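/- Let $p$ be a prime, let $0\le d<p$, and let $K\cong C_{p^{i_1}}\times\cdots\times C_{p^{i_d}}$ and $K'\cong C_{p^{j_1}}\times\cdots\times C_{p^{j_d}}$ be abelian $p$-groups of rank $d$, where $i_l,j_l\ge 1$ for all $l$, and $i_l,j_l\ge 2$ for all $l$ if $p=2$. For a group $G$, let $C^*(G;\mathbb F_p)=\operatorname{Hom}_{\mathbb F_pG}(B_*(G;\mathbb F_p),\mathbb F_p)$ be the complex of homogeneous cochains, where $B_n(G;\mathbb F_p)$ is the free $\mathbb F_p$-module on $G^{n+1}$ with the diagonal $G$-action, the differential is $$(\delta f)(g_0,\ldots,g_{n+1})=(-1)^{n+1}\sum_{i=0}^{n+1}(-1)^i f(g_0,\ldots,\widehat{g_i},\ldots,g_{n+1})\qquad(f\in C^n(G;\mathbb F_p)),$$ and the cup product is $$(f_1\cup f_2)(g_0,\ldots,g_{m+n})=(-1)^{mn}f_1(g_0,\ldots,g_m)\,f_2(g_m,\ldots,g_{m+n})\qquad(f_1\in C^m(G;\mathbb F_p),\ f_2\in C^n(G;\mathbb F_p)).$$ Let $C_{p^\infty}=\bigcup_{k\ge1}C_{p^k}$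 be the Prüfer $p$-group (as a discrete group), let $\Lambda(y_1,\ldots,y_d)$ be the exterior algebra over $\mathbb F_p$ on generators of degree $1$ with zero differential, and let $$U(p,d)=C^*(C_{p^\infty}^d;\mathbb F_p)\otimes_{\mathbb F_p}\Lambda(y_1,\ldots,y_d)$$ be the tensor product of differential graded algebras: the total complex, with differential $d(a\otimes b)=da\otimes b+(-1)^{|a|}a\otimes db$ and product $(a\otimes b)(a'\otimes b')=(-1)^{|b||a'|}aa'\otimes bb'$. Then there is a zig-zag of quasi-isomorphisms of cochain complexes (not required to respect the products) $$C^*(K;\mathbb F_p)\longleftarrow U(p,d)\longrightarrow C^*(K';\mathbb F_p)$$ such that the maps induced on cohomology are isomorphisms of rings $H^*(K;\mathbb F_p)\cong H^*(U(p,d))\cong H^*(K';\mathbb F_p)$. -/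

import Mathlib

open CategoryTheory

universe u

/-- A differential graded algebra over `k`, concentrated in degrees `n ≥ 0`, with a differential of
degree `+1`: a cochain complex with an associative unital product satisfying the Leibniz rule.
The product `X m × X n → X r` is indexed by a proof of `m + n = r`. -/
structure DGAlg (k : Type u) [CommRing k] where
  X : ℕ → Type u
  [addCommGroup : ∀ n, AddCommGroup (X n)]
  [module : ∀ n, Module k (X n)]
  d : ∀ n, X n →ₗ[k] X (n + 1)
  d_d : ∀ n (a : X n), d (n + 1) (d n a) = 0
  mul : ∀ {m n r : ℕ}, m + n = r → X m →ₗ[k] X n →ₗ[k] X r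
  one : X 0
  one_mul : ∀ {n : ℕ} (a : X n), mul (zero_add n) one a = a
  mul_one : ∀ {n : ℕ} (a : X n), mul (add_zero n) a one = a
  mul_assoc : ∀ {m n l mn nl r : ℕ} (h₁ : m + n = mn) (h₂ : mn + l = r) (h₃ : n + l = nl)
    (h₄ : m + nl = r) (a : X m) (b : X n) (c : X l),
    mul h₂ (mul h₁ a b) c = mul h₄ a (mul h₃ b c)
  leibniz : ∀ {m n r : ℕ} (h : m + n = r) (h₁ : (m + 1) + n = r + 1) (h₂ : m + (n + 1) = r + 1)
    (a : X m) (b : X n),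
    d r (mul h a b) = mul h₁ (d m a) b + (-1 : k) ^ m • mul h₂ a (d n b)

namespace DGAlg

attribute [instance] DGAlg.addCommGroup DGAlg.module

variable {k : Type u} [CommRing k]

/-- The underlying cochain complex of `k`-modules. -/
noncomputable def complex (A : DGAlg k) : CochainComplex (ModuleCat.{u} k) ℕ :=
  CochainComplex.of (fun n => ModuleCat.of k (A.X n)) (fun n => ModuleCat.ofHom (A.d n))
    (fun n => by ext a; exact A.d_d n a)

theorem complex_d (A : DGAlg k) (n : ℕ) :
    A.complex.d n (n + 1) = ModuleCat.ofHom (A.d n) :=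
  CochainComplex.of_d (fun n => ModuleCat.of k (A.X n)) (fun n => ModuleCat.ofHom (A.d n)) n

/-- The cocycles of degree `n`. -/
def cocycles (A : DGAlg k) (n : ℕ) : Submodule k (A.X n) := LinearMap.ker (A.d n)

/-- The coboundaries of degree `n`. -/
def coboundaries (A : DGAlg k) : ∀ n : ℕ, Submodule k (A.X n)
  | 0 => ⊥
  | n + 1 => LinearMap.range (A.d n)

theorem cocycles_comp_d (A : DGAlg k) (n : ℕ) :
    (ModuleCat.ofHom (A.cocycles n).subtype :
      ModuleCat.of k (A.cocycles n) ⟶ A.complex.X n) ≫ A.complex.d n (n + 1) = 0 := by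
  rw [complex_d]
  ext a
  exact a.2

/-- The inclusion of the cocycles into Mathlib's object of cycles. -/
noncomputable def toCyc (A : DGAlg k) (n : ℕ) :
    ModuleCat.of k (A.cocycles n) ⟶ A.complex.cycles n :=
  A.complex.liftCycles (ModuleCat.ofHom (A.cocycles n).subtype) (n + 1) (by simp)
    (A.cocycles_comp_d n)

/-- The cohomology class of a cocycle. -/
noncomputable def cls (A : DGAlg k) (n : ℕ) :
    A.cocycles n →ₗ[k] A.complex.homology n :=
  (A.toCyc n ≫ A.complex.homologyπ n).hom

theorem iCycles_toCyc (A : DGAlg k) (n : ℕ) (a : A.cocycles n) :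
    (A.complex.iCycles n).hom ((A.toCyc n).hom a) = (a : A.X n) := by
  have : A.toCyc n ≫ A.complex.iCycles n = ModuleCat.ofHom (A.cocycles n).subtype :=
    A.complex.liftCycles_i _ _ _ _
  exact congrArg (fun f => f.hom a) this

theorem iCycles_injective (A : DGAlg k) (n : ℕ) :
    Function.Injective (A.complex.iCycles n).hom :=
  (ModuleCat.mono_iff_injective _).1 inferInstance

theorem toCyc_surjective (A : DGAlg k) (n : ℕ) : Function.Surjective (A.toCyc n).hom := by
  intro z
  have hz : A.d n ((A.complex.iCycles n).hom z) = 0 := by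
    have := A.complex.iCycles_d n (n + 1)
    rw [complex_d] at this
    exact congrArg (fun f => f.hom z) this
  refine ⟨⟨(A.complex.iCycles n).hom z, hz⟩, ?_⟩
  apply A.iCycles_injective n
  rw [iCycles_toCyc]

theorem cls_surjective (A : DGAlg k) (n : ℕ) : Function.Surjective (A.cls n) := by
  have h : Function.Surjective (A.complex.homologyπ n).hom :=
    (ModuleCat.epi_iff_surjective _).1 inferInstance
  exact h.comp (A.toCyc_surjective n)

theorem cls_eq_zero_iff (A : DGAlg k) (n : ℕ) (a : A.cocycles n) :
    A.cls n a = 0 ↔ (a : A.X n) ∈ A.coboundaries n := by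
  have hex := ShortComplex.exact_of_g_is_cokernel
    (ShortComplex.mk (A.complex.toCycles ((ComplexShape.up ℕ).prev n) n) (A.complex.homologyπ n)
      (by simp)) (A.complex.homologyIsCokernel _ n rfl)
  have key : A.cls n a = 0 ↔ ∃ b, (A.complex.d ((ComplexShape.up ℕ).prev n) n).hom b =
      (a : A.X n) := by
    constructor
    · intro h
      obtain ⟨b, hb⟩ := (ShortComplex.moduleCat_exact_iff _).1 hex ((A.toCyc n).hom a) h
      refine ⟨b, ?_⟩
      rw [← iCycles_toCyc, ← hb, ← A.complex.toCycles_i]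
      rfl
    · rintro ⟨b, hb⟩
      have : (A.toCyc n).hom a =
          (A.complex.toCycles ((ComplexShape.up ℕ).prev n) n).hom b := by
        apply A.iCycles_injective n
        rw [iCycles_toCyc, ← hb, ← A.complex.toCycles_i]
        rfl
      change (A.complex.homologyπ n).hom ((A.toCyc n).hom a) = 0
      rw [this]
      exact congrArg (fun f => f.hom b) (A.complex.toCycles_comp_homologyπ _ n)
  rw [key]
  cases n with
  | zero =>
    have h0 : A.complex.d ((ComplexShape.up ℕ).prev 0) 0 = 0 := A.complex.shape _ _ (by simp)
    rw [h0]
    constructor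
    · rintro ⟨b, hb⟩
      exact hb.symm
    · intro h
      exact ⟨0, (show (a : A.X 0) = 0 from h).symm⟩
  | succ m =>
    rw [(ComplexShape.up ℕ).prev_eq' (show (ComplexShape.up ℕ).Rel m (m + 1) from rfl), complex_d]
    exact Iff.rfl

theorem mul_mem_cocycles (A : DGAlg k) {m n r : ℕ} (h : m + n = r) {a : A.X m} {b : A.X n}
    (ha : a ∈ A.cocycles m) (hb : b ∈ A.cocycles n) : A.mul h a b ∈ A.cocycles r := by
  change A.d _ _ = 0
  rw [A.leibniz h (by omega) (by omega), show A.d m a = 0 from ha, show A.d n b = 0 from hb]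
  simp

theorem d_one (A : DGAlg k) : A.d 0 A.one = 0 := by
  have h := A.leibniz (zero_add 0) (by omega) (by omega) A.one A.one
  rw [A.mul_one, A.mul_one (A.d 0 A.one), A.one_mul (A.d 0 A.one)] at h
  simpa using h

theorem mul_mem_coboundaries_left (A : DGAlg k) {m n r : ℕ} (h : m + n = r) {a : A.X m}
    {b : A.X n} (ha : a ∈ A.coboundaries m) (hb : b ∈ A.cocycles n) :
    A.mul h a b ∈ A.coboundaries r := by
  cases m with
  | zero =>
    rw [show a = 0 from ha]
    simp
  | succ m =>
    obtain ⟨c, rfl⟩ := ha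
    obtain rfl : r = (m + n) + 1 := by omega
    refine ⟨A.mul rfl c b, ?_⟩
    rw [A.leibniz rfl h (by omega), show A.d n b = 0 from hb]
    simp

theorem mul_mem_coboundaries_right (A : DGAlg k) {m n r : ℕ} (h : m + n = r) {a : A.X m}
    {b : A.X n} (ha : a ∈ A.cocycles m) (hb : b ∈ A.coboundaries n) :
    A.mul h a b ∈ A.coboundaries r := by
  cases n with
  | zero =>
    rw [show b = 0 from hb]
    simp
  | succ n =>
    obtain ⟨c, rfl⟩ := hb
    obtain rfl : r = (m + n) + 1 := by omega
    refine ⟨(-1 : k) ^ m • A.mul rfl a c, ?_⟩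
    rw [map_smul, A.leibniz rfl (by omega) h, show A.d m a = 0 from ha]
    simp [smul_smul, ← mul_pow]

/-- The product on cocycles. -/
def cocyclesMul (A : DGAlg k) {m n r : ℕ} (h : m + n = r) :
    A.cocycles m →ₗ[k] A.cocycles n →ₗ[k] A.cocycles r :=
  LinearMap.mk₂ k (fun a b => ⟨A.mul h a b, A.mul_mem_cocycles h a.2 b.2⟩)
    (fun a a' b => by ext; simp) (fun c a b => by ext; simp)
    (fun a b b' => by ext; simp) (fun c a b => by ext; simp)

theorem cls_mul_congr (A : DGAlg k) {m n r : ℕ} (h : m + n = r) {a a' : A.cocycles m}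
    {b b' : A.cocycles n} (ha : A.cls m a = A.cls m a') (hb : A.cls n b = A.cls n b') :
    A.cls r (A.cocyclesMul h a b) = A.cls r (A.cocyclesMul h a' b') := by
  rw [← sub_eq_zero, ← map_sub, cls_eq_zero_iff] at ha hb
  rw [← sub_eq_zero, ← map_sub, cls_eq_zero_iff]
  have e : ((A.cocyclesMul h a b - A.cocyclesMul h a' b' : A.cocycles r) : A.X r) =
      A.mul h ((a - a' : A.cocycles m) : A.X m) b +
        A.mul h (a' : A.X m) ((b - b' : A.cocycles n) : A.X n) := by
    simp [cocyclesMul]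
  rw [e]
  exact add_mem (A.mul_mem_coboundaries_left h ha b.2) (A.mul_mem_coboundaries_right h a'.2 hb)

/-- The product `[a] ∪ [b] = [a ∪ b]` on cohomology. -/
noncomputable def hmul (A : DGAlg k) {m n r : ℕ} (h : m + n = r) (x : A.complex.homology m)
    (y : A.complex.homology n) : A.complex.homology r :=
  A.cls r (A.cocyclesMul h (Function.surjInv (A.cls_surjective m) x)
    (Function.surjInv (A.cls_surjective n) y))

theorem hmul_cls (A : DGAlg k) {m n r : ℕ} (h : m + n = r) (a : A.cocycles m)
    (b : A.cocycles n) :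
    A.hmul h (A.cls m a) (A.cls n b) = A.cls r (A.cocyclesMul h a b) :=
  A.cls_mul_congr h (Function.surjInv_eq _ _) (Function.surjInv_eq _ _)

/-- The class of the unit. -/
noncomputable def hone (A : DGAlg k) : A.complex.homology 0 := A.cls 0 ⟨A.one, A.d_one⟩

theorem hmul_add (A : DGAlg k) {m n r : ℕ} (h : m + n = r) (x : A.complex.homology m)
    (y y' : A.complex.homology n) :
    A.hmul h x (y + y') = A.hmul h x y + A.hmul h x y' := by
  obtain ⟨a, rfl⟩ := A.cls_surjective m x
  obtain ⟨b, rfl⟩ := A.cls_surjective n y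
  obtain ⟨b', rfl⟩ := A.cls_surjective n y'
  rw [← map_add, hmul_cls, hmul_cls, hmul_cls, map_add, map_add]

theorem add_hmul (A : DGAlg k) {m n r : ℕ} (h : m + n = r) (x x' : A.complex.homology m)
    (y : A.complex.homology n) :
    A.hmul h (x + x') y = A.hmul h x y + A.hmul h x' y := by
  obtain ⟨a, rfl⟩ := A.cls_surjective m x
  obtain ⟨a', rfl⟩ := A.cls_surjective m x'
  obtain ⟨b, rfl⟩ := A.cls_surjective n y
  rw [← map_add, hmul_cls, hmul_cls, hmul_cls, map_add, LinearMap.add_apply, map_add]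

theorem hmul_zero (A : DGAlg k) {m n r : ℕ} (h : m + n = r) (x : A.complex.homology m) :
    A.hmul h x (0 : A.complex.homology n) = 0 := by
  simpa using A.hmul_add h x 0 0

theorem zero_hmul (A : DGAlg k) {m n r : ℕ} (h : m + n = r) (y : A.complex.homology n) :
    A.hmul h (0 : A.complex.homology m) y = 0 := by
  simpa using A.add_hmul h 0 0 y

theorem hone_hmul (A : DGAlg k) {n : ℕ} (x : A.complex.homology n) :
    A.hmul (zero_add n) A.hone x = x := by
  obtain ⟨a, rfl⟩ := A.cls_surjective n x
  rw [hone, hmul_cls]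
  congr 1
  exact Subtype.ext (A.one_mul _)

theorem hmul_hone (A : DGAlg k) {n : ℕ} (x : A.complex.homology n) :
    A.hmul (add_zero n) x A.hone = x := by
  obtain ⟨a, rfl⟩ := A.cls_surjective n x
  rw [hone, hmul_cls]
  congr 1
  exact Subtype.ext (A.mul_one _)

theorem hmul_assoc (A : DGAlg k) {m n l mn nl r : ℕ} (h₁ : m + n = mn) (h₂ : mn + l = r)
    (h₃ : n + l = nl) (h₄ : m + nl = r) (x : A.complex.homology m) (y : A.complex.homology n)
    (z : A.complex.homology l) :
    A.hmul h₂ (A.hmul h₁ x y) z = A.hmul h₄ x (A.hmul h₃ y z) := by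
  obtain ⟨a, rfl⟩ := A.cls_surjective m x
  obtain ⟨b, rfl⟩ := A.cls_surjective n y
  obtain ⟨c, rfl⟩ := A.cls_surjective l z
  rw [hmul_cls, hmul_cls, hmul_cls, hmul_cls]
  congr 1
  exact Subtype.ext (A.mul_assoc h₁ h₂ h₃ h₄ _ _ _)

theorem sigma_eq_of_hmul (A : DGAlg k) {m n r r' : ℕ} (h : m + n = r) (h' : m + n = r')
    (x : A.complex.homology m) (y : A.complex.homology n) :
    (GradedMonoid.mk r (A.hmul h x y) : GradedMonoid fun n => A.complex.homology n) =
      GradedMonoid.mk r' (A.hmul h' x y) := by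
  subst h
  subst h'
  rfl

noncomputable instance hgmul (A : DGAlg k) :
    GradedMonoid.GMul (fun n : ℕ => A.complex.homology n) where
  mul x y := A.hmul rfl x y

noncomputable instance hgone (A : DGAlg k) :
    GradedMonoid.GOne (fun n : ℕ => A.complex.homology n) where
  one := A.hone

noncomputable instance hgmonoid (A : DGAlg k) :
    GradedMonoid.GMonoid (fun n : ℕ => A.complex.homology n) where
  one_mul x := (A.sigma_eq_of_hmul _ _ _ _).trans (congrArg _ (A.hone_hmul x.2))
  mul_one x := (A.sigma_eq_of_hmul _ _ _ _).trans (congrArg _ (A.hmul_hone x.2))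
  mul_assoc x y z := (A.sigma_eq_of_hmul _ _ _ _).trans
    (congrArg _ (A.hmul_assoc rfl (add_assoc _ _ _) rfl rfl x.2 y.2 z.2))

/-- The cohomology modules of a differential graded algebra form a graded ring under
`[a] ∪ [b] = [a ∪ b]`. -/
noncomputable instance hgring (A : DGAlg k) :
    DirectSum.GRing (fun n : ℕ => A.complex.homology n) where
  mul_zero x := A.hmul_zero rfl x
  zero_mul y := A.zero_hmul rfl y
  mul_add x y y' := A.hmul_add rfl x y y'
  add_mul x x' y := A.add_hmul rfl x x' y
  natCast n := n • A.hone
  natCast_zero := zero_smul _ _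
  natCast_succ _ := succ_nsmul _ _
  intCast n := n • A.hone
  intCast_ofNat _ := natCast_zsmul _ _
  intCast_negSucc_ofNat _ := negSucc_zsmul _ _

/-- The cohomology ring `H^*(A) = ⨁ₙ Hⁿ(A)` of a differential graded algebra. -/
abbrev Cohomology (A : DGAlg k) : Type u := DirectSum ℕ fun n => A.complex.homology n

/-- The map `⨁ₙ Hⁿ(A) → ⨁ₙ Hⁿ(B)` induced by a cochain map (which need not respect products). -/
noncomputable def cohomologyMap {A B : DGAlg k} (φ : A.complex ⟶ B.complex) :
    A.Cohomology →ₗ[k] B.Cohomology :=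
  DirectSum.lmap fun n => (HomologicalComplex.homologyMap φ n).hom

/-- The map induced on cohomology by the cochain map `φ` is an isomorphism of rings. -/
def InducesRingIso {A B : DGAlg k} (φ : A.complex ⟶ B.complex) : Prop :=
  ∃ e : A.Cohomology ≃+* B.Cohomology, ∀ x, e x = cohomologyMap φ x

end DGAlg

section Tensor

open scoped TensorProduct

variable {k : Type u} [CommRing k]

namespace DGAlg

/-- The degree `n` part `⨁_{i + j = n} Aⁱ ⊗ Bʲ` of the tensor product. -/
abbrev TensorX (A B : DGAlg k) (n : ℕ) : Type u :=
  DirectSum {ij : ℕ × ℕ // ij.1 + ij.2 = n} fun ij => A.X ij.1.1 ⊗[k] B.X ij.1.2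

/-- `a ⊗ b` as an element of the tensor product. -/
noncomputable def tmul (A B : DGAlg k) {i j n : ℕ} (h : i + j = n) :
    A.X i →ₗ[k] B.X j →ₗ[k] TensorX A B n :=
  (TensorProduct.mk k (A.X i) (B.X j)).compr₂
    (DirectSum.lof k {ij : ℕ × ℕ // ij.1 + ij.2 = n}
      (fun ij => A.X ij.1.1 ⊗[k] B.X ij.1.2) ⟨(i, j), h⟩)

/-- The linear map out of the tensor product with prescribed values on the `a ⊗ b`. -/
noncomputable def tdesc {A B : DGAlg k} {n : ℕ} {P : Type u} [AddCommGroup P] [Module k P]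
    (f : ∀ i j : ℕ, i + j = n → A.X i →ₗ[k] B.X j →ₗ[k] P) : TensorX A B n →ₗ[k] P :=
  DirectSum.toModule k _ P fun ij => TensorProduct.lift (f ij.1.1 ij.1.2 ij.2)

theorem tdesc_tmul {A B : DGAlg k} {n : ℕ} {P : Type u} [AddCommGroup P] [Module k P]
    (f : ∀ i j : ℕ, i + j = n → A.X i →ₗ[k] B.X j →ₗ[k] P) {i j : ℕ} (h : i + j = n)
    (a : A.X i) (b : B.X j) : tdesc f (tmul A B h a b) = f i j h a b := by
  simp only [tdesc, tmul, LinearMap.compr₂_apply, DirectSum.toModule_lof, TensorProduct.mk_apply,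
    TensorProduct.lift.tmul]

theorem tensor_hom_ext {A B : DGAlg k} {n : ℕ} {P : Type u} [AddCommGroup P] [Module k P]
    {f g : TensorX A B n →ₗ[k] P}
    (h : ∀ (i j : ℕ) (h : i + j = n) (a : A.X i) (b : B.X j),
      f (tmul A B h a b) = g (tmul A B h a b)) : f = g := by
  apply DirectSum.linearMap_ext
  rintro ⟨⟨i, j⟩, hij⟩
  apply TensorProduct.ext'
  intro a b
  exact h i j hij a b

theorem tmul_congr (A B : DGAlg k) {i j n : ℕ} (h : i + j = n) {s t : k} {a a' : A.X i}
    {b b' : B.X j} (hs : s = t) (ha : a = a') (hb : b = b') :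
    s • tmul A B h a b = t • tmul A B h a' b' := by
  rw [hs, ha, hb]

/-- The differential `a ⊗ b ↦ da ⊗ b + (-1)^i a ⊗ db` for `a` of degree `i`. -/
noncomputable def tensorD (A B : DGAlg k) (n : ℕ) : TensorX A B n →ₗ[k] TensorX A B (n + 1) :=
  tdesc fun i j h =>
    (tmul A B (show (i + 1) + j = n + 1 by omega)).comp (A.d i) +
      (-1 : k) ^ i • (tmul A B (show i + (j + 1) = n + 1 by omega)).compl₂ (B.d j)

theorem tensorD_tmul (A B : DGAlg k) {i j n : ℕ} (h : i + j = n) (a : A.X i) (b : B.X j) :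
    tensorD A B n (tmul A B h a b) =
      tmul A B (show (i + 1) + j = n + 1 by omega) (A.d i a) b +
        (-1 : k) ^ i • tmul A B (show i + (j + 1) = n + 1 by omega) a (B.d j b) := by
  rw [tensorD, tdesc_tmul]
  rfl

/-- The product `(a ⊗ b)(a' ⊗ b') = (-1)^(|b||a'|) aa' ⊗ bb'`. -/
noncomputable def tensorMul (A B : DGAlg k) {m n r : ℕ} (h : m + n = r) :
    TensorX A B m →ₗ[k] TensorX A B n →ₗ[k] TensorX A B r :=
  tdesc fun i j hij => LinearMap.mk₂ k
    (fun a b => tdesc fun i' j' hij' => LinearMap.mk₂ k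
      (fun a' b' => (-1 : k) ^ (j * i') •
        tmul A B (show (i + i') + (j + j') = r by omega) (A.mul rfl a a') (B.mul rfl b b'))
      (fun _ _ _ => by simp) (fun _ _ _ => by simp [smul_smul, mul_comm])
      (fun _ _ _ => by simp) (fun _ _ _ => by simp [smul_smul, mul_comm]))
    (fun _ _ _ => by
      apply tensor_hom_ext
      intro i' j' h' a' b'
      simp [tdesc_tmul])
    (fun _ _ _ => by
      apply tensor_hom_ext
      intro i' j' h' a' b'
      simp [tdesc_tmul, smul_smul, mul_comm])
    (fun _ _ _ => by
      apply tensor_hom_ext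
      intro i' j' h' a' b'
      simp [tdesc_tmul])
    (fun _ _ _ => by
      apply tensor_hom_ext
      intro i' j' h' a' b'
      simp [tdesc_tmul, smul_smul, mul_comm])

theorem tensorMul_tmul (A B : DGAlg k) {m n r i j i' j' i'' j'' : ℕ} (h : m + n = r)
    (hm : i + j = m) (hn : i' + j' = n) (hi : i + i' = i'') (hj : j + j' = j'')
    (hr : i'' + j'' = r) (a : A.X i) (b : B.X j) (a' : A.X i') (b' : B.X j') :
    tensorMul A B h (tmul A B hm a b) (tmul A B hn a' b') =
      (-1 : k) ^ (j * i') • tmul A B hr (A.mul hi a a') (B.mul hj b b') := by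
  subst hi
  subst hj
  rw [tensorMul, tdesc_tmul, LinearMap.mk₂_apply, tdesc_tmul, LinearMap.mk₂_apply]

theorem tensor_ind {A B : DGAlg k} {n : ℕ} {p : TensorX A B n → Prop} (h0 : p 0)
    (hadd : ∀ x y, p x → p y → p (x + y))
    (h : ∀ (i j : ℕ) (h : i + j = n) (a : A.X i) (b : B.X j), p (tmul A B h a b))
    (x : TensorX A B n) : p x := by
  induction x using DirectSum.induction_on with
  | zero => exact h0
  | of ij x =>
    obtain ⟨⟨i, j⟩, hij⟩ := ij
    induction x using TensorProduct.induction_on with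
    | zero => rw [map_zero]; exact h0
    | tmul a b => exact h i j hij a b
    | add x y hx hy => rw [map_add]; exact hadd _ _ hx hy
  | add x y hx hy => exact hadd _ _ hx hy

/-- The tensor product of two differential graded algebras: the total complex of the tensor product
double complex, with the product `(a ⊗ b)(a' ⊗ b') = (-1)^(|b||a'|) aa' ⊗ bb'`. -/
noncomputable def tensor (A B : DGAlg k) : DGAlg k where
  X := TensorX A B
  d := tensorD A B
  d_d n x := by
    induction x using tensor_ind with
    | h0 => simp
    | hadd x y hx hy => simp [hx, hy]
    | h i j h a b =>
      simp only [tensorD_tmul, map_add, map_smul, A.d_d, B.d_d, map_zero, LinearMap.zero_apply,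
        smul_zero, add_zero, zero_add]
      rw [← add_smul]
      simp [pow_succ]
  mul := tensorMul A B
  one := tmul A B (zero_add 0) A.one B.one
  one_mul {n} x := by
    induction x using tensor_ind with
    | h0 => simp
    | hadd x y hx hy => simp only [map_add, hx, hy]
    | h i j h a b =>
      rw [tensorMul_tmul A B _ _ _ (zero_add i) (zero_add j) h, A.one_mul, B.one_mul]
      simp
  mul_one {n} x := by
    induction x using tensor_ind with
    | h0 => simp
    | hadd x y hx hy => simp only [map_add, LinearMap.add_apply, hx, hy]
    | h i j h a b =>
      rw [tensorMul_tmul A B _ _ _ (add_zero i) (add_zero j) h, A.mul_one, B.mul_one]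
      simp
  mul_assoc {m n l mn nl r} h₁ h₂ h₃ h₄ x y z := by
    induction x using tensor_ind with
    | h0 => simp
    | hadd x x' hx hx' => simp only [map_add, LinearMap.add_apply, hx, hx']
    | h i j h a b =>
    induction y using tensor_ind with
    | h0 => simp
    | hadd y y' hy hy' => simp only [map_add, LinearMap.add_apply, hy, hy']
    | h i' j' h' a' b' =>
    induction z using tensor_ind with
    | h0 => simp
    | hadd z z' hz hz' => simp only [map_add, hz, hz']
    | h i'' j'' h'' a'' b'' =>
      rw [tensorMul_tmul A B h₁ h h' rfl rfl (by omega),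
        tensorMul_tmul A B h₃ h' h'' rfl rfl (by omega), map_smul, LinearMap.smul_apply, map_smul,
        tensorMul_tmul A B h₂ (by omega) h'' rfl rfl (by omega),
        tensorMul_tmul A B h₄ h (by omega) (i'' := i + i' + i'') (j'' := j + j' + j'') (by omega)
          (by omega) (by omega), smul_smul, smul_smul]
      apply tmul_congr
      · ring
      · exact A.mul_assoc _ _ _ _ _ _ _
      · exact B.mul_assoc _ _ _ _ _ _ _
  leibniz {m n r} h h₁ h₂ x y := by
    induction x using tensor_ind with
    | h0 => simp
    | hadd x x' hx hx' =>
      simp only [map_add, LinearMap.add_apply, hx, hx', smul_add]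
      abel
    | h i j h a b =>
    induction y using tensor_ind with
    | h0 => simp
    | hadd y y' hy hy' =>
      simp only [map_add, hy, hy', smul_add]
      abel
    | h i' j' h' a' b' =>
      rw [tensorMul_tmul A B _ _ _ rfl rfl (by omega), map_smul, tensorD_tmul, tensorD_tmul,
        tensorD_tmul, A.leibniz rfl (by omega) (by omega), B.leibniz rfl (by omega) (by omega)]
      simp only [map_add, map_smul, LinearMap.add_apply, LinearMap.smul_apply, smul_add, smul_smul]
      rw [tensorMul_tmul A B h₁ _ _ (i'' := i + i' + 1) (j'' := j + j') (by omega) (by omega)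
          (by omega),
        tensorMul_tmul A B h₁ _ _ (i'' := i + i') (j'' := j + j' + 1) (by omega) (by omega)
          (by omega),
        tensorMul_tmul A B h₂ _ _ (i'' := i + i' + 1) (j'' := j + j') (by omega) (by omega)
          (by omega),
        tensorMul_tmul A B h₂ _ _ (i'' := i + i') (j'' := j + j' + 1) (by omega) (by omega)
          (by omega)]
      simp only [smul_smul]
      have e1 : (-1 : k) ^ i * (-1 : k) ^ ((j + 1) * i') =
          (-1 : k) ^ (j * i') * (-1 : k) ^ (i + i') := by ring
      have e2 : (-1 : k) ^ m * (-1 : k) ^ (j * (i' + 1)) =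
          (-1 : k) ^ (j * i') * (-1 : k) ^ i := by
        have e : (-1 : k) ^ j * (-1 : k) ^ j = 1 := by rw [← mul_pow]; simp
        rw [← h, pow_add, mul_add, pow_add, _root_.mul_one]
        linear_combination (-1 : k) ^ i * (-1 : k) ^ (j * i') * e
      have e3 : (-1 : k) ^ m * (-1 : k) ^ i' * (-1 : k) ^ (j * i') =
          (-1 : k) ^ (j * i') * ((-1 : k) ^ (i + i') * (-1 : k) ^ j) := by
        rw [← h]
        ring
      rw [e1, e2, e3]
      abel

end DGAlg

end Tensor

section Exterior

/-- The exterior algebra `Λ(y₁, …, y_d)` over `k` on `d` generators of degree `1`, with zero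
differential. -/
noncomputable def exteriorDGAlg (k : Type u) [CommRing k] (d : ℕ) : DGAlg k where
  X n := ⋀[k]^n (Fin d → k)
  d _ := 0
  d_d _ _ := rfl
  mul {m n r} h := LinearMap.mk₂ k
    (fun a b => ⟨(a : ExteriorAlgebra k (Fin d → k)) * b, h ▸ SetLike.mul_mem_graded a.2 b.2⟩)
    (fun _ _ _ => Subtype.ext (add_mul _ _ _)) (fun _ _ _ => Subtype.ext (smul_mul_assoc _ _ _))
    (fun _ _ _ => Subtype.ext (mul_add _ _ _)) (fun _ _ _ => Subtype.ext (mul_smul_comm _ _ _))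
  one := ⟨1, SetLike.one_mem_graded fun n : ℕ => ⋀[k]^n (Fin d → k)⟩
  one_mul _ := Subtype.ext (one_mul _)
  mul_one _ := Subtype.ext (mul_one _)
  mul_assoc _ _ _ _ _ _ _ := Subtype.ext (mul_assoc _ _ _)
  leibniz _ _ _ _ _ := Subtype.ext (by simp)

end Exterior

namespace GroupCochains

variable (k : Type u) [CommRing k] (G : Type u) [Group G]

/-- `Cⁿ(G; k) = Hom_{kG}(Bₙ(G; k), k)`, where `Bₙ(G; k)` is the free `k`-module on `G^(n+1)` with
diagonal `G`-action and `k` is the trivial module: the functions on `G^(n+1)` that are invariant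
under the diagonal action. -/
def cochains (n : ℕ) : Submodule k ((Fin (n + 1) → G) → k) where
  carrier := {f | ∀ (g : G) (x : Fin (n + 1) → G), f (fun i => g * x i) = f x}
  add_mem' hf hf' g x := by simp only [Pi.add_apply, hf g x, hf' g x]
  zero_mem' _ _ := rfl
  smul_mem' c f hf g x := by simp only [Pi.smul_apply, hf g x]

variable {k G}

/-- The differential `(δf)(g₀, …, g_{n+1}) = (-1)^(n+1) ∑ᵢ (-1)^i f(g₀, …, ĝᵢ, …, g_{n+1})`. -/
def diff (n : ℕ) : cochains k G n →ₗ[k] cochains k G (n + 1) where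
  toFun f := ⟨fun x => (-1) ^ (n + 1) * ∑ i : Fin (n + 2), (-1) ^ (i : ℕ) * f.1 (x ∘ i.succAbove),
    fun g x => by
      exact congrArg _ <| Finset.sum_congr rfl fun i _ => congrArg _ (f.2 g (x ∘ i.succAbove))⟩
  map_add' f f' := by
    ext x
    simp [mul_add, Finset.sum_add_distrib]
  map_smul' c f := by
    ext x
    simp only [Submodule.coe_smul, Pi.smul_apply, smul_eq_mul, RingHom.id_apply, Finset.mul_sum]
    exact Finset.sum_congr rfl fun i _ => by ring

/-- The cup product
`(f₁ ∪ f₂)(g₀, …, g_{m+n}) = (-1)^(mn) f₁(g₀, …, g_m) f₂(g_m, …, g_{m+n})`. -/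
def cup {m n r : ℕ} (h : m + n = r) :
    cochains k G m →ₗ[k] cochains k G n →ₗ[k] cochains k G r :=
  LinearMap.mk₂ k
    (fun f₁ f₂ => ⟨fun x => (-1) ^ (m * n) *
        (f₁.1 (fun i => x ⟨i, by omega⟩) * f₂.1 (fun i => x ⟨m + i, by omega⟩)),
      fun g x => congrArg _ (congrArg₂ _ (f₁.2 g _) (f₂.2 g _))⟩)
    (fun _ _ _ => by ext x; simp only [Submodule.coe_add, Pi.add_apply]; ring)
    (fun _ _ _ => by ext x; simp only [Submodule.coe_smul, Pi.smul_apply, smul_eq_mul]; ring)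
    (fun _ _ _ => by ext x; simp only [Submodule.coe_add, Pi.add_apply]; ring)
    (fun _ _ _ => by ext x; simp only [Submodule.coe_smul, Pi.smul_apply, smul_eq_mul]; ring)

/-- The value of a cochain on the first terms of a sequence. -/
def ev {n : ℕ} (f : cochains k G n) (x : ℕ → G) : k := f.1 fun i => x i

theorem ext_ev {n : ℕ} {f f' : cochains k G n} (h : ∀ x : ℕ → G, ev f x = ev f' x) : f = f' := by
  ext x
  have e : (fun i : Fin (n + 1) => (fun j : ℕ => if hj : j < n + 1 then x ⟨j, hj⟩ else 1) i) =
      x := by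
    funext i
    exact dif_pos i.2
  have := h fun j : ℕ => if hj : j < n + 1 then x ⟨j, hj⟩ else 1
  rw [ev, ev, e] at this
  exact this

/-- The increasing map `ℕ → ℕ` that omits the value `i`. -/
def skip (i j : ℕ) : ℕ := if j < i then j else j + 1

theorem ev_diff {n : ℕ} (f : cochains k G n) (x : ℕ → G) :
    ev (diff n f) x =
      (-1) ^ (n + 1) * ∑ i ∈ Finset.range (n + 2), (-1) ^ i * ev f (x ∘ skip i) := by
  rw [Finset.sum_range]
  simp only [ev, diff, LinearMap.coe_mk, AddHom.coe_mk]
  congr 1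
  refine Finset.sum_congr rfl fun i _ => ?_
  refine congrArg _ (congrArg f.1 ?_)
  funext j
  simp only [Function.comp, skip, Fin.succAbove, Fin.lt_def, Fin.val_castSucc]
  split_ifs <;> rfl

theorem ev_cup {m n r : ℕ} (h : m + n = r) (f₁ : cochains k G m) (f₂ : cochains k G n)
    (x : ℕ → G) :
    ev (cup h f₁ f₂) x = (-1) ^ (m * n) * (ev f₁ x * ev f₂ fun i => x (m + i)) := rfl

theorem skip_skip {i j : ℕ} (h : i ≤ j) : skip i ∘ skip j = skip (j + 1) ∘ skip i := by
  funext a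
  simp only [Function.comp, skip]
  split_ifs <;> omega

theorem ev_congr {n : ℕ} (f : cochains k G n) {x y : ℕ → G} (h : ∀ i, i ≤ n → x i = y i) :
    ev f x = ev f y := by
  exact congrArg f.1 (funext fun i => h i (by omega))

theorem diff_diff (n : ℕ) (f : cochains k G n) : diff (n + 1) (diff n f) = 0 := by
  apply ext_ev
  intro x
  have key : ∑ i ∈ Finset.range (n + 3), ∑ j ∈ Finset.range (n + 2),
      (-1 : k) ^ i * ((-1) ^ j * ev f (x ∘ skip i ∘ skip j)) = 0 := by
    rw [← Finset.sum_product', ← Finset.sum_filter_add_sum_filter_not _ (fun ij => ij.1 ≤ ij.2),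
      ← eq_neg_iff_add_eq_zero, ← Finset.sum_neg_distrib]
    refine Finset.sum_bij (fun ij _ => (ij.2 + 1, ij.1)) ?_ ?_ ?_ ?_
    · rintro ⟨i, j⟩ h
      simp only [Finset.mem_filter, Finset.mem_product, Finset.mem_range] at h ⊢
      omega
    · rintro ⟨i, j⟩ _ ⟨i', j'⟩ _ h
      simp only [Prod.mk.injEq] at h ⊢
      omega
    · rintro ⟨i, j⟩ h
      simp only [Finset.mem_filter, Finset.mem_product, Finset.mem_range] at h
      refine ⟨(j, i - 1), ?_, ?_⟩
      · simp only [Finset.mem_filter, Finset.mem_product, Finset.mem_range]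
        omega
      · simp only [Prod.mk.injEq, and_true]
        omega
    · rintro ⟨i, j⟩ h
      simp only [Finset.mem_filter] at h
      simp only [skip_skip h.2]
      ring
  rw [ev_diff]
  simp only [ev_diff, Finset.mul_sum]
  rw [show ev (0 : cochains k G (n + 1 + 1)) x = 0 from rfl,
    ← mul_zero ((-1 : k) ^ (n + 1 + 1) * (-1 : k) ^ (n + 1)), ← key, Finset.mul_sum]
  refine Finset.sum_congr rfl fun i _ => ?_
  rw [Finset.mul_sum]
  refine Finset.sum_congr rfl fun j _ => ?_
  rw [Function.comp_assoc]
  ring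

theorem diff_cup {m n r : ℕ} (h : m + n = r) (h₁ : (m + 1) + n = r + 1)
    (h₂ : m + (n + 1) = r + 1) (a : cochains k G m) (b : cochains k G n) :
    diff r (cup h a b) = cup h₁ (diff m a) b + (-1 : k) ^ m • cup h₂ a (diff n b) := by
  apply ext_ev
  intro x
  have hadd : ∀ (c : k) (f f' : cochains k G (r + 1)), ev (f + c • f') x = ev f x + c * ev f' x :=
    fun _ _ _ => rfl
  rw [hadd, ev_diff, ev_cup, ev_cup, ev_diff, ev_diff]
  simp only [ev_cup]
  subst h
  have hs : Finset.range (m + n + 2) = Finset.range ((m + 1) + (n + 1)) := by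
    congr 1
    omega
  rw [hs, Finset.sum_range_add, Finset.sum_range_succ _ (m + 1), Finset.sum_range_succ' _ (n + 1)]
  have e1 : ∀ i ∈ Finset.range (m + 1),
      (-1 : k) ^ i * ((-1) ^ (m * n) * (ev a (x ∘ skip i) *
        ev b fun j => (x ∘ skip i) (m + j))) =
      (-1) ^ (m * n) * ((-1) ^ i * ev a (x ∘ skip i)) * ev b fun j => x (m + 1 + j) := by
    intro i hi
    rw [Finset.mem_range] at hi
    have : (fun j => (x ∘ skip i) (m + j)) = fun j => x (m + 1 + j) := by
      funext j
      simp only [Function.comp, skip]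
      rw [if_neg (by omega)]
      congr 1
      omega
    rw [this]
    ring
  have e2 : ∀ i ∈ Finset.range (n + 1),
      (-1 : k) ^ (m + 1 + i) * ((-1) ^ (m * n) * (ev a (x ∘ skip (m + 1 + i)) *
        ev b fun j => (x ∘ skip (m + 1 + i)) (m + j))) =
      (-1) ^ m * (-1) ^ (m * n) * ev a x *
        ((-1) ^ (i + 1) * ev b ((fun j => x (m + j)) ∘ skip (i + 1))) := by
    intro i _
    have h1 : ev a (x ∘ skip (m + 1 + i)) = ev a x := ev_congr a fun j hj => by
      simp only [Function.comp, skip]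
      rw [if_pos (by omega)]
    have h2 : (fun j => (x ∘ skip (m + 1 + i)) (m + j)) =
        (fun j => x (m + j)) ∘ skip (i + 1) := by
      funext j
      simp only [Function.comp, skip]
      split_ifs <;> first | rfl | omega
    rw [h1, h2]
    ring
  have e3 : ev a (x ∘ skip (m + 1)) = ev a x := ev_congr a fun j hj => by
    simp only [Function.comp, skip]
    rw [if_pos (by omega)]
  have e4 : ((fun j => x (m + j)) ∘ skip 0) = fun j => x (m + 1 + j) := by
    funext j
    simp only [Function.comp, skip]
    rw [if_neg (by omega)]
    congr 1
    omega
  rw [Finset.sum_congr rfl e1, Finset.sum_congr rfl e2, e3, e4, ← Finset.sum_mul,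
    ← Finset.mul_sum, ← Finset.mul_sum]
  have q1 : (-1 : k) ^ ((m + 1) * n) = (-1) ^ (m * n) * (-1) ^ n := by ring
  have q2 : (-1 : k) ^ (m * (n + 1)) = (-1) ^ (m * n) * (-1) ^ m := by ring
  rw [q1, q2]
  simp only [pow_add, pow_one, pow_zero]
  ring

end GroupCochains

/-- The differential graded algebra `C^*(G; k)` of homogeneous cochains of the group `G` with
coefficients in the trivial module `k`. -/
def groupCochains (k : Type u) [CommRing k] (G : Type u) [Group G] : DGAlg k where
  X n := GroupCochains.cochains k G n
  d := GroupCochains.diff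
  d_d := GroupCochains.diff_diff
  mul := GroupCochains.cup
  one := ⟨fun _ => 1, fun _ _ => rfl⟩
  one_mul f := GroupCochains.ext_ev fun x => by
    rw [GroupCochains.ev_cup]
    simp [GroupCochains.ev]
  mul_one f := GroupCochains.ext_ev fun x => by
    rw [GroupCochains.ev_cup]
    simp [GroupCochains.ev]
  mul_assoc {m n l mn nl r} h₁ h₂ h₃ h₄ a b c := GroupCochains.ext_ev fun x => by
    subst h₁
    subst h₃
    simp only [GroupCochains.ev_cup, add_assoc]
    ring
  leibniz := GroupCochains.diff_cup

/-- The Prüfer `p`-group `C_{p^∞} = ⋃ₖ C_{p^k}`: the group of complex `p`-power roots of unity. -/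
abbrev PruferGroup (p : ℕ) : Type := CommGroup.primaryComponent ℂˣ p

/-- `U(p, d) = C^*(C_{p^∞}^d; 𝔽_p) ⊗ Λ(y₁, …, y_d)`. -/
noncomputable def universalDGAlg (p d : ℕ) : DGAlg (ZMod p) :=
  (groupCochains (ZMod p) (Fin d → PruferGroup p)).tensor (exteriorDGAlg (ZMod p) d)

/-!
It suffices to map `U(p, d)` to `C^*(K; 𝔽_p)` for one group `K`, since `U(p, d)` does not depend on
the exponents. Let `X = C_{p^∞}^d` and embed `K` into `X` factor by factor. The subgroups of `X`
whose first `m` coordinates lie in the factors of `K` form a chain `X = A₀ ⊇ A₁ ⊇ ⋯ ⊇ A_d = K` in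
which every quotient `A_m / A_{m + 1}` is a Prüfer group. All cohomology groups are computed by
invariant cochains on `X` itself; restriction from `K`-invariant cochains on `X` to invariant
cochains on `K` is an isomorphism in cohomology because `X` retracts equivariantly onto `K`
(`exists_pull_eq`, `exists_dT_eq_of_pull_eq_dT`).

The main step (`IsRootTower`) concerns subgroups `B ≤ A` such that `A` is generated by `B` and a
system of `p`-power roots `t_j` of an element `t_0` of `B`, where `t_0` is detected by a character
`r` of `B`. Let `y` be the class of `r`. Then `H^*(B) = H^*(A) ⊕ H^*(A) y`. To see this, consider
the sequences `((t_j - 1) f)_j` for `B`-invariant cochains `f`. They lie in the telescope, the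
inverse limit `T` of the `B`-invariant cochains along the maps
`1 + t_{j + 1} + ⋯ + t_{j + 1}^(p - 1)`, and they are exactly the elements of `T` whose
first term vanishes (`exists_tr_sub_eq`), while the first terms of all elements of `T` are
`A`-invariant (`zero_mem_inv`). Each of the `p` translations is homotopic to the identity,
so the transition maps are null-homotopic in characteristic `p`; as `1` minus the shift is
surjective on sequences, `T` is acyclic
(`exists_dT_eq_of_mem_telescope`). Hence the obstruction to representing a class of `B` by an
`A`-invariant cocycle is a class of `A` of one degree less, and the product of an `A`-invariant
cocycle with `y` has that cocycle, up to a nonzero factor, as its obstruction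
(`exists_eq_add_cupR_add_dT`, `exists_dT_eq_of_add_cupR_eq_dT`).

Iterating along the chain, `H^*(K)` is free over `H^*(X)`, acting through restriction, with the
ordered products of the `d` classes `y_l` of the coordinates modulo `p` as a basis. These classes
commute with all classes in the graded sense, and their linear combinations have square zero: a
character `χ` with `q (g h) = q g + q h + χ g χ h` for a function `q` has square zero, and `q` is
`χ ^ 2 / 2` if `p` is odd and comes from the second binary digit if `p = 2`, which exists
because the exponents are at least `2`. So the `y_l` define a homomorphism from the exterior algebra
to `H^*(K)`. A linear choice of representing cocycles gives a map `a ⊗ b ↦ ι^* a ∪ l b` from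
`U(p, d)` to the cochains of `K`. It commutes with the differentials because the exterior algebra has
zero differential, and in cohomology it is multiplicative and bijective
(`exists_quasiIso_of_exterior`).
-/

/-! ### Total cochains and the prism operator -/

namespace TotalCochain

open GroupCochains Finset

variable {k : Type*} [Field k] {X Y Z : Type*}

/-- A total cochain on `X`: a function on sequences in `X` for every degree. The component of degree
`n` is meant to depend on the first `n + 1` terms only; see `IsLocal`. Working with sequences
instead of tuples, and with all degrees at once, avoids transports along equalities of degrees. -/
abbrev Total (k X : Type*) := ℕ → (ℕ → X) → k

/-- The component of degree `n` depends on the first `n + 1` terms only. -/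
def IsLocal (F : Total k X) : Prop := ∀ n x y, (∀ i ≤ n, x i = y i) → F n x = F n y

/-- The values of the alternating sum of the faces; it vanishes in degree `0`. -/
def dFun (F : Total k X) : Total k X
  | 0, _ => 0
  | n + 1, x => ∑ i ∈ range (n + 2), (-1) ^ i * F n (x ∘ skip i)

/-- The differential of total cochains: the alternating sum of the faces, without a further sign. -/
def dT : Total k X →ₗ[k] Total k X where
  toFun := dFun
  map_add' F G := by
    funext n x
    cases n with
    | zero => simp [dFun]
    | succ n => simp [dFun, mul_add, sum_add_distrib]
  map_smul' c F := by
    funext n x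
    cases n with
    | zero => simp [dFun]
    | succ n =>
      simp only [dFun, Pi.smul_apply, smul_eq_mul, mul_sum, RingHom.id_apply]
      exact sum_congr rfl fun i _ => by ring

theorem dT_zero (F : Total k X) (x : ℕ → X) : dT F 0 x = 0 := rfl

theorem dT_succ (F : Total k X) (n : ℕ) (x : ℕ → X) :
    dT F (n + 1) x = ∑ i ∈ range (n + 2), (-1) ^ i * F n (x ∘ skip i) := rfl

theorem dT_dT (F : Total k X) : dT (dT F) = 0 := by
  funext m x
  match m with
  | 0 => rfl
  | 1 => simp [dT_succ, dT_zero]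
  | n + 2 =>
    simp only [dT_succ, mul_sum]
    change _ = (0 : k)
    rw [← sum_product', ← sum_filter_add_sum_filter_not _ (fun ij => ij.1 ≤ ij.2),
      ← eq_neg_iff_add_eq_zero, ← sum_neg_distrib]
    refine sum_bij (fun ij _ => (ij.2 + 1, ij.1)) ?_ ?_ ?_ ?_
    · rintro ⟨i, j⟩ h
      simp only [mem_filter, mem_product, mem_range] at h ⊢
      omega
    · rintro ⟨i, j⟩ _ ⟨i', j'⟩ _ h
      simp only [Prod.mk.injEq] at h ⊢
      omega
    · rintro ⟨i, j⟩ h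
      simp only [mem_filter, mem_product, mem_range] at h
      refine ⟨(j, i - 1), ?_, ?_⟩
      · simp only [mem_filter, mem_product, mem_range]
        omega
      · simp only [Prod.mk.injEq, and_true]
        omega
    · rintro ⟨i, j⟩ h
      simp only [mem_filter] at h
      simp only [Function.comp_assoc, skip_skip h.2]
      ring

/-- Precomposition with a map of the underlying sets. -/
def pull (α : X → Y) : Total k Y →ₗ[k] Total k X where
  toFun F n x := F n (α ∘ x)
  map_add' _ _ := rfl
  map_smul' _ _ := rfl

theorem pull_apply (α : X → Y) (F : Total k Y) (n : ℕ) (x : ℕ → X) :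
    pull α F n x = F n (α ∘ x) := rfl

theorem pull_pull (α : X → Y) (β : Y → Z) (F : Total k Z) :
    pull α (pull β F) = pull (β ∘ α) F := rfl

theorem pull_id (F : Total k X) : pull (fun x => x) F = F := rfl

theorem dT_pull (α : X → Y) (F : Total k Y) : dT (pull α F) = pull α (dT F) := by
  funext n x
  cases n <;> rfl

theorem IsLocal.dT {F : Total k X} (hF : IsLocal F) : IsLocal (dT F) := by
  rintro (_ | n) x y h
  · rfl
  · rw [dT_succ, dT_succ]
    refine sum_congr rfl fun i _ => congrArg _ (hF n _ _ fun j hj => h _ ?_)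
    simp only [skip]
    split_ifs <;> omega

theorem IsLocal.pull {F : Total k Y} (hF : IsLocal F) (α : X → Y) : IsLocal (pull α F) :=
  fun n _ _ h => hF n _ _ fun i hi => congrArg α (h i hi)

/-- The sequence `β x₀, …, β xᵢ, α xᵢ, α xᵢ₊₁, …`. -/
def splice (α β : X → Y) (i : ℕ) (x : ℕ → X) (j : ℕ) : Y :=
  if j ≤ i then β (x j) else α (x (j - 1))

/-- The prism operator: a homotopy between the pullbacks along `α` and `β`. -/
def prism (α β : X → Y) : Total k Y →ₗ[k] Total k X where
  toFun F n x := ∑ i ∈ range (n + 1), (-1) ^ i * F (n + 1) (splice α β i x)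
  map_add' F G := by
    funext n x
    simp [mul_add, sum_add_distrib]
  map_smul' c F := by
    funext n x
    simp only [Pi.smul_apply, smul_eq_mul, mul_sum, RingHom.id_apply]
    exact sum_congr rfl fun i _ => by ring

theorem prism_apply (α β : X → Y) (F : Total k Y) (n : ℕ) (x : ℕ → X) :
    prism α β F n x = ∑ i ∈ range (n + 1), (-1) ^ i * F (n + 1) (splice α β i x) := rfl

theorem IsLocal.prism {F : Total k Y} (hF : IsLocal F) (α β : X → Y) :
    IsLocal (prism α β F) := by
  intro n x y h
  rw [prism_apply, prism_apply]
  refine sum_congr rfl fun i hi => congrArg _ (hF _ _ _ fun j hj => ?_)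
  rw [mem_range] at hi
  simp only [splice]
  split_ifs
  · rw [h j (by omega)]
  · rw [h (j - 1) (by omega)]

theorem splice_skip_lt (α β : X → Y) {i j : ℕ} (h : j < i) (x : ℕ → X) :
    splice α β i x ∘ skip j = splice α β (i - 1) (x ∘ skip j) := by
  funext a
  simp only [Function.comp, splice, skip]
  split_ifs <;> first | omega | rfl | (congr 2; omega)

theorem splice_skip_gt (α β : X → Y) {i j : ℕ} (h : i < j) (x : ℕ → X) :
    splice α β i x ∘ skip (j + 1) = splice α β i (x ∘ skip j) := by
  funext a
  simp only [Function.comp, splice, skip]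
  split_ifs <;> first | omega | rfl | (congr 2; omega)

/-- The sequence `β x₀, …, β xᵢ₋₁, α xᵢ, α xᵢ₊₁, …`. -/
def cut (α β : X → Y) (i : ℕ) (x : ℕ → X) (j : ℕ) : Y := if j < i then β (x j) else α (x j)

theorem splice_skip_self (α β : X → Y) (i : ℕ) (x : ℕ → X) :
    splice α β i x ∘ skip i = cut α β i x := by
  funext a
  simp only [Function.comp, splice, skip, cut]
  split_ifs <;> first | omega | rfl

theorem splice_skip_succ (α β : X → Y) (i : ℕ) (x : ℕ → X) :
    splice α β i x ∘ skip (i + 1) = cut α β (i + 1) x := by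
  funext a
  simp only [Function.comp, splice, skip, cut]
  split_ifs <;> first | omega | rfl

theorem prism_homotopy (α β : X → Y) {F : Total k Y} (hF : IsLocal F) :
    pull α F - pull β F = dT (prism α β F) + prism α β (dT F) := by
  funext n x
  -- The faces `i` and `i + 1` of the prisms telescope to the left side.
  have hin : ∀ i ∈ range (n + 1), ∑ j ∈ range (n + 2),
      (-1 : k) ^ i * ((-1) ^ j * F n (splice α β i x ∘ skip j)) =
      ∑ j ∈ (range (n + 2)).filter (fun j => j < i ∨ i + 1 < j),
        (-1 : k) ^ i * ((-1) ^ j * F n (splice α β i x ∘ skip j)) +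
      (F n (cut α β i x) - F n (cut α β (i + 1) x)) := by
    intro i hi
    rw [mem_range] at hi
    rw [← sum_filter_add_sum_filter_not _ (fun j => j < i ∨ i + 1 < j)]
    congr 1
    have : (range (n + 2)).filter (fun j => ¬ (j < i ∨ i + 1 < j)) = {i, i + 1} := by
      ext j
      simp only [mem_filter, mem_range, mem_insert, mem_singleton]
      omega
    rw [this, sum_pair (by omega), splice_skip_self, splice_skip_succ, ← mul_assoc, ← mul_assoc,
      ← pow_add, ← pow_add, ← add_assoc, pow_succ, (Even.add_self i).neg_one_pow]
    ring
  have hP : prism α β (dT F) n x = ∑ i ∈ range (n + 1),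
      ∑ j ∈ (range (n + 2)).filter (fun j => j < i ∨ i + 1 < j),
        (-1 : k) ^ i * ((-1) ^ j * F n (splice α β i x ∘ skip j)) +
      (F n (α ∘ x) - F n (β ∘ x)) := by
    have h0 : cut α β 0 x = α ∘ x := by funext a; simp [cut]
    have h1 : F n (cut α β (n + 1) x) = F n (β ∘ x) :=
      hF n _ _ fun i hi => by simp only [cut, Function.comp]; rw [if_pos (by omega)]
    simp only [prism_apply, dT_succ, mul_sum]
    rw [sum_congr rfl hin, sum_add_distrib, sum_range_sub' (fun i => F n (cut α β i x)), h0, h1]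
  -- The other faces of the prisms are the prisms over the faces.
  have hD : dT (prism α β F) n x = -∑ i ∈ range (n + 1),
      ∑ j ∈ (range (n + 2)).filter (fun j => j < i ∨ i + 1 < j),
        (-1 : k) ^ i * ((-1) ^ j * F n (splice α β i x ∘ skip j)) := by
    cases n with
    | zero =>
      rw [dT_zero, zero_eq_neg]
      refine sum_eq_zero fun i hi => sum_eq_zero fun j hj => ?_
      simp only [mem_filter, mem_range] at hi hj
      omega
    | succ n =>
      simp only [dT_succ, prism_apply, mul_sum]
      rw [← sum_product', ← sum_finset_product' (((range (n + 2)) ×ˢ (range (n + 3))).filter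
        fun ij => ij.2 < ij.1 ∨ ij.1 + 1 < ij.2) _ _ (by
          rintro ⟨i, j⟩
          simp only [mem_filter, mem_product]
          tauto), ← sum_neg_distrib]
      refine sum_bij' (fun ji _ => if ji.2 < ji.1 then (ji.2, ji.1 + 1) else (ji.2 + 1, ji.1))
        (fun ij _ => if ij.2 < ij.1 then (ij.2, ij.1 - 1) else (ij.2 - 1, ij.1)) ?_ ?_ ?_ ?_ ?_
      · rintro ⟨j, i⟩ h
        simp only [mem_filter, mem_product, mem_range] at h ⊢
        split_ifs <;> dsimp only <;> omega
      · rintro ⟨i, j⟩ h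
        simp only [mem_filter, mem_product, mem_range] at h ⊢
        split_ifs <;> dsimp only <;> omega
      · rintro ⟨j, i⟩ h
        dsimp only
        split_ifs with h1 h2 h2 <;> (dsimp only at h2; first | omega | simp)
      · rintro ⟨i, j⟩ h
        simp only [mem_filter, mem_product, mem_range] at h
        dsimp only
        split_ifs with h1 h2 h2 <;>
          (dsimp only at h2; first | omega | (ext <;> dsimp only <;> omega))
      · rintro ⟨j, i⟩ h
        dsimp only
        split_ifs with h1
        · rw [splice_skip_gt _ _ h1, pow_succ]
          ring
        · rw [splice_skip_lt _ _ (by omega : j < i + 1), pow_succ, Nat.add_sub_cancel]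
          ring
  change F n (α ∘ x) - F n (β ∘ x) = dT (prism α β F) n x + prism α β (dT F) n x
  rw [hP, hD]
  ring

end TotalCochain

/-! ### Invariant cochains and sums of translations -/

namespace TotalCochain

open GroupCochains Finset

variable {k : Type*} [Field k] {X : Type*} [CommGroup X]

/-- The total cochains of the homogeneous cochain complex of functions on `X` that are invariant
under the subgroup `Γ`. -/
def inv (k : Type*) [Field k] {X : Type*} [CommGroup X] (Γ : Subgroup X) :
    Submodule k (Total k X) where
  carrier := {F | IsLocal F ∧ ∀ g ∈ Γ, pull (fun x => g * x) F = F}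
  add_mem' hF hG := ⟨fun n x y h => congrArg₂ (· + ·) (hF.1 n x y h) (hG.1 n x y h), fun g hg => by
    rw [map_add, hF.2 g hg, hG.2 g hg]⟩
  zero_mem' := ⟨fun _ _ _ _ => rfl, fun _ _ => map_zero _⟩
  smul_mem' c F hF := ⟨fun n x y h => congrArg (c * ·) (hF.1 n x y h), fun g hg => by
    rw [map_smul, hF.2 g hg]⟩

/-- Translation by `t`. -/
abbrev tr (t : X) : Total k X →ₗ[k] Total k X := pull fun x => t * x

theorem tr_apply (t : X) (F : Total k X) (n : ℕ) (x : ℕ → X) :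
    tr t F n x = F n fun i => t * x i := rfl

theorem tr_tr (s t : X) (F : Total k X) : tr s (tr t F) = tr (s * t) F := by
  funext n x
  simp only [tr_apply]
  congr 1
  funext i
  rw [← mul_assoc, mul_comm t s]

theorem tr_one (F : Total k X) : tr 1 F = F := by
  funext n x
  simp [tr_apply]

theorem inv_mono {Γ Γ' : Subgroup X} (h : Γ ≤ Γ') : inv k Γ' ≤ inv k Γ :=
  fun _ hF => ⟨hF.1, fun g hg => hF.2 g (h hg)⟩

section Closure

variable {Γ : Subgroup X}

theorem inv_apply {F : Total k X} (hF : F ∈ inv k Γ) {g : X} (hg : g ∈ Γ) (n : ℕ) (x : ℕ → X) :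
    F n (fun i => g * x i) = F n x :=
  congrFun (congrFun (hF.2 g hg) n) x

theorem dT_mem_inv {F : Total k X} (hF : F ∈ inv k Γ) : dT F ∈ inv k Γ :=
  ⟨hF.1.dT, fun g hg => by rw [← dT_pull, hF.2 g hg]⟩

theorem tr_mem_inv {F : Total k X} (hF : F ∈ inv k Γ) (t : X) : tr t F ∈ inv k Γ :=
  ⟨hF.1.pull _, fun g hg => by
    change tr g (tr t F) = tr t F
    rw [tr_tr, mul_comm, ← tr_tr]
    exact congrArg _ (hF.2 g hg)⟩

theorem prism_mem_inv {F : Total k X} (hF : F ∈ inv k Γ) {α β : X → X}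
    (hα : ∀ g ∈ Γ, ∀ x, α (g * x) = g * α x) (hβ : ∀ g ∈ Γ, ∀ x, β (g * x) = g * β x) :
    prism α β F ∈ inv k Γ :=
  ⟨hF.1.prism _ _, fun g hg => by
    funext n x
    rw [pull_apply, prism_apply, prism_apply]
    refine sum_congr rfl fun i _ => congrArg _ ?_
    rw [← inv_apply hF hg _ (splice α β i x)]
    congr 1
    funext j
    simp only [splice, Function.comp]
    split_ifs
    · exact hβ g hg _
    · exact hα g hg _⟩

end Closure

/-- There is an equivariant map onto a subgroup: the difference to a system of representatives of
the cosets. -/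
theorem exists_equivariant_section (Γ : Subgroup X) :
    ∃ s : X → X, (∀ x, s x ∈ Γ) ∧ ∀ g ∈ Γ, ∀ x, s (g * x) = g * s x := by
  refine ⟨fun x => x * ((x : X ⧸ Γ).out)⁻¹, fun x => ?_, fun g hg x => ?_⟩
  · change x * _ ∈ Γ
    rw [mul_comm]
    exact QuotientGroup.eq.1 (QuotientGroup.out_eq' (x : X ⧸ Γ))
  · have : ((g * x : X) : X ⧸ Γ) = x := QuotientGroup.eq.2 (by
      rw [mul_inv, mul_assoc, inv_mul_cancel, mul_one]
      exact inv_mem hg)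
    simp only [this, mul_assoc]

/-- The sum of the translations by `1, t, …, t ^ (m - 1)`. -/
def trSum (t : X) (m : ℕ) : Total k X →ₗ[k] Total k X := ∑ j ∈ range m, tr (t ^ j)

theorem trSum_apply (t : X) (m : ℕ) (F : Total k X) :
    trSum t m F = ∑ j ∈ range m, tr (t ^ j) F := by
  simp [trSum]

theorem trSum_eval (t : X) (m : ℕ) (F : Total k X) (n : ℕ) (x : ℕ → X) :
    trSum t m F n x = ∑ j ∈ range m, F n fun i => t ^ j * x i := by
  simp [trSum_apply, tr_apply]

theorem trSum_add (t : X) (m n : ℕ) (F : Total k X) :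
    trSum t (m + n) F = trSum t m F + tr (t ^ m) (trSum t n F) := by
  simp only [trSum_apply, sum_range_add, map_sum, tr_tr, pow_add]

theorem trSum_mul (t : X) (p m : ℕ) (F : Total k X) :
    trSum t (p * m) F = trSum (t ^ p) m (trSum t p F) := by
  induction m with
  | zero => simp [trSum_apply]
  | succ m ih =>
    rw [mul_add, mul_one, trSum_add, ih, trSum_add]
    simp [trSum_apply (t ^ p) 1, tr_one, pow_mul]

theorem trSum_mem_inv {Γ : Subgroup X} {F : Total k X} (hF : F ∈ inv k Γ) (t : X) (m : ℕ) :
    trSum t m F ∈ inv k Γ := by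
  rw [trSum_apply]
  exact Submodule.sum_mem _ fun j _ => tr_mem_inv hF _

theorem dT_trSum (t : X) (m : ℕ) (F : Total k X) : dT (trSum t m F) = trSum t m (dT F) := by
  simp only [trSum_apply, map_sum, dT_pull]

/-- The telescoping identity `(t - 1)(1 + t + ⋯ + t ^ (m - 1)) = t ^ m - 1`. -/
theorem tr_sub_trSum (t : X) (m : ℕ) (F : Total k X) :
    trSum t m (tr t F - F) = tr (t ^ m) F - F := by
  simp only [trSum_apply, map_sub, tr_tr, ← pow_succ]
  rw [← sum_sub_distrib, sum_range_sub (fun j => tr (t ^ j) F), pow_zero, tr_one]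

/-- A homotopy between the sum of `m` translations and multiplication by `m`: each translation is
homotopic to the identity. -/
def trSumHomotopy (t : X) (m : ℕ) : Total k X →ₗ[k] Total k X :=
  ∑ j ∈ range m, prism (fun x => t ^ j * x) (fun x => x)

theorem trSum_eq_homotopy (t : X) (p : ℕ) [CharP k p] {F : Total k X} (hF : IsLocal F) :
    trSum t p F = dT (trSumHomotopy t p F) + trSumHomotopy t p (dT F) := by
  have h : ∑ j ∈ range p, (tr (t ^ j) F - F) =
      dT (trSumHomotopy t p F) + trSumHomotopy t p (dT F) := by
    simp only [trSumHomotopy, LinearMap.sum_apply, map_sum, ← sum_add_distrib]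
    exact sum_congr rfl fun j _ => prism_homotopy (fun x => t ^ j * x) (fun x => x) hF
  rw [← h, sum_sub_distrib, sum_const, card_range, ← Nat.cast_smul_eq_nsmul k, CharP.cast_eq_zero,
    zero_smul, sub_zero, trSum_apply]

theorem trSumHomotopy_mem_inv {Γ : Subgroup X} {F : Total k X} (hF : F ∈ inv k Γ) (t : X)
    (m : ℕ) : trSumHomotopy t m F ∈ inv k Γ := by
  simp only [trSumHomotopy, LinearMap.sum_apply]
  exact Submodule.sum_mem _ fun j _ => prism_mem_inv hF
    (fun g _ x => mul_left_comm _ _ _) fun _ _ _ => rfl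

/-- A triangular system of infinitely many equations. Its solvability is dual to the injectivity of
the transposed operator, which raises the index `j`. -/
theorem exists_sub_shift {Y : Type*} (p : ℕ) (s : ℕ → ℕ → Y → Y) (g : ℕ → Y → k) :
    ∃ f : ℕ → Y → k, ∀ j y, f j y - ∑ i ∈ range p, f (j + 1) (s (j + 1) i y) = g j y := by
  classical
  let N : (ℕ × Y →₀ k) →ₗ[k] (ℕ × Y →₀ k) := Finsupp.lsum k fun a =>
    ∑ i ∈ range p, Finsupp.lsingle (a.1 + 1, s (a.1 + 1) i a.2)
  have hN : ∀ (v : ℕ × Y →₀ k) (b : ℕ × Y), (∀ y, ∀ j < b.1, v (j, y) = 0) → N v b = 0 := by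
    intro v b hb
    simp only [N, Finsupp.lsum_apply, Finsupp.sum, Finsupp.finsetSum_apply]
    refine sum_eq_zero fun a ha => ?_
    simp only [LinearMap.sum_apply, Finsupp.finsetSum_apply, Finsupp.lsingle_apply]
    refine sum_eq_zero fun i _ => ?_
    rw [Finsupp.single_apply, if_neg]
    rintro rfl
    exact Finsupp.mem_support_iff.1 ha (hb a.2 a.1 (Nat.lt_succ_self _))
  have hinj : Function.Injective (LinearMap.id - N : (ℕ × Y →₀ k) →ₗ[k] (ℕ × Y →₀ k)) := by
    refine (injective_iff_map_eq_zero _).2 fun v hv => ?_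
    have hv' : v = N v := sub_eq_zero.1 hv
    have : ∀ j y, v (j, y) = 0 := by
      intro j
      induction j using Nat.strong_induction_on with
      | _ j ih =>
        intro y
        rw [hv']
        exact hN v (j, y) fun y' j' h => ih j' h y'
    ext ⟨j, y⟩
    exact this j y
  obtain ⟨φ, hφ⟩ := LinearMap.dualMap_surjective_of_injective hinj
    (Finsupp.lsum k fun a : ℕ × Y => (g a.1 a.2) • LinearMap.id)
  refine ⟨fun j y => φ (Finsupp.single (j, y) 1), fun j y => ?_⟩
  have := congrArg (fun ψ => ψ (Finsupp.single (j, y) 1)) hφ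
  simpa [N, LinearMap.dualMap_apply, map_sum] using this

/-- On sequences of invariant cochains, the operator `1 - σ` is surjective, where `σ` shifts the
sequence and sums translates. A choice of normal forms of tuples modulo `Γ` turns this into a system
of the shape solved by `exists_sub_shift`. -/
theorem exists_sub_trSum {Γ : Subgroup X} (p : ℕ) (t : ℕ → X) {G : ℕ → Total k X}
    (hG : ∀ j, G j ∈ inv k Γ) :
    ∃ F : ℕ → Total k X, (∀ j, F j ∈ inv k Γ) ∧
      ∀ j, F j - trSum (t (j + 1)) p (F (j + 1)) = G j := by
  obtain ⟨σ, hσ, hσ'⟩ := exists_equivariant_section Γ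
  -- `ν n x` is a normal form of the first `n + 1` terms of `x` modulo `Γ`.
  let ν : ℕ → (ℕ → X) → ℕ → X := fun n x i => if i ≤ n then (σ (x 0))⁻¹ * x i else 1
  have hν : ∀ n, ∀ g ∈ Γ, ∀ x : ℕ → X, ν n (fun i => g * x i) = ν n x := by
    intro n g hg x
    funext i
    simp only [ν, hσ' g hg]
    split_ifs
    · rw [mul_inv_rev, mul_assoc, inv_mul_cancel_left]
    · rfl
  have hνl : ∀ n (x y : ℕ → X), (∀ i ≤ n, x i = y i) → ν n x = ν n y := by
    intro n x y h
    funext i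
    simp only [ν, h 0 (Nat.zero_le n)]
    split_ifs with hi
    · rw [h i hi]
    · rfl
  have hνt : ∀ n (c : X) (x : ℕ → X), ν n (fun i => c * ν n x i) = ν n (fun i => c * x i) := by
    intro n c x
    refine Eq.trans ?_ (hν n _ (inv_mem (hσ (x 0))) (fun i => c * x i))
    refine hνl n (fun i => c * ν n x i) (fun i => (σ (x 0))⁻¹ * (c * x i)) fun i hi => ?_
    simp only [ν, if_pos hi, mul_left_comm]
  have hGν : ∀ j n x, G j n (ν n x) = G j n x := by
    intro j n x
    rw [← inv_apply (hG j) (inv_mem (hσ (x 0))) n x]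
    refine (hG j).1 n _ _ fun i hi => ?_
    simp only [ν, if_pos hi]
  choose f hf using fun n : ℕ => exists_sub_shift (k := k) p
    (fun j i (x : ℕ → X) => ν n fun l => t j ^ i * x l) (fun j x => G j n x)
  refine ⟨fun j n x => f n j (ν n x), fun j => ⟨fun n x y h => ?_, fun g hg => ?_⟩, fun j => ?_⟩
  · change f n j (ν n x) = f n j (ν n y)
    rw [hνl n x y h]
  · funext n x
    change f n j (ν n fun i => g * x i) = f n j (ν n x)
    rw [hν n g hg]
  · funext n x
    rw [Pi.sub_apply, Pi.sub_apply, trSum_eval, ← hGν, ← hf]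
    simp only [hνt]

end TotalCochain

/-! ### Root towers and the acyclicity of the telescope -/

namespace TotalCochain

open GroupCochains Finset

variable {k : Type*} [Field k] {X : Type*} [CommGroup X]

/-- `A` is generated by the subgroup `B` and a compatible system of `p`-power roots `t j` of an
element `t 0` of `B`, and `r` restricts to a homomorphism on `B` that does not vanish at `t 0`. If
`p` is prime and the values of `r` lie in a field of characteristic `p`, then `A / B` is a Prüfer
group. The cocycle `(x, y) ↦ r y - r x` is invariant under `B`. -/
structure IsRootTower (p : ℕ) (A B : Subgroup X) (t : ℕ → X) (r : X → k) : Prop where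
  le : B ≤ A
  mem : ∀ j, t j ∈ A
  pow : ∀ j, t (j + 1) ^ p = t j
  zero : t 0 ∈ B
  cover : ∀ a ∈ A, ∃ j m, ∃ b ∈ B, a = t j ^ m * b
  r_mul : ∀ b ∈ B, ∀ x, r (b * x) = r b + r x
  r_ne : r (t 0) ≠ 0

/-- The sequences of `B`-invariant cochains `f` in which `f j` is the sum of the translates of
`f (j + 1)` by `1, t (j + 1), …, t (j + 1) ^ (p - 1)`. In other words, the inverse limit of the
`B`-invariant cochains along these sums. -/
def telescope (k : Type*) [Field k] (p : ℕ) (B : Subgroup X) (t : ℕ → X) :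
    Submodule k (ℕ → Total k X) where
  carrier := {f | (∀ j, f j ∈ inv k B) ∧ ∀ j, trSum (t (j + 1)) p (f (j + 1)) = f j}
  add_mem' hf hg := ⟨fun j => add_mem (hf.1 j) (hg.1 j), fun j => by
    rw [Pi.add_apply, Pi.add_apply, map_add, hf.2, hg.2]⟩
  zero_mem' := ⟨fun _ => zero_mem _, fun _ => map_zero _⟩
  smul_mem' c f hf := ⟨fun j => Submodule.smul_mem _ c (hf.1 j), fun j => by
    rw [Pi.smul_apply, Pi.smul_apply, map_smul, hf.2]⟩

namespace IsRootTower

variable {p : ℕ} {A B : Subgroup X} {t : ℕ → X} {r : X → k}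

theorem pow_pow (h : IsRootTower p A B t r) (j n : ℕ) : t (j + n) ^ p ^ n = t j := by
  induction n with
  | zero => simp
  | succ n ih => rw [pow_succ', pow_mul, ← add_assoc, h.pow, ih]

theorem r_one (h : IsRootTower p A B t r) : r 1 = 0 := by
  simpa using h.r_mul 1 (one_mem _) 1

theorem r_pow (h : IsRootTower p A B t r) {b : X} (hb : b ∈ B) (n : ℕ) : r (b ^ n) = n * r b := by
  induction n with
  | zero => simp [h.r_one]
  | succ n ih => rw [pow_succ', h.r_mul b hb, ih]; push_cast; ring

/-- The order of `t j` modulo `B` is `p ^ j`: `t 1` does not lie in `B`, since `r (t 1 ^ p)` would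
be `p * r (t 1) = 0`. -/
theorem dvd_of_pow_mem [hp : Fact p.Prime] [CharP k p] (h : IsRootTower p A B t r) {j m : ℕ}
    (hm : t j ^ m ∈ B) : p ^ j ∣ m := by
  cases j with
  | zero => simp
  | succ j =>
    have h1 : t 1 ∉ B := fun h1 => h.r_ne (by rw [← h.pow 0, h.r_pow h1]; simp)
    have ho : orderOf (t (j + 1) : X ⧸ B) = p ^ (j + 1) := by
      apply orderOf_eq_prime_pow
      · rw [← QuotientGroup.mk_pow, QuotientGroup.eq_one_iff]
        rwa [add_comm, h.pow_pow]
      · rw [← QuotientGroup.mk_pow, QuotientGroup.eq_one_iff]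
        have := h.pow_pow 0 (j + 1)
        rw [zero_add] at this
        rw [this]
        exact h.zero
    rw [← ho]
    apply orderOf_dvd_of_pow_eq_one
    rwa [← QuotientGroup.mk_pow, QuotientGroup.eq_one_iff]

/-- A `B`-invariant cochain that is invariant under all the `t j` is `A`-invariant. -/
theorem mem_inv_of_tr (h : IsRootTower p A B t r) {F : Total k X} (hF : F ∈ inv k B)
    (hF' : ∀ j, tr (t j) F = F) : F ∈ inv k A := by
  have hpow : ∀ j m, tr (t j ^ m) F = F := by
    intro j m
    induction m with
    | zero => rw [pow_zero, tr_one]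
    | succ m ih => rw [pow_succ, ← tr_tr, hF', ih]
  refine ⟨hF.1, fun a ha => ?_⟩
  obtain ⟨j, m, b, hb, rfl⟩ := h.cover a ha
  change tr (t j ^ m * b) F = F
  rw [← tr_tr, show tr b F = F from hF.2 b hb, hpow]

section Telescope

variable {f : ℕ → Total k X}

theorem trSum_lift (h : IsRootTower p A B t r) (hf : f ∈ telescope k p B t) (j m n : ℕ) :
    trSum (t (j + n)) (p ^ n * m) (f (j + n)) = trSum (t j) m (f j) := by
  induction n with
  | zero => simp
  | succ n ih =>
    rw [pow_succ', mul_assoc, trSum_mul, ← add_assoc, hf.2, h.pow, ih]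

theorem trSum_pow (h : IsRootTower p A B t r) (hf : f ∈ telescope k p B t) (j n : ℕ) :
    trSum (t (j + n)) (p ^ n) (f (j + n)) = f j := by
  have := h.trSum_lift hf j 1 n
  rw [mul_one] at this
  rw [this, trSum_apply]
  simp [tr_one]

/-- The first term of a sequence in the telescope is a norm from every stage, hence `A`-invariant.
-/
theorem zero_mem_inv (h : IsRootTower p A B t r) (hf : f ∈ telescope k p B t) :
    f 0 ∈ inv k A := by
  refine h.mem_inv_of_tr (hf.1 0) fun j => ?_
  have h0 := h.trSum_pow hf 0 j
  have ht := h.pow_pow 0 j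
  rw [zero_add] at h0 ht
  have h1 := tr_sub_trSum (t j) (p ^ j) (f j)
  rw [ht, show tr (t 0) (f j) = f j from (hf.1 j).2 _ h.zero, sub_self, map_sub, sub_eq_zero,
    h0] at h1
  conv_rhs => rw [← h1]
  conv_lhs => rw [← h0]
  simp only [trSum_apply, map_sum, tr_tr, mul_comm]

/-- The partial sums of a sequence in the telescope that starts with `0` depend only on the end
point modulo `B`. -/
theorem trSum_congr [Fact p.Prime] [CharP k p] (h : IsRootTower p A B t r)
    (hf : f ∈ telescope k p B t) (hf0 : f 0 = 0) {i j m n : ℕ} {b c : X} (hb : b ∈ B) (hc : c ∈ B)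
    (he : t i ^ m * b = t j ^ n * c) : trSum (t i) m (f i) = trSum (t j) n (f j) := by
  have key : ∀ (l m n : ℕ) (b c : X), b ∈ B → c ∈ B → m ≤ n → t l ^ m * b = t l ^ n * c →
      trSum (t l) m (f l) = trSum (t l) n (f l) := by
    intro l m n b c hb hc hmn he
    obtain ⟨d, rfl⟩ := Nat.exists_eq_add_of_le hmn
    rw [pow_add, mul_assoc, mul_left_cancel_iff] at he
    have hd : t l ^ d ∈ B := by
      rw [eq_mul_inv_of_mul_eq he.symm]
      exact mul_mem hb (inv_mem hc)
    obtain ⟨q, rfl⟩ := h.dvd_of_pow_mem hd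
    have h0 := h.trSum_lift hf 0 q l
    rw [zero_add] at h0
    rw [trSum_add, h0, hf0]
    simp
  have h1 : t (i + j) ^ (p ^ j * m) * b = t (j + i) ^ (p ^ i * n) * c := by
    rw [pow_mul, pow_mul, h.pow_pow, h.pow_pow, he]
  rw [← h.trSum_lift hf i m j, ← h.trSum_lift hf j n i]
  rw [add_comm j i] at h1 ⊢
  rcases le_total (p ^ j * m) (p ^ i * n) with hle | hle
  · exact key _ _ _ _ _ hb hc hle h1
  · exact (key _ _ _ _ _ hc hb hle h1.symm).symm

/-- The sequences in the telescope that start with `0` are the sequences `((t j - 1) g)_j`. -/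
theorem exists_tr_sub_eq [Fact p.Prime] [CharP k p] (h : IsRootTower p A B t r)
    (hf : f ∈ telescope k p B t) (hf0 : f 0 = 0) :
    ∃ g ∈ inv k B, ∀ j, tr (t j) g - g = f j := by
  obtain ⟨s, hs, hs'⟩ := exists_equivariant_section A
  choose! κ μ β hβ hβ' using h.cover
  -- `x` is the translate of its normal form `z x` by `s (x 0)`. With the value `0` at the normal
  -- forms, the value of `g` at the translate by `t j ^ m * b` has to be a partial sum of `f j`.
  let z : (ℕ → X) → ℕ → X := fun x i => (s (x 0))⁻¹ * x i
  let G : X → Total k X := fun a => trSum (t (κ a)) (μ a) (f (κ a))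
  have hz : ∀ a ∈ A, ∀ x : ℕ → X, z (fun i => a * x i) = z x := by
    intro a ha x
    funext i
    simp only [z, hs' a ha]
    rw [mul_inv_rev, mul_assoc, inv_mul_cancel_left]
  have hG : ∀ a ∈ A, ∀ j m b, b ∈ B → a = t j ^ m * b → G a = trSum (t j) m (f j) := by
    intro a ha j m b hb he
    exact h.trSum_congr hf hf0 (hβ a ha) hb ((hβ' a ha).symm.trans he)
  have hGl : ∀ a, IsLocal (G a) := fun a => (trSum_mem_inv (hf.1 _) _ _).1
  refine ⟨fun n x => G (s (x 0)) n (z x), ⟨fun n x y hxy => ?_, fun b hb => ?_⟩, fun j => ?_⟩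
  · change G (s (x 0)) n (z x) = G (s (y 0)) n (z y)
    rw [hxy 0 (Nat.zero_le n)]
    refine hGl _ n _ _ fun i hi => ?_
    simp only [z]
    rw [hxy 0 (Nat.zero_le n), hxy i hi]
  · funext n x
    change G (s (b * x 0)) n (z fun i => b * x i) = G (s (x 0)) n (z x)
    rw [hz b (h.le hb), hs' b (h.le hb)]
    have he := hβ' _ (hs (x 0))
    rw [hG _ (mul_mem (h.le hb) (hs (x 0))) (κ (s (x 0))) (μ (s (x 0))) (b * β (s (x 0)))
      (mul_mem hb (hβ _ (hs (x 0)))) (by rw [mul_left_comm, ← he])]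
  · funext n x
    change G (s (t j * x 0)) n (z fun i => t j * x i) - G (s (x 0)) n (z x) = f j n x
    rw [hz _ (h.mem j), hs' _ (h.mem j)]
    set a := s (x 0) with ha
    have haA : a ∈ A := hs (x 0)
    -- Both end points are written as powers of a common root `t (j + κ a)`.
    have e1 : a = t (j + κ a) ^ (p ^ j * μ a) * β a := by
      rw [pow_mul, add_comm j, h.pow_pow, ← hβ' a haA]
    have e2 : t j * a = t (j + κ a) ^ (p ^ j * μ a + p ^ κ a) * β a := by
      rw [pow_add, h.pow_pow, mul_right_comm, ← e1, mul_comm]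
    rw [hG a haA _ _ _ (hβ a haA) e1, hG _ (mul_mem (h.mem j) haA) _ _ _ (hβ a haA) e2, trSum_add,
      h.trSum_pow hf, Pi.add_apply, Pi.add_apply, add_sub_cancel_left, tr_apply,
      ← inv_apply (hf.1 j) (hβ a haA)]
    congr 1
    funext i
    rw [← mul_assoc, mul_comm (β a), ← e1]
    simp only [z]
    rw [← ha, mul_inv_cancel_left]

theorem tr_sub_mem_telescope (h : IsRootTower p A B t r) {g : Total k X} (hg : g ∈ inv k B) :
    (fun j => tr (t j) g - g) ∈ telescope k p B t := by
  refine ⟨fun j => sub_mem (tr_mem_inv hg _) hg, fun j => ?_⟩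
  rw [tr_sub_trSum, h.pow]

/-- The telescope is acyclic: it is the kernel of a surjective operator `1 - σ` where `σ` is
null-homotopic. -/
theorem exists_dT_eq_of_mem_telescope [CharP k p] (hf : f ∈ telescope k p B t)
    (hd : ∀ j, dT (f j) = 0) : ∃ e ∈ telescope k p B t, ∀ j, dT (e j) = f j := by
  let H : ℕ → Total k X →ₗ[k] Total k X := fun j => trSumHomotopy (t (j + 1)) p
  let S : ℕ → Total k X →ₗ[k] Total k X := fun j => trSum (t (j + 1)) p
  have hS : ∀ j F, F ∈ inv k B → dT F = 0 → S j F = dT (H j F) := fun j F hF hdF => by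
    rw [show S j F = _ from trSum_eq_homotopy (t (j + 1)) p hF.1, hdF, map_zero, add_zero]
  have hH : ∀ j F, F ∈ inv k B → H j F ∈ inv k B := fun j F hF => trSumHomotopy_mem_inv hF _ _
  -- `G` bounds `f`, but lies in the telescope only up to the cocycle `Z`.
  let G : ℕ → Total k X := fun j => H j (f (j + 1))
  have hG : ∀ j, G j ∈ inv k B := fun j => hH j _ (hf.1 _)
  have hdG : ∀ j, dT (G j) = f j := fun j => by
    rw [← hS j _ (hf.1 _) (hd _)]
    exact hf.2 j
  let Z : ℕ → Total k X := fun j => G j - S j (G (j + 1))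
  have hZ : ∀ j, Z j ∈ inv k B := fun j => sub_mem (hG j) (trSum_mem_inv (hG _) _ _)
  have hdZ : ∀ j, dT (Z j) = 0 := fun j => by
    rw [map_sub, hdG, dT_trSum, hdG, hf.2, sub_self]
  obtain ⟨Y, hY, hY'⟩ := exists_sub_trSum p t (G := fun j => H j (Z (j + 1)))
    fun j => hH j _ (hZ _)
  refine ⟨fun j => G j - Z j - dT (Y j), ⟨fun j => sub_mem (sub_mem (hG j) (hZ j))
    (dT_mem_inv (hY j)), fun j => ?_⟩, fun j => ?_⟩
  · have e1 := congrArg dT (hY' j)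
    rw [← hS j _ (hZ _) (hdZ _), map_sub, dT_trSum] at e1
    have e2 : Z j = G j - trSum (t (j + 1)) p (G (j + 1)) := rfl
    rw [map_sub, map_sub]
    change _ - S j (Z (j + 1)) - _ = G j - Z j - dT (Y j)
    rw [← e1, e2]
    abel
  · rw [map_sub, map_sub, hdG, hdZ, dT_dT, sub_zero, sub_zero]

end Telescope

end IsRootTower

end TotalCochain

/-! ### The cohomology of the two groups in a root tower -/

namespace TotalCochain

open GroupCochains Finset

variable {k : Type*} [Field k] {X : Type*}

/-- The product of a total cochain with the cocycle `(x, y) ↦ r y - r x`, without a further sign. -/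
def cupR (r : X → k) : Total k X →ₗ[k] Total k X where
  toFun F n x := match n with
    | 0 => 0
    | n + 1 => F n x * (r (x (n + 1)) - r (x n))
  map_add' F G := by
    funext n x
    cases n with
    | zero => simp
    | succ n => simp [add_mul]
  map_smul' c F := by
    funext n x
    cases n with
    | zero => simp
    | succ n => simp [mul_assoc]

theorem cupR_zero (r : X → k) (F : Total k X) (x : ℕ → X) : cupR r F 0 x = 0 := rfl

theorem cupR_succ (r : X → k) (F : Total k X) (n : ℕ) (x : ℕ → X) :
    cupR r F (n + 1) x = F n x * (r (x (n + 1)) - r (x n)) := rfl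

/-- The product of a total cochain with the cochain `e` of degree `0`. -/
def mulLast (e : X → k) (F : Total k X) : Total k X := fun n x => F n x * e (x n)

theorem mulLast_apply (e : X → k) (F : Total k X) (n : ℕ) (x : ℕ → X) :
    mulLast e F n x = F n x * e (x n) := rfl

/-- Multiplication by `(-1) ^ n` in degree `n`. -/
def alt : Total k X →ₗ[k] Total k X where
  toFun F n x := (-1) ^ n * F n x
  map_add' F G := by
    funext n x
    simp [mul_add]
  map_smul' c F := by
    funext n x
    simp only [Pi.smul_apply, smul_eq_mul, RingHom.id_apply]
    ring

theorem alt_apply (F : Total k X) (n : ℕ) (x : ℕ → X) : alt F n x = (-1) ^ n * F n x := rfl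

theorem alt_alt (F : Total k X) : alt (alt F) = F := by
  funext n x
  rw [alt_apply, alt_apply, ← mul_assoc, ← mul_pow]
  simp

theorem dT_alt (F : Total k X) : dT (alt F) = -alt (dT F) := by
  funext n x
  cases n with
  | zero => simp [alt_apply, dT_zero]
  | succ n =>
    simp only [dT_succ, alt_apply, Pi.neg_apply, mul_sum, ← sum_neg_distrib]
    exact sum_congr rfl fun i _ => by ring

/-- The faces that contribute to the Leibniz rule for a product with a cochain of low degree. -/
theorem dT_succ' {F : Total k X} (hF : IsLocal F) (n : ℕ) (x : ℕ → X) :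
    dT F (n + 1) x =
      ∑ i ∈ range (n + 1), (-1) ^ i * F n (x ∘ skip i) + (-1) ^ (n + 1) * F n x := by
  rw [dT_succ, sum_range_succ]
  congr 2
  refine hF n _ _ fun j hj => ?_
  simp only [Function.comp, skip]
  rw [if_pos (by omega)]

theorem IsLocal.cupR {F : Total k X} (hF : IsLocal F) (r : X → k) : IsLocal (cupR r F) := by
  rintro (_ | n) x y h
  · rfl
  · rw [cupR_succ, cupR_succ, h n (by omega), h (n + 1) le_rfl,
      hF n x y fun i hi => h i (by omega)]

theorem dT_cupR (r : X → k) {F : Total k X} (hF : IsLocal F) :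
    dT (cupR r F) = cupR r (dT F) := by
  funext n x
  match n with
  | 0 => rfl
  | 1 => simp [dT_succ, cupR_succ, cupR_zero, dT_zero]
  | n + 2 =>
    rw [dT_succ' (hF.cupR r), sum_range_succ, cupR_succ, cupR_succ, cupR_succ, dT_succ' hF, add_mul,
      sum_mul]
    have h1 : ∀ i ∈ range (n + 1), (-1) ^ i * cupR r F (n + 1) (x ∘ skip i) =
        (-1) ^ i * F n (x ∘ skip i) * (r (x (n + 2)) - r (x (n + 1))) := by
      intro i hi
      rw [mem_range] at hi
      simp only [cupR_succ, Function.comp, skip]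
      rw [if_neg (by omega), if_neg (by omega), mul_assoc]
    have h2 : F n (x ∘ skip (n + 1)) = F n x := hF n _ _ fun j hj => by
      simp only [Function.comp, skip]
      rw [if_pos (by omega)]
    have h3 : (x ∘ skip (n + 1)) (n + 1) = x (n + 2) := by simp [skip]
    have h4 : (x ∘ skip (n + 1)) n = x n := by simp [skip]
    rw [sum_congr rfl h1, h2, h3, h4]
    ring

theorem dT_mulLast (e : X → k) {F : Total k X} (hF : IsLocal F) :
    dT (mulLast e F) = mulLast e (dT F) + cupR e (alt F) := by
  have hl : IsLocal (mulLast e F) := fun n x y h => by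
    simp only [mulLast]
    rw [hF n x y h, h n le_rfl]
  funext n x
  cases n with
  | zero => simp [dT_zero, mulLast, cupR_zero]
  | succ n =>
    have h1 : ∀ i ∈ range (n + 1), (-1) ^ i * mulLast e F n (x ∘ skip i) =
        (-1) ^ i * F n (x ∘ skip i) * e (x (n + 1)) := by
      intro i hi
      rw [mem_range] at hi
      simp only [mulLast, Function.comp, skip]
      rw [if_neg (by omega), mul_assoc]
    rw [Pi.add_apply, Pi.add_apply, dT_succ' hl, sum_congr rfl h1, cupR_succ, mulLast_apply,
      mulLast_apply, dT_succ' hF, alt_apply, ← sum_mul]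
    ring

variable [CommGroup X]

theorem alt_mem_inv {Γ : Subgroup X} {F : Total k X} (hF : F ∈ inv k Γ) : alt F ∈ inv k Γ :=
  ⟨fun n x y h => congrArg ((-1) ^ n * ·) (hF.1 n x y h), fun g hg => by
    conv_rhs => rw [← hF.2 g hg]
    rfl⟩

namespace IsRootTower

variable {p : ℕ} {A B : Subgroup X} {t : ℕ → X} {r : X → k}

theorem cupR_mem_inv (h : IsRootTower p A B t r) {F : Total k X} (hF : F ∈ inv k B) :
    cupR r F ∈ inv k B :=
  ⟨hF.1.cupR r, fun b hb => by
    funext n x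
    cases n with
    | zero => rfl
    | succ n =>
      rw [pull_apply, cupR_succ, cupR_succ]
      simp only [Function.comp]
      rw [h.r_mul b hb, h.r_mul b hb, add_sub_add_left_eq_sub]
      exact congrArg (· * _) (inv_apply hF hb n x)⟩

/-- The cochains `x ↦ r (t j * x) - r x` of degree `0`. -/
def shift (t : ℕ → X) (r : X → k) (j : ℕ) (x : X) : k := r (t j * x) - r x

theorem mulLast_shift_zero (h : IsRootTower p A B t r) (F : Total k X) :
    mulLast (shift t r 0) F = r (t 0) • F := by
  funext n x
  simp only [mulLast, shift, Pi.smul_apply, smul_eq_mul]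
  rw [h.r_mul _ h.zero]
  ring

/-- The telescope contains a sequence that starts with `r (t 0) • F`; see `mulLast_shift_zero`. -/
theorem mulLast_mem_telescope (h : IsRootTower p A B t r) {F : Total k X} (hF : F ∈ inv k A) :
    (fun j => mulLast (shift t r j) F) ∈ telescope k p B t := by
  refine ⟨fun j => ⟨fun n x y hxy => ?_, fun b hb => ?_⟩, fun j => ?_⟩
  · simp only [mulLast]
    rw [hF.1 n x y hxy, hxy n le_rfl]
  · funext n x
    have := inv_apply hF (h.le hb) n x
    simp only [pull_apply, mulLast, shift, Function.comp_def]
    rw [this, mul_left_comm, h.r_mul b hb, h.r_mul b hb, add_sub_add_left_eq_sub]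
  · funext n x
    have hF' : ∀ i, F n (fun l => t (j + 1) ^ i * x l) = F n x := fun i =>
      inv_apply hF (pow_mem (h.mem _) i) n x
    simp only [trSum_eval, mulLast, shift, hF', ← mul_sum, ← mul_assoc, ← pow_succ']
    rw [sum_range_sub (fun i => r (t (j + 1) ^ i * x n)), h.pow, pow_zero, one_mul]

/-- Translating the product with the cocycle `(x, y) ↦ r y - r x` changes it by a coboundary. -/
theorem tr_cupR_sub (h : IsRootTower p A B t r) {F : Total k X} (hF : F ∈ inv k A)
    (hd : dT F = 0) (j : ℕ) :
    tr (t j) (cupR r F) - cupR r F = dT (mulLast (shift t r j) (alt F)) := by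
  rw [dT_mulLast _ (alt_mem_inv hF).1, dT_alt, hd, alt_alt]
  funext n x
  cases n with
  | zero => simp [cupR_zero, mulLast, tr_apply]
  | succ n =>
    have := inv_apply hF (h.mem j) n x
    simp only [Pi.sub_apply, Pi.add_apply, tr_apply, cupR_succ, this, shift, map_zero, neg_zero,
      mulLast, Pi.zero_apply, zero_mul]
    ring

/-- Every `B`-invariant cocycle `b` is cohomologous to `a + a' ∪ y` for `A`-invariant cocycles `a`
and `a'`, where `y` is the cocycle `(x, y) ↦ r y - r x`. The sequence `((t j - 1) b)_j` lies in the
acyclic telescope, hence is the coboundary of a sequence `E`, and `E 0` determines `a'`. What is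
left of `E` starts with `0`, so that it has the form `((t j - 1) g)_j` by `exists_tr_sub_eq`. -/
theorem exists_eq_add_cupR_add_dT [Fact p.Prime] [CharP k p] (h : IsRootTower p A B t r)
    {b : Total k X} (hb : b ∈ inv k B) (hd : dT b = 0) :
    ∃ a ∈ inv k A, ∃ a' ∈ inv k A, ∃ g ∈ inv k B,
      dT a = 0 ∧ dT a' = 0 ∧ b = a + cupR r a' + dT g := by
  obtain ⟨E, hE, hdE⟩ := exists_dT_eq_of_mem_telescope (h.tr_sub_mem_telescope hb) fun j => by
    rw [map_sub, dT_pull, hd, map_zero, sub_zero]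
  have hE0 : E 0 ∈ inv k A := h.zero_mem_inv hE
  have hdE0 : dT (E 0) = 0 := by
    rw [hdE, sub_eq_zero]
    exact hb.2 _ h.zero
  have hu : alt (E 0) ∈ inv k A := alt_mem_inv hE0
  have hdu : dT (alt (E 0)) = 0 := by rw [dT_alt, hdE0, map_zero, neg_zero]
  -- The product of `a'` with `y` changes the first term of the sequence by `r (t 0) • alt a'`.
  set c := (r (t 0))⁻¹ with hc
  have ha' : c • alt (E 0) ∈ inv k A := Submodule.smul_mem _ _ hu
  have hda' : dT (c • alt (E 0)) = 0 := by rw [map_smul, hdu, smul_zero]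
  have hW := sub_mem hE (h.mulLast_mem_telescope (alt_mem_inv ha'))
  obtain ⟨g, hg, hg'⟩ := h.exists_tr_sub_eq hW (by
    rw [Pi.sub_apply, h.mulLast_shift_zero, map_smul, alt_alt, smul_smul, hc,
      mul_inv_cancel₀ h.r_ne, one_smul, sub_self])
  have hcup := h.cupR_mem_inv (inv_mono h.le ha')
  have hdcup : dT (cupR r (c • alt (E 0))) = 0 := by rw [dT_cupR _ ha'.1, hda', map_zero]
  refine ⟨b - cupR r (c • alt (E 0)) - dT g, h.mem_inv_of_tr
    (sub_mem (sub_mem hb hcup) (dT_mem_inv hg)) fun j => ?_, _, ha', g, hg, ?_, hda', by abel⟩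
  · have e1 := h.tr_cupR_sub ha' hda' j
    have e2 := congrArg dT (hg' j)
    rw [Pi.sub_apply, map_sub, map_sub, hdE, ← e1, dT_pull] at e2
    rw [map_sub, map_sub]
    rw [← sub_eq_zero] at e2 ⊢
    rw [← neg_eq_zero, ← e2]
    abel
  · rw [map_sub, map_sub, hd, hdcup, dT_dT, sub_zero, sub_zero]

/-- A representation as in `exists_eq_add_cupR_add_dT` is unique up to coboundaries. -/
theorem exists_dT_eq_of_add_cupR_eq_dT [Fact p.Prime] [CharP k p] (h : IsRootTower p A B t r)
    {a a' g : Total k X} (ha : a ∈ inv k A) (ha' : a' ∈ inv k A) (hg : g ∈ inv k B)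
    (hda' : dT a' = 0) (he : a + cupR r a' = dT g) :
    ∃ u ∈ inv k A, ∃ u' ∈ inv k A, dT u = a ∧ dT u' = a' := by
  have htr : ∀ j, tr (t j) a = a := fun j => ha.2 _ (h.mem j)
  obtain ⟨V, hV, hdV⟩ := exists_dT_eq_of_mem_telescope (sub_mem (h.tr_sub_mem_telescope hg)
    (h.mulLast_mem_telescope (alt_mem_inv ha'))) fun j => by
      rw [Pi.sub_apply, map_sub, ← h.tr_cupR_sub ha' hda', map_sub, dT_pull, ← he, map_add, htr]
      abel
  have hV0 := h.zero_mem_inv hV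
  -- A comparison of the first terms shows that `a'` is the coboundary of `u'`.
  set c := (r (t 0))⁻¹ with hc
  have hu' : c • alt (V 0) ∈ inv k A := Submodule.smul_mem _ _ (alt_mem_inv hV0)
  have hdu' : dT (c • alt (V 0)) = a' := by
    rw [map_smul, dT_alt, hdV, Pi.sub_apply, h.mulLast_shift_zero,
      show tr (t 0) g = g from hg.2 _ h.zero, sub_self, zero_sub, map_neg, map_smul, alt_alt,
      neg_neg, smul_smul, hc, inv_mul_cancel₀ h.r_ne, one_smul]
  -- Then `a` is the coboundary of the `B`-invariant `g'`, and it remains to make `g'` invariant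
  -- under `A`, by subtracting a product with `y` and a coboundary.
  set g' := g - cupR r (c • alt (V 0)) with hg'
  have hg'B : g' ∈ inv k B := sub_mem hg (h.cupR_mem_inv (inv_mono h.le hu'))
  have hdg' : dT g' = a := by
    rw [hg', map_sub, dT_cupR _ hu'.1, hdu', ← he, add_sub_cancel_right]
  obtain ⟨W, hW, hdW⟩ := exists_dT_eq_of_mem_telescope (h.tr_sub_mem_telescope hg'B) fun j => by
    rw [map_sub, dT_pull, hdg', htr, sub_self]
  have hW0 := h.zero_mem_inv hW
  have hdW0 : dT (W 0) = 0 := by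
    rw [hdW, sub_eq_zero]
    exact hg'B.2 _ h.zero
  have hv : c • alt (W 0) ∈ inv k A := Submodule.smul_mem _ _ (alt_mem_inv hW0)
  have hdv : dT (c • alt (W 0)) = 0 := by
    rw [map_smul, dT_alt, hdW0, map_zero, neg_zero, smul_zero]
  obtain ⟨q, hq, hq'⟩ := h.exists_tr_sub_eq (sub_mem hW (h.mulLast_mem_telescope (alt_mem_inv hv)))
    (by rw [Pi.sub_apply, h.mulLast_shift_zero, map_smul, alt_alt, smul_smul, hc,
      mul_inv_cancel₀ h.r_ne, one_smul, sub_self])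
  have hcup := h.cupR_mem_inv (inv_mono h.le hv)
  refine ⟨g' - cupR r (c • alt (W 0)) - dT q, h.mem_inv_of_tr
    (sub_mem (sub_mem hg'B hcup) (dT_mem_inv hq)) fun j => ?_, _, hu', ?_, hdu'⟩
  · have e1 := h.tr_cupR_sub hv hdv j
    have e2 := congrArg dT (hq' j)
    rw [Pi.sub_apply, map_sub, map_sub, hdW, ← e1, dT_pull] at e2
    rw [map_sub, map_sub]
    rw [← sub_eq_zero] at e2 ⊢
    rw [← neg_eq_zero, ← e2]
    abel
  · rw [map_sub, map_sub, hdg', dT_cupR _ hv.1, hdv, map_zero, dT_dT, sub_zero, sub_zero]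

end IsRootTower

end TotalCochain

/-! ### Chains of root towers and restriction to subgroups -/

namespace TotalCochain

open GroupCochains Finset

variable {k : Type*} [Field k] {X : Type*}

/-- The product, in increasing order, with the cocycles `(x, y) ↦ r l y - r l x` for the `l < m` in
the set `S`. -/
def cupMon (r : ℕ → X → k) (S : Finset ℕ) : ℕ → Total k X →ₗ[k] Total k X
  | 0 => LinearMap.id
  | m + 1 => if m ∈ S then cupR (r m) ∘ₗ cupMon r S m else cupMon r S m

theorem cupMon_zero (r : ℕ → X → k) (S : Finset ℕ) (F : Total k X) : cupMon r S 0 F = F := rfl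

theorem cupMon_succ_of_mem {r : ℕ → X → k} {S : Finset ℕ} {m : ℕ} (h : m ∈ S) (F : Total k X) :
    cupMon r S (m + 1) F = cupR (r m) (cupMon r S m F) := by
  rw [cupMon, if_pos h, LinearMap.comp_apply]

theorem cupMon_succ_of_notMem {r : ℕ → X → k} {S : Finset ℕ} {m : ℕ} (h : m ∉ S)
    (F : Total k X) : cupMon r S (m + 1) F = cupMon r S m F := by
  rw [cupMon, if_neg h]

theorem cupMon_insert {r : ℕ → X → k} (S : Finset ℕ) {m n : ℕ} (h : n ≤ m) (F : Total k X) :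
    cupMon r (insert m S) n F = cupMon r S n F := by
  induction n with
  | zero => rfl
  | succ n ih =>
    have hn : n ∈ insert m S ↔ n ∈ S := by
      rw [mem_insert, or_iff_right (by omega)]
    by_cases hS : n ∈ S
    · rw [cupMon_succ_of_mem hS, cupMon_succ_of_mem (hn.2 hS), ih (by omega)]
    · rw [cupMon_succ_of_notMem hS, cupMon_succ_of_notMem (mt hn.1 hS), ih (by omega)]

theorem sum_cupMon_succ (r : ℕ → X → k) (m : ℕ) (a : Finset ℕ → Total k X) :
    ∑ S ∈ (range (m + 1)).powerset, cupMon r S (m + 1) (a S) =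
      ∑ S ∈ (range m).powerset, cupMon r S m (a S) +
        cupR (r m) (∑ S ∈ (range m).powerset, cupMon r S m (a (insert m S))) := by
  rw [range_add_one, sum_powerset_insert notMem_range_self, map_sum]
  congr 1
  · refine sum_congr rfl fun S hS => cupMon_succ_of_notMem (fun h => ?_) _
    exact notMem_range_self (mem_powerset.1 hS h)
  · refine sum_congr rfl fun S _ => ?_
    rw [cupMon_succ_of_mem (mem_insert_self _ _), cupMon_insert S le_rfl]

section Tower

variable [CommGroup X] {p d : ℕ} {A : ℕ → Subgroup X} {t : ℕ → ℕ → X} {r : ℕ → X → k}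

theorem cupMon_mem_inv (h : ∀ m < d, IsRootTower p (A m) (A (m + 1)) (t m) (r m)) {m : ℕ}
    (hm : m ≤ d) (S : Finset ℕ) {F : Total k X} (hF : F ∈ inv k (A 0)) :
    cupMon r S m F ∈ inv k (A m) := by
  induction m with
  | zero => exact hF
  | succ m ih =>
    have := inv_mono (h m hm).le (ih (by omega))
    by_cases hS : m ∈ S
    · rw [cupMon_succ_of_mem hS]
      exact (h m hm).cupR_mem_inv this
    · rwa [cupMon_succ_of_notMem hS]

theorem dT_cupMon (h : ∀ m < d, IsRootTower p (A m) (A (m + 1)) (t m) (r m)) {m : ℕ}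
    (hm : m ≤ d) (S : Finset ℕ) {F : Total k X} (hF : F ∈ inv k (A 0)) :
    dT (cupMon r S m F) = cupMon r S m (dT F) := by
  induction m with
  | zero => rfl
  | succ m ih =>
    by_cases hS : m ∈ S
    · rw [cupMon_succ_of_mem hS, cupMon_succ_of_mem hS,
        dT_cupR _ (cupMon_mem_inv h (by omega) S hF).1, ih (by omega)]
    · rw [cupMon_succ_of_notMem hS, cupMon_succ_of_notMem hS, ih (by omega)]

theorem sum_cupMon_mem_inv (h : ∀ m < d, IsRootTower p (A m) (A (m + 1)) (t m) (r m)) {m : ℕ}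
    (hm : m ≤ d) {a : Finset ℕ → Total k X} (ha : ∀ S, a S ∈ inv k (A 0)) :
    ∑ S ∈ (range m).powerset, cupMon r S m (a S) ∈ inv k (A m) :=
  Submodule.sum_mem _ fun S _ => cupMon_mem_inv h hm S (ha S)

theorem dT_sum_cupMon (h : ∀ m < d, IsRootTower p (A m) (A (m + 1)) (t m) (r m)) {m : ℕ}
    (hm : m ≤ d) {a : Finset ℕ → Total k X} (ha : ∀ S, a S ∈ inv k (A 0))
    (hd : ∀ S, dT (a S) = 0) : dT (∑ S ∈ (range m).powerset, cupMon r S m (a S)) = 0 := by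
  rw [map_sum]
  exact sum_eq_zero fun S _ => by rw [dT_cupMon h hm S (ha S), hd, map_zero]

variable [Fact p.Prime] [CharP k p]

/-- Along a chain of root towers, every cocycle is cohomologous to a combination of the products of
the degree `1` cocycles with cocycles of the largest group. -/
theorem exists_eq_sum_cupMon_add_dT (h : ∀ m < d, IsRootTower p (A m) (A (m + 1)) (t m) (r m))
    {m : ℕ} (hm : m ≤ d) {b : Total k X} (hb : b ∈ inv k (A m)) (hdb : dT b = 0) :
    ∃ a : Finset ℕ → Total k X, (∀ S, a S ∈ inv k (A 0)) ∧ (∀ S, dT (a S) = 0) ∧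
      ∃ g ∈ inv k (A m), b = ∑ S ∈ (range m).powerset, cupMon r S m (a S) + dT g := by
  induction m generalizing b with
  | zero => exact ⟨fun _ => b, fun _ => hb, fun _ => hdb, 0, zero_mem _, by simp [cupMon_zero]⟩
  | succ m ih =>
    have hs := h m hm
    obtain ⟨c, hc, c', hc', g, hg, hdc, hdc', he⟩ := hs.exists_eq_add_cupR_add_dT hb hdb
    obtain ⟨a, ha, hda, u, hu, hau⟩ := ih (by omega) hc hdc
    obtain ⟨a', ha', hda', u', hu', hau'⟩ := ih (by omega) hc' hdc'
    refine ⟨fun S => if m ∈ S then a' (S.erase m) else a S, fun S => ?_, fun S => ?_,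
      u + cupR (r m) u' + g, add_mem (add_mem (inv_mono hs.le hu)
        (hs.cupR_mem_inv (inv_mono hs.le hu'))) hg, ?_⟩
    · dsimp only
      split_ifs
      exacts [ha' _, ha _]
    · dsimp only
      split_ifs
      exacts [hda' _, hda _]
    · have hS : ∀ S ∈ (range m).powerset, m ∉ S := fun S hS h =>
        notMem_range_self (mem_powerset.1 hS h)
      have e1 : ∀ S ∈ (range m).powerset,
          cupMon r S m (if m ∈ S then a' (S.erase m) else a S) = cupMon r S m (a S) :=
        fun S h => by rw [if_neg (hS S h)]
      have e2 : ∀ S ∈ (range m).powerset, cupMon r S m (if m ∈ insert m S then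
          a' ((insert m S).erase m) else a (insert m S)) = cupMon r S m (a' S) :=
        fun S h => by rw [if_pos (mem_insert_self _ _), erase_insert (hS S h)]
      rw [sum_cupMon_succ, sum_congr rfl e1, sum_congr rfl e2, map_add, map_add,
        dT_cupR _ hu'.1, he, hau, hau', map_add]
      abel

/-- The coefficients in `exists_eq_sum_cupMon_add_dT` are unique up to coboundaries. -/
theorem exists_dT_eq_of_sum_cupMon_eq_dT
    (h : ∀ m < d, IsRootTower p (A m) (A (m + 1)) (t m) (r m)) {m : ℕ} (hm : m ≤ d)
    {a : Finset ℕ → Total k X} (ha : ∀ S, a S ∈ inv k (A 0)) (hda : ∀ S, dT (a S) = 0)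
    {g : Total k X} (hg : g ∈ inv k (A m))
    (he : ∑ S ∈ (range m).powerset, cupMon r S m (a S) = dT g) :
    ∀ S ∈ (range m).powerset, ∃ u ∈ inv k (A 0), dT u = a S := by
  induction m generalizing a g with
  | zero =>
    intro S hS
    obtain rfl : S = ∅ := by simpa using hS
    exact ⟨g, hg, by simpa [cupMon_zero] using he.symm⟩
  | succ m ih =>
    rw [sum_cupMon_succ] at he
    obtain ⟨u, hu, u', hu', hdu, hdu'⟩ := (h m hm).exists_dT_eq_of_add_cupR_eq_dT
      (sum_cupMon_mem_inv h (by omega) ha) (sum_cupMon_mem_inv h (by omega) fun S => ha _) hg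
      (dT_sum_cupMon h (by omega) (fun S => ha _) fun S => hda _) he
    intro S hS
    by_cases hmS : m ∈ S
    · have := ih (by omega) (fun S => ha (insert m S)) (fun S => hda _) hu' hdu'.symm (S.erase m)
        (by
          rw [mem_powerset, range_add_one] at *
          exact subset_insert_iff.1 hS)
      rwa [insert_erase hmS] at this
    · refine ih (by omega) ha hda hu hdu.symm S ?_
      rw [mem_powerset, range_add_one] at *
      exact (subset_insert_iff_of_notMem hmS).1 hS

end Tower

section Restriction

variable {K : Type*} [CommGroup K] [CommGroup X]

/-- The normalization `ρ (ι g) = g` makes restriction along `ι` an exact left inverse of the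
pullback along `ρ`. -/
theorem exists_equivariant_retraction (ι : K →* X) (hι : Function.Injective ι) :
    ∃ ρ : X → K, (∀ g x, ρ (ι g * x) = g * ρ x) ∧ ∀ g, ρ (ι g) = g := by
  obtain ⟨s, hs, hs'⟩ := exists_equivariant_section ι.range
  choose σ hσ using hs
  have h : ∀ g x, σ (ι g * x) = g * σ x := fun g x => hι (by
    rw [hσ, map_mul, hσ, hs' _ ⟨g, rfl⟩])
  refine ⟨fun x => σ x * (σ 1)⁻¹, fun g x => by simp only [h, mul_assoc], fun g => ?_⟩
  have := h g 1
  rw [mul_one] at this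
  simp only [this, mul_inv_cancel_right]

/-- Restriction to a subgroup `K` of `X` induces a surjection from the cohomology of the
`K`-invariant cochains on `X` to that of the invariant cochains on `K`. -/
theorem exists_pull_eq (ι : K →* X) (hι : Function.Injective ι) {z : Total k K}
    (hz : z ∈ inv k ⊤) (hd : dT z = 0) : ∃ F ∈ inv k ι.range, dT F = 0 ∧ pull ι F = z := by
  obtain ⟨ρ, hρ, hρ'⟩ := exists_equivariant_retraction ι hι
  refine ⟨pull ρ z, ⟨hz.1.pull _, ?_⟩, by rw [dT_pull, hd, map_zero], ?_⟩
  · rintro _ ⟨g, rfl⟩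
    rw [pull_pull]
    conv_rhs => rw [← hz.2 g trivial, pull_pull]
    congr 1
    congr 1
    funext x
    exact hρ g x
  · rw [pull_pull]
    convert pull_id z using 3
    exact funext hρ'

/-- Restriction to a subgroup `K` of `X` induces an injection from the cohomology of the
`K`-invariant cochains on `X` to that of the invariant cochains on `K`. -/
theorem exists_dT_eq_of_pull_eq_dT (ι : K →* X) (hι : Function.Injective ι) {F : Total k X}
    (hF : F ∈ inv k ι.range) (hd : dT F = 0) {w : Total k K} (hw : w ∈ inv k ⊤)
    (he : pull ι F = dT w) : ∃ g ∈ inv k ι.range, dT g = F := by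
  obtain ⟨ρ, hρ, hρ'⟩ := exists_equivariant_retraction ι hι
  have hp := prism_homotopy (ι ∘ ρ) (fun x => x) hF.1
  rw [pull_id, hd, map_zero, add_zero, ← pull_pull, he, ← dT_pull] at hp
  refine ⟨pull ρ w - prism (ι ∘ ρ) (fun x => x) F, sub_mem ⟨hw.1.pull _, ?_⟩
    (prism_mem_inv hF ?_ fun _ _ _ => rfl), by rw [map_sub, ← hp, sub_sub_cancel]⟩
  · rintro _ ⟨g, rfl⟩
    rw [pull_pull]
    conv_rhs => rw [← hw.2 g trivial, pull_pull]
    congr 1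
    congr 1
    funext x
    exact hρ g x
  · rintro _ ⟨g, rfl⟩ x
    simp only [Function.comp, hρ, map_mul]

end Restriction

end TotalCochain

/-! ### The Prüfer group and its finite subgroups -/

section Prufer

open Finset

variable (p : ℕ) [Fact p.Prime]

theorem pruferGroup_exp_isPrimitiveRoot (n : ℕ) :
    IsPrimitiveRoot (Complex.exp (2 * Real.pi * Complex.I / (p ^ n : ℕ))) (p ^ n) :=
  Complex.isPrimitiveRoot_exp _ (pow_ne_zero _ (Fact.out : p.Prime).ne_zero)

/-- The standard primitive root of unity of order `p ^ n`. -/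
noncomputable def pruferRoot (n : ℕ) : PruferGroup p :=
  ⟨Units.mk0 (Complex.exp (2 * Real.pi * Complex.I / (p ^ n : ℕ))) (Complex.exp_ne_zero _),
    n, by
      exact Units.ext (pruferGroup_exp_isPrimitiveRoot p n).pow_eq_one⟩

theorem coe_pruferRoot (n : ℕ) :
    ((pruferRoot p n : ℂˣ) : ℂ) = Complex.exp (2 * Real.pi * Complex.I / (p ^ n : ℕ)) := rfl

theorem orderOf_pruferRoot (n : ℕ) : orderOf (pruferRoot p n) = p ^ n := by
  rw [← Subgroup.orderOf_coe, ← orderOf_units, coe_pruferRoot]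
  exact (pruferGroup_exp_isPrimitiveRoot p n).eq_orderOf.symm

theorem pruferRoot_succ_pow (n : ℕ) : pruferRoot p (n + 1) ^ p = pruferRoot p n := by
  have hp : (p : ℂ) ≠ 0 := Nat.cast_ne_zero.2 (Fact.out : p.Prime).ne_zero
  refine Subtype.ext (Units.ext ?_)
  rw [Subgroup.coe_pow, Units.val_pow_eq_pow_val, coe_pruferRoot, coe_pruferRoot,
    ← Complex.exp_nat_mul]
  congr 1
  push_cast
  field_simp
  rw [pow_succ']

theorem pruferRoot_add_pow (m n : ℕ) : pruferRoot p (m + n) ^ p ^ n = pruferRoot p m := by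
  induction n with
  | zero => simp
  | succ n ih => rw [pow_succ', pow_mul, ← add_assoc, pruferRoot_succ_pow, ih]

theorem exists_eq_pruferRoot_pow (x : PruferGroup p) : ∃ n m, x = pruferRoot p n ^ m := by
  obtain ⟨x, n, hn⟩ := x
  have : NeZero (p ^ n) := ⟨pow_ne_zero _ (Fact.out : p.Prime).ne_zero⟩
  obtain ⟨m, -, hm⟩ := (pruferGroup_exp_isPrimitiveRoot p n).eq_pow_of_pow_eq_one
    (ξ := (x : ℂ)) (by rw [← Units.val_pow_eq_pow_val, hn, Units.val_one])
  refine ⟨n, m, Subtype.ext (Units.ext ?_)⟩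
  rw [Subgroup.coe_pow, Units.val_pow_eq_pow_val, coe_pruferRoot]
  exact hm.symm

/-- The embedding of the cyclic group of order `p ^ n` into the Prüfer group. -/
noncomputable def pruferEmb (n : ℕ) : Multiplicative (ZMod (p ^ n)) →* PruferGroup p :=
  AddMonoidHom.toMultiplicativeLeft (ZMod.lift (p ^ n)
    ⟨zmultiplesHom _ (Additive.ofMul (pruferRoot p n)), by
    change Additive.ofMul (pruferRoot p n ^ ((p ^ n : ℕ) : ℤ)) = 0
    rw [zpow_natCast, ← orderOf_pruferRoot p n, pow_orderOf_eq_one]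
    rfl⟩)

theorem pruferEmb_intCast (n : ℕ) (m : ℤ) :
    pruferEmb p n (Multiplicative.ofAdd (m : ZMod (p ^ n))) = pruferRoot p n ^ m := by
  change Additive.toMul (ZMod.lift (p ^ n) _ (m : ZMod (p ^ n))) = _
  rw [ZMod.lift_coe]
  rfl

theorem pruferEmb_injective (n : ℕ) : Function.Injective (pruferEmb p n) := by
  rw [injective_iff_map_eq_one]
  intro a ha
  obtain ⟨m, hm⟩ := ZMod.intCast_surjective (Multiplicative.toAdd a)
  obtain rfl : a = Multiplicative.ofAdd (m : ZMod (p ^ n)) := by rw [hm]; rfl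
  rw [pruferEmb_intCast, ← orderOf_dvd_iff_zpow_eq_one, orderOf_pruferRoot] at ha
  exact congrArg Multiplicative.ofAdd ((ZMod.intCast_zmod_eq_zero_iff_dvd _ _).2 ha)

end Prufer

namespace TotalCochain

section PruferTower

open Finset

variable (p : ℕ) [Fact p.Prime] {d : ℕ} (i : Fin d → ℕ)

/-- The elements of `C_{p^∞}^d` whose first `m` coordinates lie in the subgroups `C_{p^(i l)}`. -/
def pruferChain (m : ℕ) : Subgroup (Fin d → PruferGroup p) where
  carrier := {x | ∀ l : Fin d, (l : ℕ) < m → x l ∈ (pruferEmb p (i l)).range}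
  mul_mem' hx hy l hl := mul_mem (hx l hl) (hy l hl)
  one_mem' _ _ := one_mem _
  inv_mem' hx l hl := inv_mem (hx l hl)

/-- The embedding of `C_{p^(i 0)} × ⋯ × C_{p^(i (d - 1))}` into `C_{p^∞}^d`. -/
noncomputable def pruferProdEmb :
    ((l : Fin d) → Multiplicative (ZMod (p ^ i l))) →* (Fin d → PruferGroup p) where
  toFun x l := pruferEmb p (i l) (x l)
  map_one' := funext fun _ => map_one _
  map_mul' _ _ := funext fun _ => map_mul _ _ _

theorem pruferProdEmb_injective : Function.Injective (pruferProdEmb p i) :=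
  fun _ _ h => funext fun l => pruferEmb_injective p (i l) (congrFun h l)

theorem pruferChain_zero : pruferChain p i 0 = ⊤ :=
  top_le_iff.1 fun _ _ _ h => absurd h (Nat.not_lt_zero _)

theorem pruferChain_last : pruferChain p i d = (pruferProdEmb p i).range := by
  ext x
  constructor
  · intro h
    choose y hy using fun l : Fin d => h l l.2
    exact ⟨y, funext hy⟩
  · rintro ⟨y, rfl⟩ l -
    exact ⟨y l, rfl⟩

/-- The residue modulo `p` of an element of `C_{p^n}`. -/
def residue {n : ℕ} (hn : 0 < n) (a : Multiplicative (ZMod (p ^ n))) : ZMod p :=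
  ZMod.castHom (dvd_pow_self p hn.ne') (ZMod p) (Multiplicative.toAdd a)

theorem residue_mul {n : ℕ} (hn : 0 < n) (a b : Multiplicative (ZMod (p ^ n))) :
    residue p hn (a * b) = residue p hn a + residue p hn b :=
  map_add _ _ _

/-- `C_{p^(i 0)} × ⋯ × C_{p^(i (d - 1))}` is the end of a chain of root towers that starts with
`C_{p^∞}^d`, such that the functions `r l` restrict to the coordinates modulo `p`. -/
theorem exists_isRootTower (hi : ∀ l, 0 < i l) :
    ∃ (t : ℕ → ℕ → Fin d → PruferGroup p) (r : ℕ → (Fin d → PruferGroup p) → ZMod p),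
      (∀ m < d, IsRootTower p (pruferChain p i m) (pruferChain p i (m + 1)) (t m) (r m)) ∧
      ∀ (l : Fin d) x, r l (pruferProdEmb p i x) = residue p (hi l) (x l) := by
  choose ρ hρ hρ' using fun l : Fin d =>
    exists_equivariant_retraction (pruferEmb p (i l)) (pruferEmb_injective p (i l))
  -- The roots of `t 0`, the generator of the `m`-th factor, are taken in the `m`-th coordinate.
  refine ⟨fun m j => if h : m < d then Pi.mulSingle ⟨m, h⟩ (pruferRoot p (i ⟨m, h⟩ + j)) else 1,
    fun m x => if h : m < d then residue p (hi ⟨m, h⟩) (ρ ⟨m, h⟩ (x ⟨m, h⟩)) else 0, ?_, ?_⟩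
  · intro m hm
    simp only [dif_pos hm]
    set l : Fin d := ⟨m, hm⟩ with hl
    have hroot : pruferRoot p (i l) = pruferEmb p (i l) (Multiplicative.ofAdd 1) := by
      simpa using (pruferEmb_intCast p (i l) 1).symm
    have hmul : ∀ b ∈ pruferChain p i (m + 1), ∀ x, residue p (hi l) (ρ l ((b * x) l)) =
        residue p (hi l) (ρ l (b l)) + residue p (hi l) (ρ l (x l)) := by
      intro b hb x
      obtain ⟨a, ha⟩ := hb l (Nat.lt_succ_self m)
      rw [Pi.mul_apply, ← ha, hρ, hρ', residue_mul]
    refine ⟨fun x hx l' hl' => hx l' (by omega), fun j l' hl' => ?_, fun j => ?_,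
      fun l' hl' => ?_, fun a ha => ?_, hmul, ?_⟩
    · rw [Pi.mulSingle_eq_of_ne (by rintro rfl; exact lt_irrefl _ hl')]
      exact one_mem _
    · rw [← Pi.mulSingle_pow, ← add_assoc, pruferRoot_succ_pow]
    · by_cases h : l' = l
      · subst h
        rw [Pi.mulSingle_eq_same, add_zero, hroot]
        exact ⟨_, rfl⟩
      · rw [Pi.mulSingle_eq_of_ne h]
        exact one_mem _
    · obtain ⟨n, q, hq⟩ := exists_eq_pruferRoot_pow p (a l)
      set s : Fin d → PruferGroup p := Pi.mulSingle l (pruferRoot p (i l + n)) with hs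
      refine ⟨n, p ^ i l * q, (s ^ (p ^ i l * q))⁻¹ * a, fun l' hl' => ?_,
        (mul_inv_cancel_left _ _).symm⟩
      by_cases h : l' = l
      · subst h
        rw [Pi.mul_apply, Pi.inv_apply, Pi.pow_apply, hs, Pi.mulSingle_eq_same, pow_mul, add_comm,
          pruferRoot_add_pow, hq, inv_mul_cancel]
        exact one_mem _
      · rw [Pi.mul_apply, Pi.inv_apply, Pi.pow_apply, hs, Pi.mulSingle_eq_of_ne h, one_pow, inv_one,
          one_mul]
        exact ha l' (lt_of_le_of_ne (Nat.lt_succ_iff.1 hl') fun h' => h (Fin.ext h'))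
    · rw [Pi.mulSingle_eq_same, add_zero, hroot, hρ']
      rw [residue, toAdd_ofAdd, map_one]
      exact one_ne_zero
  · intro l x
    simp only [l.2, dif_pos]
    exact congrArg _ (hρ' l (x l))

end PruferTower

end TotalCochain

/-! ### Cohomology rings of differential graded algebras -/

namespace DGAlg

universe v

variable {k : Type v} [CommRing k] {A B : DGAlg k}

/-- The cochain map given by a family of linear maps that commute with the differentials. -/
noncomputable def complexHom (f : ∀ n, A.X n →ₗ[k] B.X n)
    (hf : ∀ n a, f (n + 1) (A.d n a) = B.d n (f n a)) : A.complex ⟶ B.complex :=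
  CochainComplex.ofHom (X := A.complex) (Y := B.complex) (fun n => ModuleCat.ofHom (f n))
    fun n => by
      rw [complex_d, complex_d]
      ext a
      exact (hf n a).symm

theorem map_mem_cocycles (f : ∀ n, A.X n →ₗ[k] B.X n)
    (hf : ∀ n a, f (n + 1) (A.d n a) = B.d n (f n a)) {n : ℕ} {a : A.X n}
    (ha : a ∈ A.cocycles n) : f n a ∈ B.cocycles n := by
  change B.d n (f n a) = 0
  rw [← hf, show A.d n a = 0 from ha, map_zero]

/-- The map on cocycles induced by a cochain map. -/
def mapCocycles (f : ∀ n, A.X n →ₗ[k] B.X n) (hf : ∀ n a, f (n + 1) (A.d n a) = B.d n (f n a))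
    (n : ℕ) : A.cocycles n →ₗ[k] B.cocycles n :=
  (f n).restrict fun _ ha => map_mem_cocycles f hf ha

section

variable (f : ∀ n, A.X n →ₗ[k] B.X n) (hf : ∀ n a, f (n + 1) (A.d n a) = B.d n (f n a))

theorem homologyMap_cls {n : ℕ} (a : A.cocycles n) :
    (HomologicalComplex.homologyMap (complexHom f hf) n).hom (A.cls n a) =
      B.cls n (mapCocycles f hf n a) := by
  have h1 : A.complex.homologyπ n ≫ HomologicalComplex.homologyMap (complexHom f hf) n =
      HomologicalComplex.cyclesMap (complexHom f hf) n ≫ B.complex.homologyπ n :=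
    HomologicalComplex.homologyπ_naturality _ _
  have h2 := congrArg (fun g => g.hom ((A.toCyc n).hom a)) h1
  refine h2.trans ?_
  change (B.complex.homologyπ n).hom
    ((HomologicalComplex.cyclesMap (complexHom f hf) n).hom ((A.toCyc n).hom a)) =
    (B.complex.homologyπ n).hom ((B.toCyc n).hom _)
  congr 1
  apply B.iCycles_injective n
  rw [iCycles_toCyc]
  have h3 : HomologicalComplex.cyclesMap (complexHom f hf) n ≫ B.complex.iCycles n =
      A.complex.iCycles n ≫ (complexHom f hf).f n := HomologicalComplex.cyclesMap_i _ _
  have h4 := congrArg (fun g => g.hom ((A.toCyc n).hom a)) h3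
  refine h4.trans ?_
  change f n ((A.complex.iCycles n).hom ((A.toCyc n).hom a)) = f n a
  rw [iCycles_toCyc]

theorem cls_eq_iff {n : ℕ} (a b : A.cocycles n) :
    A.cls n a = A.cls n b ↔ (a : A.X n) - b ∈ A.coboundaries n := by
  rw [← sub_eq_zero, ← map_sub, cls_eq_zero_iff]
  rfl

theorem bijective_homologyMap
    (hsurj : ∀ n, ∀ b ∈ B.cocycles n, ∃ a ∈ A.cocycles n, b - f n a ∈ B.coboundaries n)
    (hinj : ∀ n, ∀ a ∈ A.cocycles n, f n a ∈ B.coboundaries n → a ∈ A.coboundaries n) (n : ℕ) :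
    Function.Bijective (HomologicalComplex.homologyMap (complexHom f hf) n).hom := by
  constructor
  · refine (injective_iff_map_eq_zero _).2 fun x hx => ?_
    obtain ⟨a, rfl⟩ := A.cls_surjective n x
    rw [homologyMap_cls, cls_eq_zero_iff] at hx
    exact (A.cls_eq_zero_iff n a).2 (hinj n a a.2 hx)
  · intro y
    obtain ⟨b, rfl⟩ := B.cls_surjective n y
    obtain ⟨a, ha, hab⟩ := hsurj n b b.2
    refine ⟨A.cls n ⟨a, ha⟩, ?_⟩
    rw [homologyMap_cls]
    exact ((cls_eq_iff _ _).2 hab).symm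

theorem quasiIso_complexHom
    (h : ∀ n, Function.Bijective (HomologicalComplex.homologyMap (complexHom f hf) n).hom) :
    QuasiIso (complexHom f hf) := by
  rw [quasiIso_iff]
  intro n
  rw [quasiIsoAt_iff_isIso_homologyMap, ConcreteCategory.isIso_iff_bijective]
  exact h n

theorem cohomologyMap_of (n : ℕ) (x : A.complex.homology n) :
    cohomologyMap (complexHom f hf) (DirectSum.of (fun n => A.complex.homology n) n x) =
      DirectSum.of (fun n => B.complex.homology n) n
        ((HomologicalComplex.homologyMap (complexHom f hf) n).hom x) :=
  DirectSum.lmap_lof _ _ _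

theorem of_mul_of {m n : ℕ} (x : A.complex.homology m) (y : A.complex.homology n) :
    (DirectSum.of (fun n => A.complex.homology n) m x : A.Cohomology) *
      DirectSum.of (fun n => A.complex.homology n) n y =
    DirectSum.of (fun n => A.complex.homology n) (m + n) (A.hmul rfl x y) :=
  DirectSum.of_mul_of _ _

/-- The class of a cocycle as an element of the cohomology ring. -/
noncomputable def clsRing (A : DGAlg k) (n : ℕ) : A.cocycles n →ₗ[k] A.Cohomology :=
  DirectSum.lof k ℕ (fun n => A.complex.homology n) n ∘ₗ A.cls n

theorem clsRing_apply {n : ℕ} (a : A.cocycles n) :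
    A.clsRing n a = DirectSum.of (fun n => A.complex.homology n) n (A.cls n a) := rfl

theorem clsRing_eq_iff {n : ℕ} (a b : A.cocycles n) :
    A.clsRing n a = A.clsRing n b ↔ (a : A.X n) - b ∈ A.coboundaries n := by
  rw [clsRing_apply, clsRing_apply, (DirectSum.of_injective n).eq_iff, cls_eq_iff]

theorem clsRing_mul {m n r : ℕ} (h : m + n = r) (a : A.cocycles m) (b : A.cocycles n) :
    A.clsRing m a * A.clsRing n b = A.clsRing r (A.cocyclesMul h a b) := by
  subst h
  rw [clsRing_apply, clsRing_apply, clsRing_apply, of_mul_of, hmul_cls]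

theorem clsRing_one : A.clsRing 0 ⟨A.one, A.d_one⟩ = 1 := rfl

theorem cohomologyMap_clsRing {n : ℕ} (a : A.cocycles n) :
    cohomologyMap (complexHom f hf) (A.clsRing n a) =
      B.clsRing n (mapCocycles f hf n a) := by
  rw [clsRing_apply, cohomologyMap_of, homologyMap_cls, clsRing_apply]

theorem cohomology_induction {P : A.Cohomology → Prop} (h0 : P 0)
    (hadd : ∀ x y, P x → P y → P (x + y)) (h : ∀ n a, P (A.clsRing n a)) (x : A.Cohomology) :
    P x := by
  induction x using DirectSum.induction_on with
  | zero => exact h0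
  | of n x =>
    obtain ⟨a, rfl⟩ := A.cls_surjective n x
    exact h n a
  | add x y hx hy => exact hadd _ _ hx hy

theorem inducesRingIso_complexHom
    (h : ∀ n, Function.Bijective (HomologicalComplex.homologyMap (complexHom f hf) n).hom)
    (hmul : ∀ m n (a : A.cocycles m) (b : A.cocycles n),
      cohomologyMap (complexHom f hf) (A.clsRing m a * A.clsRing n b) =
        cohomologyMap (complexHom f hf) (A.clsRing m a) *
          cohomologyMap (complexHom f hf) (A.clsRing n b)) :
    InducesRingIso (complexHom f hf) := by
  set Φ := cohomologyMap (complexHom f hf) with hΦ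
  have hmul' : ∀ x y, Φ (x * y) = Φ x * Φ y := by
    intro x y
    induction x using cohomology_induction with
    | h0 => rw [zero_mul, map_zero, zero_mul]
    | hadd x x' hx hx' => rw [add_mul, map_add, hx, hx', map_add, add_mul]
    | h m a =>
    induction y using cohomology_induction with
    | h0 => rw [mul_zero, map_zero, mul_zero]
    | hadd y y' hy hy' => rw [mul_add, map_add, hy, hy', map_add, mul_add]
    | h n b => exact hmul m n a b
  have hbij : Function.Bijective Φ := by
    constructor
    · refine (injective_iff_map_eq_zero _).2 fun x hx => ?_
      refine DFinsupp.ext fun n => (injective_iff_map_eq_zero _).1 (h n).1 _ ?_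
      have := congrArg (fun z : B.Cohomology => z n) hx
      exact (DirectSum.lmap_apply _ _ _).symm.trans this
    · intro y
      induction y using DirectSum.induction_on with
      | zero => exact ⟨0, map_zero _⟩
      | of n y =>
        obtain ⟨x, rfl⟩ := (h n).2 y
        exact ⟨_, cohomologyMap_of f hf n x⟩
      | add y y' hy hy' =>
        obtain ⟨x, rfl⟩ := hy
        obtain ⟨x', rfl⟩ := hy'
        exact ⟨x + x', map_add _ _ _⟩
  exact ⟨{ Equiv.ofBijective Φ hbij with
    map_mul' := hmul'
    map_add' := map_add Φ }, fun _ => rfl⟩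

end

/-- The cohomology ring of a differential graded algebra over `k` is a `k`-algebra. -/
noncomputable instance cohomologyAlgebra (A : DGAlg k) : Algebra k A.Cohomology :=
  Algebra.ofModule
    (fun r x y => by
      induction x using cohomology_induction with
      | h0 => simp
      | hadd x x' hx hx' => rw [smul_add, add_mul, add_mul, hx, hx', smul_add]
      | h m a =>
      induction y using cohomology_induction with
      | h0 => simp
      | hadd y y' hy hy' => rw [mul_add, mul_add, hy, hy', smul_add]
      | h n b => rw [← map_smul, clsRing_mul rfl, clsRing_mul rfl, map_smul, LinearMap.smul_apply,
          map_smul])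
    (fun r x y => by
      induction x using cohomology_induction with
      | h0 => simp
      | hadd x x' hx hx' => rw [add_mul, add_mul, hx, hx', smul_add]
      | h m a =>
      induction y using cohomology_induction with
      | h0 => simp
      | hadd y y' hy hy' => rw [smul_add, mul_add, mul_add, hy, hy', smul_add]
      | h n b => rw [← map_smul, clsRing_mul rfl, clsRing_mul rfl, map_smul, map_smul])

end DGAlg

/-! ### Tensor products with an exterior algebra -/

namespace DGAlg

universe v

section ExteriorBasis

variable (k : Type v) [Field k] (d : ℕ)

/-- The basis of the exterior algebra formed by the ordered products of the generators. -/
noncomputable def extBasis : Module.Basis (Finset (Fin d)) k (ExteriorAlgebra k (Fin d → k)) :=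
  (Pi.basisFun k (Fin d)).ExteriorAlgebra

theorem extBasis_mem (S : Finset (Fin d)) :
    extBasis k d S ∈ ⋀[k]^S.card (Fin d → k) := by
  rw [extBasis, ExteriorAlgebra.basis_apply_ofCard _ (rfl : S.card = S.card)]
  exact (exteriorPower.ιMulti_family k S.card (Pi.basisFun k (Fin d)) _).2

/-- The ordered product of the generators in `S`, as an element of degree `|S|`. -/
noncomputable def extMon (S : Finset (Fin d)) : (exteriorDGAlg k d).X S.card :=
  ⟨extBasis k d S, extBasis_mem k d S⟩

/-- The inclusion of the elements of degree `j` into the exterior algebra. -/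
noncomputable def extVal (j : ℕ) : (exteriorDGAlg k d).X j →ₗ[k] ExteriorAlgebra k (Fin d → k) :=
  (⋀[k]^j (Fin d → k)).subtype

variable {k d}

theorem extVal_mul {i j r : ℕ} (h : i + j = r) (a : (exteriorDGAlg k d).X i)
    (b : (exteriorDGAlg k d).X j) :
    extVal k d r ((exteriorDGAlg k d).mul h a b) = extVal k d i a * extVal k d j b := rfl

theorem exteriorDGAlg_hom_ext {P : Type*} [AddCommGroup P] [Module k P] {j : ℕ}
    {f g : (exteriorDGAlg k d).X j →ₗ[k] P}
    (h : ∀ S (e : (exteriorDGAlg k d).X j), S.card = j → extVal k d j e = extBasis k d S →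
      f e = g e) : f = g := by
  refine Module.Basis.ext ((Pi.basisFun k (Fin d)).exteriorPower j) fun s => ?_
  refine h s.1 _ s.2 ?_
  exact (ExteriorAlgebra.basis_eq_coe_basis (Pi.basisFun k (Fin d)) s).symm

end ExteriorBasis

section Decomposition

variable {k : Type v} [Field k] {d : ℕ} {A : DGAlg k}

/-- The identity of `A.X i` if `i = j`, and zero otherwise. -/
def eqMap (A : DGAlg k) (i j : ℕ) : A.X i →ₗ[k] A.X j :=
  if h : i = j then h ▸ LinearMap.id else 0

theorem eqMap_self (i : ℕ) (a : A.X i) : A.eqMap i i a = a := by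
  rw [eqMap, dif_pos rfl]
  rfl

theorem d_eqMap (i j : ℕ) (a : A.X i) :
    A.d j (A.eqMap i j a) = A.eqMap (i + 1) (j + 1) (A.d i a) := by
  by_cases h : i = j
  · subst h
    rw [eqMap_self, eqMap_self]
  · rw [eqMap, eqMap, dif_neg h, dif_neg (by omega)]
    simp

/-- The coefficient in degree `i` of the ordered product of the generators in `S`. -/
noncomputable def coeff (A : DGAlg k) (d : ℕ) (S : Finset (Fin d)) (n i : ℕ) :
    TensorX A (exteriorDGAlg k d) n →ₗ[k] A.X i :=
  tdesc fun i' j _ => LinearMap.mk₂ k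
    (fun a b => (extBasis k d).repr (extVal k d j b) S • A.eqMap i' i a)
    (fun _ _ _ => by rw [map_add, smul_add])
    (fun _ _ _ => by rw [map_smul, smul_comm])
    (fun _ _ _ => by rw [map_add, map_add, Finsupp.add_apply, add_smul])
    (fun _ _ _ => by rw [map_smul, map_smul, Finsupp.smul_apply, smul_eq_mul, smul_smul])

theorem coeff_tmul (S : Finset (Fin d)) {n i i' j : ℕ} (h : i' + j = n) (a : A.X i')
    (b : (exteriorDGAlg k d).X j) :
    coeff A d S n i (tmul A (exteriorDGAlg k d) h a b) =
      (extBasis k d).repr (extVal k d j b) S • A.eqMap i' i a :=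
  tdesc_tmul _ _ _ _

theorem tensorD_exterior {n i j : ℕ} (h : i + j = n) (a : A.X i) (b : (exteriorDGAlg k d).X j) :
    tensorD A (exteriorDGAlg k d) n (tmul A (exteriorDGAlg k d) h a b) =
      tmul A (exteriorDGAlg k d) (show (i + 1) + j = n + 1 by omega) (A.d i a) b := by
  rw [tensorD_tmul, show (exteriorDGAlg k d).d j b = 0 from rfl, map_zero, smul_zero, add_zero]

theorem coeff_tensorD (S : Finset (Fin d)) (n i : ℕ) (u : TensorX A (exteriorDGAlg k d) n) :
    coeff A d S (n + 1) (i + 1) (tensorD A (exteriorDGAlg k d) n u) =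
      A.d i (coeff A d S n i u) := by
  induction u using tensor_ind with
  | h0 => simp
  | hadd x y hx hy => rw [map_add, map_add, map_add, map_add, hx, hy]
  | h i' j h a b => rw [tensorD_exterior, coeff_tmul, coeff_tmul, map_smul, d_eqMap]

theorem tmul_eqMap {i i' j n : ℕ} (hi : i = i') (h : i + j = n) (h' : i' + j = n) (a : A.X i)
    (b : (exteriorDGAlg k d).X j) :
    tmul A (exteriorDGAlg k d) h' (A.eqMap i i' a) b = tmul A (exteriorDGAlg k d) h a b := by
  subst hi
  rw [eqMap_self]

theorem extMon_congr {S : Finset (Fin d)} {j n i : ℕ} (hj : S.card = j) (h : i + j = n)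
    (h' : i + S.card = n) {e : (exteriorDGAlg k d).X j} (he : extVal k d j e = extBasis k d S)
    (a : A.X i) : tmul A (exteriorDGAlg k d) h' a (extMon k d S) =
      tmul A (exteriorDGAlg k d) h a e := by
  subst hj
  congr 1
  exact Subtype.ext he.symm

/-- Every element of the tensor product with the exterior algebra is the combination of the ordered
products of the generators with its coefficients. -/
theorem eq_sum_coeff (n : ℕ) (u : TensorX A (exteriorDGAlg k d) n) :
    u = ∑ S : {S : Finset (Fin d) // S.card ≤ n}, tmul A (exteriorDGAlg k d)
      (Nat.sub_add_cancel S.2) (coeff A d S n (n - S.1.card) u) (extMon k d S) := by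
  classical
  have key : LinearMap.id = ∑ S : {S : Finset (Fin d) // S.card ≤ n},
      (tmul A (exteriorDGAlg k d) (Nat.sub_add_cancel S.2)).flip (extMon k d S) ∘ₗ
        coeff A d S n (n - S.1.card) := by
    refine tensor_hom_ext fun i j h a b => ?_
    refine LinearMap.congr_fun (exteriorDGAlg_hom_ext (f := tmul A (exteriorDGAlg k d) h a)
      (g := (∑ S : {S : Finset (Fin d) // S.card ≤ n},
        (tmul A (exteriorDGAlg k d) (Nat.sub_add_cancel S.2)).flip (extMon k d S) ∘ₗ
          coeff A d S n (n - S.1.card)) ∘ₗ tmul A (exteriorDGAlg k d) h a) fun T e hT he => ?_) b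
    rw [LinearMap.comp_apply, LinearMap.sum_apply,
      Finset.sum_eq_single (⟨T, by omega⟩ : {S : Finset (Fin d) // S.card ≤ n})]
    · rw [LinearMap.comp_apply, LinearMap.flip_apply, coeff_tmul, he, Module.Basis.repr_self,
        Finsupp.single_eq_same, one_smul, extMon_congr hT (by dsimp only; omega) _ he,
        tmul_eqMap (by dsimp only; omega) h]
    · rintro ⟨S, hS⟩ - hST
      rw [LinearMap.comp_apply, LinearMap.flip_apply, coeff_tmul, he, Module.Basis.repr_self,
        Finsupp.single_eq_of_ne (fun h => hST (Subtype.ext h)), zero_smul, map_zero,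
        LinearMap.zero_apply]
    · intro h
      exact absurd (Finset.mem_univ _) h
  have := LinearMap.congr_fun key u
  rw [LinearMap.id_apply, LinearMap.sum_apply] at this
  exact this

theorem coeff_mem_cocycles (S : Finset (Fin d)) {n : ℕ} (i : ℕ)
    {u : TensorX A (exteriorDGAlg k d) n} (hu : tensorD A (exteriorDGAlg k d) n u = 0) :
    coeff A d S n i u ∈ A.cocycles i := by
  change A.d i _ = 0
  rw [← coeff_tensorD, hu, map_zero]

theorem tmul_mem_cocycles {n i j : ℕ} (h : i + j = n) {a : A.X i} (ha : a ∈ A.cocycles i)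
    (b : (exteriorDGAlg k d).X j) :
    tmul A (exteriorDGAlg k d) h a b ∈ (A.tensor (exteriorDGAlg k d)).cocycles n := by
  change tensorD A (exteriorDGAlg k d) n _ = 0
  rw [tensorD_exterior, show A.d i a = 0 from ha, map_zero, LinearMap.zero_apply]

theorem tmul_mem_coboundaries {n i j : ℕ} (h : i + j = n) {a : A.X i}
    (ha : a ∈ A.coboundaries i) (b : (exteriorDGAlg k d).X j) :
    tmul A (exteriorDGAlg k d) h a b ∈ (A.tensor (exteriorDGAlg k d)).coboundaries n := by
  cases i with
  | zero =>
    rw [show a = 0 from ha, map_zero, LinearMap.zero_apply]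
    exact zero_mem _
  | succ i =>
    obtain ⟨c, rfl⟩ := ha
    obtain ⟨n, rfl⟩ : ∃ n', n = n' + 1 := ⟨i + j, by omega⟩
    exact ⟨tmul A (exteriorDGAlg k d) (by omega) c b, tensorD_exterior _ c b⟩

end Decomposition

end DGAlg

/-! ### Quasi-isomorphisms out of a tensor product with an exterior algebra -/

namespace DGAlg

universe v

variable {k : Type v} [Field k] {d : ℕ} {A B : DGAlg k}

section Exterior

variable {f : ExteriorAlgebra k (Fin d → k) →ₐ[k] B.Cohomology}

theorem exterior_map_mem_range (h1 : ∀ v, f (ExteriorAlgebra.ι k v) ∈ LinearMap.range (B.clsRing 1))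
    {j : ℕ} {x : ExteriorAlgebra k (Fin d → k)} (hx : x ∈ ⋀[k]^j (Fin d → k)) :
    f x ∈ LinearMap.range (B.clsRing j) := by
  induction hx using Submodule.pow_induction_on_left' with
  | algebraMap r =>
    rw [AlgHom.commutes, Algebra.algebraMap_eq_smul_one]
    exact Submodule.smul_mem _ _ ⟨_, clsRing_one⟩
  | add x y i _ _ hx hy => rw [map_add]; exact add_mem hx hy
  | mem_mul m hm i x _ hx =>
    obtain ⟨v, rfl⟩ := hm
    obtain ⟨a, ha⟩ := h1 v
    obtain ⟨b, hb⟩ := hx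
    rw [map_mul, ← ha, ← hb, clsRing_mul (Nat.add_comm 1 i)]
    exact ⟨_, rfl⟩

theorem exterior_map_comm
    (h2 : ∀ v n (c : B.cocycles n), f (ExteriorAlgebra.ι k v) * B.clsRing n c =
      (-1 : k) ^ n • (B.clsRing n c * f (ExteriorAlgebra.ι k v)))
    {j : ℕ} {x : ExteriorAlgebra k (Fin d → k)} (hx : x ∈ ⋀[k]^j (Fin d → k)) {n : ℕ}
    (c : B.cocycles n) :
    f x * B.clsRing n c = (-1 : k) ^ (j * n) • (B.clsRing n c * f x) := by
  induction hx using Submodule.pow_induction_on_left' with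
  | algebraMap r =>
    rw [AlgHom.commutes, zero_mul, pow_zero, one_smul, Algebra.commutes]
  | add x y i _ _ hx hy => rw [map_add, add_mul, mul_add, smul_add, hx, hy]
  | mem_mul m hm i x _ hx =>
    obtain ⟨v, rfl⟩ := hm
    rw [map_mul, _root_.mul_assoc, hx, mul_smul_comm, ← _root_.mul_assoc, h2, smul_mul_assoc,
      smul_smul, ← _root_.mul_assoc, ← pow_add, Nat.succ_mul]

theorem exists_cocycle_lift
    (h1 : ∀ v, f (ExteriorAlgebra.ι k v) ∈ LinearMap.range (B.clsRing 1)) (j : ℕ) :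
    ∃ l : (exteriorDGAlg k d).X j →ₗ[k] B.cocycles j,
      ∀ b, B.clsRing j (l b) = f (extVal k d j b) := by
  obtain ⟨l, hl⟩ := Module.projective_lifting_property (B.clsRing j).rangeRestrict
    ((f.toLinearMap ∘ₗ extVal k d j).codRestrict (LinearMap.range (B.clsRing j))
      fun b => exterior_map_mem_range h1 b.2) (LinearMap.surjective_rangeRestrict _)
  exact ⟨l, fun b => congrArg Subtype.val (LinearMap.congr_fun hl b)⟩

end Exterior

section Tensor

/-- The cocycle `a ⊗ b` of a tensor product with an exterior algebra. -/
noncomputable def tmulCocycle {i j n : ℕ} (h : i + j = n) (a : A.cocycles i)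
    (b : (exteriorDGAlg k d).X j) : (A.tensor (exteriorDGAlg k d)).cocycles n :=
  ⟨tmul A (exteriorDGAlg k d) h a b, tmul_mem_cocycles h a.2 b⟩

theorem exists_eq_sum_tmulCocycle {n : ℕ} (x : (A.tensor (exteriorDGAlg k d)).cocycles n) :
    ∃ a : ∀ S : {S : Finset (Fin d) // S.card ≤ n}, A.cocycles (n - S.1.card),
      x = ∑ S : {S : Finset (Fin d) // S.card ≤ n},
        tmulCocycle (Nat.sub_add_cancel S.2) (a S) (extMon k d S) := by
  refine ⟨fun S => ⟨_, coeff_mem_cocycles S.1 _ x.2⟩, Subtype.ext ?_⟩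
  rw [AddSubmonoidClass.coe_finsetSum]
  exact eq_sum_coeff n x.1

theorem cocyclesMul_tmulCocycle {i j m i' j' n i'' j'' r : ℕ} (h : i + j = m) (h' : i' + j' = n)
    (hi : i + i' = i'') (hj : j + j' = j'') (hr : i'' + j'' = r) (hm : m + n = r)
    (a : A.cocycles i) (b : (exteriorDGAlg k d).X j) (a' : A.cocycles i')
    (b' : (exteriorDGAlg k d).X j') :
    (A.tensor (exteriorDGAlg k d)).cocyclesMul hm (tmulCocycle h a b) (tmulCocycle h' a' b') =
      (-1 : k) ^ (j * i') • tmulCocycle hr (A.cocyclesMul hi a a')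
        ((exteriorDGAlg k d).mul hj b b') :=
  Subtype.ext (tensorMul_tmul A (exteriorDGAlg k d) hm h h' hi hj hr _ _ _ _)

/-- The classes of the cocycles `a ⊗ b` generate the cohomology of the tensor product. -/
theorem tensor_cohomology_induction {P : (A.tensor (exteriorDGAlg k d)).Cohomology → Prop}
    (h0 : P 0) (hadd : ∀ x y, P x → P y → P (x + y))
    (h : ∀ i j (a : A.cocycles i) (b : (exteriorDGAlg k d).X j),
      P (clsRing _ (i + j) (tmulCocycle rfl a b))) (x) : P x := by
  induction x using cohomology_induction with
  | h0 => exact h0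
  | hadd x y hx hy => exact hadd x y hx hy
  | h n x =>
    obtain ⟨a, rfl⟩ := exists_eq_sum_tmulCocycle x
    rw [map_sum]
    refine Finset.sum_induction _ P hadd h0 fun S _ => ?_
    have : ∀ i j (hn : i + j = n) (a : A.cocycles i) (b : (exteriorDGAlg k d).X j),
        P (clsRing _ n (tmulCocycle hn a b)) := by
      rintro i j rfl a b
      exact h i j a b
    exact this _ _ _ _ _

/-- The map `a ⊗ b ↦ g a · l b` out of a tensor product with an exterior algebra. -/
noncomputable def tensorMap (g : ∀ n, A.X n →ₗ[k] B.X n)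
    (l : ∀ j, (exteriorDGAlg k d).X j →ₗ[k] B.cocycles j) (n : ℕ) :
    (A.tensor (exteriorDGAlg k d)).X n →ₗ[k] B.X n :=
  tdesc (A := A) (B := exteriorDGAlg k d) fun i j h =>
    (B.mul h).compl₁₂ (g i) ((B.cocycles j).subtype ∘ₗ l j)

theorem tensorMap_tmul (g : ∀ n, A.X n →ₗ[k] B.X n)
    (l : ∀ j, (exteriorDGAlg k d).X j →ₗ[k] B.cocycles j) {i j n : ℕ} (h : i + j = n) (a : A.X i)
    (b : (exteriorDGAlg k d).X j) :
    tensorMap g l n (tmul A (exteriorDGAlg k d) h a b) = B.mul h (g i a) (l j b) :=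
  tdesc_tmul _ _ _ _

theorem tensorMap_d {g : ∀ n, A.X n →ₗ[k] B.X n} (hg : ∀ n a, g (n + 1) (A.d n a) = B.d n (g n a))
    (l : ∀ j, (exteriorDGAlg k d).X j →ₗ[k] B.cocycles j) (n : ℕ)
    (u : (A.tensor (exteriorDGAlg k d)).X n) :
    tensorMap g l (n + 1) ((A.tensor (exteriorDGAlg k d)).d n u) =
      B.d n (tensorMap g l n u) := by
  have : tensorMap g l (n + 1) ∘ₗ tensorD A (exteriorDGAlg k d) n = B.d n ∘ₗ tensorMap g l n := by
    refine tensor_hom_ext fun i j h a b => ?_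
    refine (congrArg (tensorMap g l (n + 1)) (tensorD_exterior h a b)).trans ?_
    refine Eq.trans ?_ (congrArg (B.d n) (tensorMap_tmul g l h a b)).symm
    rw [tensorMap_tmul, hg, B.leibniz h (by omega) (by omega),
      show B.d j (l j b) = 0 from (l j b).2, map_zero, smul_zero, add_zero]
  exact LinearMap.congr_fun this u

theorem clsRing_tensorMap {g : ∀ n, A.X n →ₗ[k] B.X n}
    (hg : ∀ n a, g (n + 1) (A.d n a) = B.d n (g n a))
    {l : ∀ j, (exteriorDGAlg k d).X j →ₗ[k] B.cocycles j}
    {f : ExteriorAlgebra k (Fin d → k) →ₐ[k] B.Cohomology}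
    (hl : ∀ j b, B.clsRing j (l j b) = f (extVal k d j b)) {i j n : ℕ} (h : i + j = n)
    (a : A.cocycles i) (b : (exteriorDGAlg k d).X j) :
    B.clsRing n (mapCocycles (tensorMap g l) (tensorMap_d hg l) n (tmulCocycle h a b)) =
      B.clsRing i (mapCocycles g hg i a) * f (extVal k d j b) := by
  rw [← hl, clsRing_mul h]
  congr 1
  exact Subtype.ext (tensorMap_tmul g l h a b)

end Tensor

/-- Let `g : A → B` be a homomorphism of differential graded algebras and let `f` be a homomorphism
from an exterior algebra to the cohomology ring of `B` whose values on the generators are of degree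
`1` and commute with all classes in the graded sense. If every class of `B` is uniquely a
combination of the values of `f` on the ordered monomials with classes of `A` as coefficients, then
`a ⊗ b ↦ g a · l b`, where `l` picks cocycles linearly, is a quasi-isomorphism that induces an
isomorphism of cohomology rings. -/
theorem exists_quasiIso_of_exterior {g : ∀ n, A.X n →ₗ[k] B.X n}
    (hg : ∀ n a, g (n + 1) (A.d n a) = B.d n (g n a))
    (hgm : ∀ {m n r : ℕ} (h : m + n = r) (a : A.X m) (b : A.X n),
      g r (A.mul h a b) = B.mul h (g m a) (g n b))
    {f : ExteriorAlgebra k (Fin d → k) →ₐ[k] B.Cohomology}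
    (h1 : ∀ v, f (ExteriorAlgebra.ι k v) ∈ LinearMap.range (B.clsRing 1))
    (h2 : ∀ v n (c : B.cocycles n), f (ExteriorAlgebra.ι k v) * B.clsRing n c =
      (-1 : k) ^ n • (B.clsRing n c * f (ExteriorAlgebra.ι k v)))
    (hsurj : ∀ n (b : B.cocycles n), ∃ a : ∀ S : {S : Finset (Fin d) // S.card ≤ n},
      A.cocycles (n - S.1.card), B.clsRing n b =
        ∑ S, B.clsRing _ (mapCocycles g hg _ (a S)) * f (extBasis k d S.1))
    (hinj : ∀ n (a : ∀ S : {S : Finset (Fin d) // S.card ≤ n}, A.cocycles (n - S.1.card)),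
      ∑ S, B.clsRing _ (mapCocycles g hg _ (a S)) * f (extBasis k d S.1) = 0 →
      ∀ S, (a S : A.X (n - S.1.card)) ∈ A.coboundaries _) :
    ∃ φ : (A.tensor (exteriorDGAlg k d)).complex ⟶ B.complex, QuasiIso φ ∧ InducesRingIso φ := by
  choose l hl using exists_cocycle_lift h1
  have hF := tensorMap_d hg l
  have hcls := @clsRing_tensorMap _ _ _ _ _ _ hg _ _ hl
  have hsum : ∀ n (a : ∀ S : {S : Finset (Fin d) // S.card ≤ n}, A.cocycles (n - S.1.card)),
      B.clsRing n (mapCocycles (tensorMap g l) hF n (∑ S : {S : Finset (Fin d) // S.card ≤ n},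
        tmulCocycle (Nat.sub_add_cancel S.2) (a S) (extMon k d S))) =
      ∑ S, B.clsRing _ (mapCocycles g hg _ (a S)) * f (extBasis k d S.1) := fun n a => by
    rw [map_sum, map_sum]
    exact Finset.sum_congr rfl fun S _ => hcls _ _ _
  have hbij := bijective_homologyMap (tensorMap g l) hF (fun n b hb => ?_) fun n u hu hub => ?_
  · refine ⟨complexHom (tensorMap g l) hF, quasiIso_complexHom _ hF hbij,
      inducesRingIso_complexHom _ hF hbij fun m n x y => ?_⟩
    generalize clsRing _ m x = X
    generalize clsRing _ n y = Y
    induction X using tensor_cohomology_induction with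
    | h0 => rw [zero_mul, map_zero, zero_mul]
    | hadd X X' hX hX' => rw [add_mul, map_add, hX, hX', map_add, add_mul]
    | h i j a b =>
    induction Y using tensor_cohomology_induction with
    | h0 => rw [mul_zero, map_zero, mul_zero]
    | hadd Y Y' hY hY' => rw [mul_add, map_add, hY, hY', map_add, mul_add]
    | h i' j' a' b' =>
      have e : B.clsRing (i + i') (mapCocycles g hg _ (A.cocyclesMul rfl a a')) =
          B.clsRing i (mapCocycles g hg i a) * B.clsRing i' (mapCocycles g hg i' a') := by
        rw [clsRing_mul rfl]
        congr 1
        exact Subtype.ext (hgm rfl _ _)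
      rw [clsRing_mul rfl, cocyclesMul_tmulCocycle rfl rfl rfl rfl (by omega), map_smul, map_smul,
        cohomologyMap_clsRing, cohomologyMap_clsRing, cohomologyMap_clsRing, hcls, hcls, hcls,
        extVal_mul, map_mul, e, _root_.mul_assoc, _root_.mul_assoc, ← _root_.mul_assoc (f _),
        exterior_map_comm h2 (x := extVal k d j b) b.2, smul_mul_assoc, mul_smul_comm,
        _root_.mul_assoc]
  · obtain ⟨a, ha⟩ := hsurj n ⟨b, hb⟩
    exact ⟨_, Subtype.property _, (clsRing_eq_iff ⟨b, hb⟩ _).1 (ha.trans (hsum n a).symm)⟩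
  · obtain ⟨a, ha⟩ := exists_eq_sum_tmulCocycle ⟨u, hu⟩
    have h0 : B.clsRing n (mapCocycles (tensorMap g l) hF n ⟨u, hu⟩) = 0 := by
      rw [← map_zero (B.clsRing n), clsRing_eq_iff]
      rw [ZeroMemClass.coe_zero, sub_zero]
      exact hub
    rw [ha, hsum] at h0
    have hu' := congrArg Subtype.val ha
    rw [AddSubmonoidClass.coe_finsetSum] at hu'
    rw [show u = _ from hu']
    exact sum_mem fun S _ => tmul_mem_coboundaries _ (hinj n a h0 S) _

end DGAlg

/-! ### Components of invariant total cochains -/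

namespace TotalCochain

open GroupCochains Finset

variable {k : Type u} [Field k] {G : Type u} [CommGroup G]

/-- The extension of a tuple to a sequence, by the value `1`. -/
def extend {n : ℕ} (x : Fin (n + 1) → G) (j : ℕ) : G := if h : j < n + 1 then x ⟨j, h⟩ else 1

theorem extend_of_le {n j : ℕ} (x : ℕ → G) (h : j ≤ n) :
    extend (fun i : Fin (n + 1) => x i) j = x j := dif_pos (Nat.lt_succ_of_le h)

/-- The component of degree `n` of an invariant total cochain. With the sign `(-1) ^ (n.choose 2)`
the differentials agree up to the constant sign `-1`, and the products `cupR` with cocycles of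
degree `1` agree with the cup products. -/
def comp (n : ℕ) : inv k (⊤ : Subgroup G) →ₗ[k] cochains k G n where
  toFun F := ⟨fun x => (-1) ^ n.choose 2 * F.1 n (extend x), fun g x => by
    refine congrArg _ ((F.2.1 n _ _ fun i hi => ?_).trans
      (inv_apply F.2 (Subgroup.mem_top g) n (extend x)))
    rw [extend, extend, dif_pos (Nat.lt_succ_of_le hi), dif_pos (Nat.lt_succ_of_le hi)]⟩
  map_add' F F' := by
    ext x
    exact mul_add _ _ _
  map_smul' c F := by
    ext x
    exact mul_left_comm _ _ _

theorem ev_comp (n : ℕ) (F : inv k (⊤ : Subgroup G)) (x : ℕ → G) :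
    ev (comp n F) x = (-1) ^ n.choose 2 * F.1 n x :=
  congrArg _ (F.2.1 n _ _ fun _ hi => extend_of_le x hi)

theorem neg_one_pow_mul_self (n : ℕ) : (-1 : k) ^ n * (-1) ^ n = 1 := by
  rw [← mul_pow]
  simp

theorem comp_ext {F F' : inv k (⊤ : Subgroup G)} (h : ∀ n, comp n F = comp n F') : F = F' := by
  refine Subtype.ext (funext fun n => funext fun x => ?_)
  have := congrArg (fun f => (-1) ^ n.choose 2 * ev f x) (h n)
  simpa only [ev_comp, ← mul_assoc, neg_one_pow_mul_self, one_mul] using this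

/-- The invariant total cochain with prescribed components. -/
def ofComp (c : ∀ n, cochains k G n) : inv k (⊤ : Subgroup G) :=
  ⟨fun n x => (-1) ^ n.choose 2 * ev (c n) x,
    fun n _ _ h => congrArg _ (ev_congr (c n) h), fun g _ => by
      funext n x
      exact congrArg _ ((c n).2 g _)⟩

theorem comp_ofComp (c : ∀ n, cochains k G n) (n : ℕ) : comp n (ofComp c) = c n := by
  refine ext_ev fun x => ?_
  rw [ev_comp]
  change _ * (_ * _) = _
  rw [← mul_assoc, neg_one_pow_mul_self, one_mul]

/-- The differential on invariant total cochains. -/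
def dInv : inv k (⊤ : Subgroup G) →ₗ[k] inv k (⊤ : Subgroup G) :=
  dT.restrict fun _ => dT_mem_inv

theorem comp_zero_dInv (F : inv k (⊤ : Subgroup G)) : comp 0 (dInv F) = 0 := by
  refine ext_ev fun x => ?_
  rw [ev_comp]
  exact mul_zero _

theorem comp_succ_dInv (n : ℕ) (F : inv k (⊤ : Subgroup G)) :
    comp (n + 1) (dInv F) = -diff n (comp n F) := by
  refine ext_ev fun x => ?_
  rw [ev_comp]
  change _ = -ev (diff n (comp n F)) x
  rw [ev_diff]
  simp only [ev_comp]
  change _ * dT F.1 (n + 1) x = _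
  rw [dT_succ, mul_sum, mul_sum, ← sum_neg_distrib]
  refine sum_congr rfl fun i _ => ?_
  rw [show (n + 1).choose 2 = n + n.choose 2 by
    rw [Nat.choose_succ_succ' n 1, Nat.choose_one_right]]
  ring

/-- The invariant total cocycles. -/
def zcyc (k G : Type u) [Field k] [CommGroup G] : Submodule k (inv k (⊤ : Subgroup G)) :=
  LinearMap.ker dInv

theorem mem_zcyc_iff (F : inv k (⊤ : Subgroup G)) : F ∈ zcyc k G ↔ dT F.1 = 0 :=
  Subtype.ext_iff

theorem comp_mem_cocycles (n : ℕ) {F : inv k (⊤ : Subgroup G)} (hF : F ∈ zcyc k G) :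
    comp n F ∈ (groupCochains k G).cocycles n := by
  have := comp_succ_dInv n F
  rw [show dInv F = 0 from hF, map_zero, zero_eq_neg] at this
  exact this

theorem ofComp_mem_zcyc {c : ∀ n, cochains k G n}
    (hc : ∀ n, c n ∈ (groupCochains k G).cocycles n) : ofComp c ∈ zcyc k G := by
  refine comp_ext fun n => ?_
  rw [map_zero]
  cases n with
  | zero => exact comp_zero_dInv _
  | succ n =>
    rw [comp_succ_dInv, comp_ofComp, neg_eq_zero]
    exact hc n

/-- The component of degree `n` of a total cocycle. -/
def compCocycle (n : ℕ) : zcyc k G →ₗ[k] (groupCochains k G).cocycles n :=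
  (comp n).restrict fun _ hF => comp_mem_cocycles n hF

/-- The class of the component of degree `n` of a total cocycle. -/
noncomputable def cl (n : ℕ) : zcyc k G →ₗ[k] (groupCochains k G).Cohomology :=
  (groupCochains k G).clsRing n ∘ₗ compCocycle n

theorem cl_eq_zero_iff (n : ℕ) (F : zcyc k G) :
    cl n F = 0 ↔ comp n F.1 ∈ (groupCochains k G).coboundaries n := by
  have := DGAlg.clsRing_eq_iff (compCocycle n F) 0
  rw [map_zero, ZeroMemClass.coe_zero, sub_zero] at this
  exact this

/-- A total cocycle is a coboundary if and only if the classes of its components vanish. -/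
theorem forall_cl_eq_zero_iff (F : zcyc k G) :
    (∀ n, cl n F = 0) ↔ ∃ w, dInv w = F.1 := by
  simp only [cl_eq_zero_iff]
  constructor
  · intro h
    choose c hc using fun n => show ∃ c, diff n c = comp (n + 1) F.1 from h (n + 1)
    refine ⟨ofComp (-c), comp_ext fun n => ?_⟩
    cases n with
    | zero => exact (comp_zero_dInv _).trans (show comp 0 F.1 = 0 from h 0).symm
    | succ n => rw [comp_succ_dInv, comp_ofComp, Pi.neg_apply, map_neg, neg_neg, hc]
  · rintro ⟨w, hw⟩ n
    rw [← hw]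
    cases n with
    | zero =>
      rw [comp_zero_dInv]
      exact zero_mem _
    | succ n =>
      rw [comp_succ_dInv]
      exact neg_mem ⟨_, rfl⟩

theorem cl_eq_of_dInv_eq {F F' : zcyc k G} {w : inv k (⊤ : Subgroup G)}
    (h : dInv w = F.1 - F'.1) (n : ℕ) : cl n F = cl n F' := by
  refine (DGAlg.clsRing_eq_iff (compCocycle n F) (compCocycle n F')).2 ?_
  have := (cl_eq_zero_iff n _).1 ((forall_cl_eq_zero_iff (F - F')).2 ⟨w, h⟩ n)
  exact (map_sub (comp n) F.1 F'.1) ▸ this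

section Concentrated

/-- The total cocycle that is concentrated in degree `n`, with component `b`. -/
noncomputable def single (n : ℕ) (b : (groupCochains k G).cocycles n) : zcyc k G :=
  ⟨ofComp (Pi.single n b.1), ofComp_mem_zcyc fun m => by
    obtain rfl | h := eq_or_ne m n
    · exact (congrArg (diff m) (Pi.single_eq_same m b.1)).trans b.2
    · exact (congrArg (diff m) (Pi.single_eq_of_ne h b.1)).trans (map_zero _)⟩

theorem compCocycle_single_self (n : ℕ) (b : (groupCochains k G).cocycles n) :
    compCocycle n (single n b) = b :=
  Subtype.ext ((comp_ofComp _ _).trans (Pi.single_eq_same n b.1))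

theorem compCocycle_single_of_ne {m n : ℕ} (h : m ≠ n) (b : (groupCochains k G).cocycles n) :
    compCocycle m (single n b) = 0 :=
  Subtype.ext ((comp_ofComp _ _).trans (Pi.single_eq_of_ne h b.1))

end Concentrated

section Pull

variable {K : Type u} [CommGroup K] (ι : K →* G)

theorem pull_mem_inv {F : Total k G} (hF : F ∈ inv k ι.range) :
    pull ι F ∈ inv k (⊤ : Subgroup K) :=
  ⟨hF.1.pull _, fun g _ => by
    conv_rhs => rw [← hF.2 (ι g) ⟨g, rfl⟩, pull_pull]
    rw [pull_pull]
    congr 1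
    congr 1
    funext x
    exact map_mul ι g x⟩

/-- Restriction of total cocycles along a homomorphism. -/
def res : zcyc k G →ₗ[k] zcyc k K :=
  ((pull ι).restrict fun _ hF => pull_mem_inv ι (inv_mono le_top hF)).restrict fun F hF => by
    rw [mem_zcyc_iff] at hF ⊢
    change dT (pull ι F.1) = 0
    rw [dT_pull, hF, map_zero]

/-- Restriction of cochains along a homomorphism. -/
def resCochain (n : ℕ) : (groupCochains k G).X n →ₗ[k] (groupCochains k K).X n where
  toFun f := ⟨fun x => f.1 (ι ∘ x), fun g x => by
    refine Eq.trans (congrArg f.1 ?_) (f.2 (ι g) (ι ∘ x))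
    funext j
    exact map_mul ι g (x j)⟩
  map_add' _ _ := rfl
  map_smul' _ _ := rfl

theorem resCochain_d (n : ℕ) (a : (groupCochains k G).X n) :
    resCochain ι (n + 1) ((groupCochains k G).d n a) =
      (groupCochains k K).d n (resCochain ι n a) := rfl

theorem resCochain_mul {m n r : ℕ} (h : m + n = r) (a : (groupCochains k G).X m)
    (b : (groupCochains k G).X n) : resCochain ι r ((groupCochains k G).mul h a b) =
      (groupCochains k K).mul h (resCochain ι m a) (resCochain ι n b) := rfl

theorem compCocycle_res (n : ℕ) (F : zcyc k G) : compCocycle n (res ι F) =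
    DGAlg.mapCocycles (resCochain ι) (resCochain_d ι) n (compCocycle n F) := by
  refine Subtype.ext (ext_ev fun x => ?_)
  change ev (comp n (res ι F).1) x = ev (comp n F.1) (ι ∘ x)
  rw [ev_comp, ev_comp]
  rfl

theorem cl_res (n : ℕ) (F : zcyc k G) : cl n (res ι F) = (groupCochains k K).clsRing n
    (DGAlg.mapCocycles (resCochain ι) (resCochain_d ι) n (compCocycle n F)) :=
  congrArg ((groupCochains k K).clsRing n) (compCocycle_res ι n F)

theorem pull_cupMon {r : ℕ → G → k} {χ : ℕ → K → k} {m : ℕ}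
    (h : ∀ l < m, ∀ x, r l (ι x) = χ l x) (S : Finset ℕ) (F : Total k G) :
    pull ι (cupMon r S m F) = cupMon χ S m (pull ι F) := by
  induction m with
  | zero => rfl
  | succ m ih =>
    by_cases hm : m ∈ S
    · rw [cupMon_succ_of_mem hm, cupMon_succ_of_mem hm, ← ih fun l hl => h l (by omega)]
      funext n x
      cases n with
      | zero => rfl
      | succ n =>
        rw [pull_apply, cupR_succ, cupR_succ, pull_apply, ← h m (by omega), ← h m (by omega)]
        rfl
    · rw [cupMon_succ_of_notMem hm, cupMon_succ_of_notMem hm, ih fun l hl => h l (by omega)]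

end Pull

section Characters

/-- The additive character `χ` as a function on the multiplicative group `G`. -/
def charFun (χ : Additive G →+ k) (x : G) : k := χ (Additive.ofMul x)

theorem charFun_mul (χ : Additive G →+ k) (x y : G) :
    charFun χ (x * y) = charFun χ x + charFun χ y := map_add χ _ _

theorem charFun_inv (χ : Additive G →+ k) (x : G) : charFun χ x⁻¹ = -charFun χ x := map_neg χ _

/-- The homogeneous cochain `(x, y) ↦ χ y - χ x` of an additive character `χ`. -/
def charCochain : (Additive G →+ k) →ₗ[k] cochains k G 1 where
  toFun χ := ⟨fun x => charFun χ (x 1) - charFun χ (x 0), fun g x => by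
    simp only [charFun_mul, add_sub_add_left_eq_sub]⟩
  map_add' χ χ' := Subtype.ext (funext fun x => add_sub_add_comm _ _ _ _)
  map_smul' c χ := Subtype.ext (funext fun x => (mul_sub _ _ _).symm)

theorem ev_charCochain (χ : Additive G →+ k) (x : ℕ → G) :
    ev (charCochain χ) x = charFun χ (x 1) - charFun χ (x 0) := rfl

theorem diff_charCochain (χ : Additive G →+ k) : diff 1 (charCochain χ) = 0 := by
  refine ext_ev fun x => ?_
  change _ = (0 : k)
  rw [ev_diff]
  simp [ev_charCochain, sum_range_succ, skip]

/-- The cocycle `(x, y) ↦ χ y - χ x` of an additive character `χ`. -/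
def charCocycle : (Additive G →+ k) →ₗ[k] (groupCochains k G).cocycles 1 :=
  charCochain.codRestrict _ diff_charCochain

end Characters

end TotalCochain

/-! ### Products with the cocycles of characters -/

namespace TotalCochain

open GroupCochains Finset

variable {k : Type u} [Field k] {G : Type u} [CommGroup G]

section CupMonomials

theorem cupR_mem_inv (χ : Additive G →+ k) {F : Total k G} (hF : F ∈ inv k (⊤ : Subgroup G)) :
    cupR (charFun χ) F ∈ inv k (⊤ : Subgroup G) :=
  ⟨hF.1.cupR _, fun g hg => by
    funext n x
    cases n with
    | zero => rfl
    | succ n =>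
      rw [pull_apply, cupR_succ, cupR_succ]
      simp only [Function.comp, charFun_mul, add_sub_add_left_eq_sub]
      exact congrArg (· * _) (inv_apply hF hg n x)⟩

/-- The product of total cocycles with the cocycle of an additive character. -/
def cupChar (χ : Additive G →+ k) : zcyc k G →ₗ[k] zcyc k G :=
  ((cupR (charFun χ)).restrict fun _ => cupR_mem_inv χ).restrict fun F hF => by
    rw [mem_zcyc_iff] at hF ⊢
    change dT (cupR _ F.1) = 0
    rw [dT_cupR _ F.2.1, hF, map_zero]

theorem cl_zero_cupChar (χ : Additive G →+ k) (F : zcyc k G) : cl 0 (cupChar χ F) = 0 := by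
  rw [cl_eq_zero_iff]
  refine ext_ev fun x => ?_
  rw [ev_comp]
  exact mul_zero _

theorem cl_succ_cupChar (χ : Additive G →+ k) (n : ℕ) (F : zcyc k G) :
    cl (n + 1) (cupChar χ F) =
      cl n F * (groupCochains k G).clsRing 1 (charCocycle χ) := by
  refine Eq.trans ?_ (DGAlg.clsRing_mul rfl _ _).symm
  refine congrArg ((groupCochains k G).clsRing (n + 1)) (Subtype.ext (ext_ev fun x => ?_))
  refine Eq.trans (ev_comp _ _ _) (Eq.trans ?_ (ev_cup rfl _ _ _).symm)
  change _ * cupR (charFun χ) F.1.1 (n + 1) x = _ * (ev (comp n F.1) x * ev (charCochain χ) _)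
  rw [ev_comp, ev_charCochain, cupR_succ,
    show (n + 1).choose 2 = n + n.choose 2 by rw [Nat.choose_succ_succ' n 1, Nat.choose_one_right],
    mul_one]
  simp only [add_zero]
  ring

/-- The product, in increasing order, of the `y l` for the `l < m` in the set `S`. -/
def ordProd {R : Type*} [Monoid R] (y : ℕ → R) (S : Finset ℕ) (m : ℕ) : R :=
  (((List.range m).filter (· ∈ S)).map y).prod

theorem ordProd_succ_of_mem {R : Type*} [Monoid R] (y : ℕ → R) {S : Finset ℕ} {m : ℕ}
    (h : m ∈ S) : ordProd y S (m + 1) = ordProd y S m * y m := by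
  simp [ordProd, List.range_succ, h]

theorem ordProd_succ_of_notMem {R : Type*} [Monoid R] (y : ℕ → R) {S : Finset ℕ} {m : ℕ}
    (h : m ∉ S) : ordProd y S (m + 1) = ordProd y S m := by
  simp [ordProd, List.range_succ, h]

theorem map_ordProd {R R' : Type*} [Monoid R] [Monoid R'] (f : R →* R') (y : ℕ → R)
    (S : Finset ℕ) (m : ℕ) : f (ordProd y S m) = ordProd (f ∘ y) S m := by
  rw [ordProd, map_list_prod, List.map_map]
  rfl

/-- The product of a total cocycle with the cocycles of characters is a total cocycle, and its class
is the product of the classes. The degree is raised by the number of factors, so that the classes in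
smaller degrees vanish. -/
theorem exists_cupMon_eq (χ : ℕ → Additive G →+ k) (S : Finset ℕ) (m : ℕ) (F : zcyc k G) :
    ∃ F' : zcyc k G, F'.1.1 = cupMon (fun l => charFun (χ l)) S m F.1.1 ∧
      ∀ n, cl n F' = if ((range m).filter (· ∈ S)).card ≤ n then
        cl (n - ((range m).filter (· ∈ S)).card) F *
          ordProd (fun l => (groupCochains k G).clsRing 1 (charCocycle (χ l))) S m else 0 := by
  induction m with
  | zero => exact ⟨F, rfl, fun n => by simp [ordProd]⟩
  | succ m ih =>
    obtain ⟨F', hF', h⟩ := ih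
    by_cases hm : m ∈ S
    · refine ⟨cupChar (χ m) F', ?_, fun n => ?_⟩
      · rw [cupMon_succ_of_mem hm, ← hF']
        rfl
      · rw [range_add_one, filter_insert, if_pos hm, card_insert_of_notMem (by simp),
          ordProd_succ_of_mem _ hm]
        cases n with
        | zero => rw [cl_zero_cupChar, if_neg (by omega)]
        | succ n =>
          rw [cl_succ_cupChar, h, Nat.add_sub_add_right]
          by_cases hn : ((range m).filter (· ∈ S)).card ≤ n
          · rw [if_pos hn, if_pos (by omega), mul_assoc]
          · rw [if_neg hn, if_neg (by omega), zero_mul]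
    · refine ⟨F', ?_, fun n => ?_⟩
      · rw [cupMon_succ_of_notMem hm, hF']
      · rw [range_add_one, filter_insert, if_neg hm, ordProd_succ_of_notMem _ hm, h]

end CupMonomials

section Relations

/-- The product of a cochain with the difference of the values of a character at the last and at the
first argument. -/
def commutatorPrimitive (χ : Additive G →+ k) (n : ℕ) (a : cochains k G n) : cochains k G n :=
  ⟨fun x => a.1 x * (charFun χ (x (Fin.last n)) - charFun χ (x 0)), fun g x => by
    simp only [charFun_mul, add_sub_add_left_eq_sub]
    exact congrArg (· * _) (a.2 g x)⟩

theorem ev_commutatorPrimitive (χ : Additive G →+ k) (n : ℕ) (a : cochains k G n) (x : ℕ → G) :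
    ev (commutatorPrimitive χ n a) x = ev a x * (charFun χ (x n) - charFun χ (x 0)) := rfl

/-- The graded commutator of a cocycle with the cocycle of a character is a coboundary. -/
theorem diff_commutatorPrimitive (χ : Additive G →+ k) (n : ℕ) (a : cochains k G n)
    (ha : diff n a = 0) : diff n (commutatorPrimitive χ n a) =
      cup (add_comm 1 n) (charCochain χ) a - (-1 : k) ^ n • cup rfl a (charCochain χ) := by
  refine ext_ev fun x => ?_
  have key : ∑ i ∈ range (n + 2), (-1) ^ i * ev a (x ∘ skip i) = 0 := by
    have := congrArg (fun f => (-1) ^ (n + 1) * ev f x) ha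
    simp only [ev_diff, ← mul_assoc, neg_one_pow_mul_self, one_mul] at this
    exact this.trans (mul_zero _)
  change _ = ev (cup (add_comm 1 n) (charCochain χ) a) x -
    (-1) ^ n * ev (cup rfl a (charCochain χ)) x
  have e : ∀ i ∈ range n, (-1) ^ (i + 1) * ev (commutatorPrimitive χ n a) (x ∘ skip (i + 1)) =
      (-1) ^ (i + 1) * ev a (x ∘ skip (i + 1)) *
        (charFun χ (x (n + 1)) - charFun χ (x 0)) := fun i hi => by
    rw [mem_range] at hi
    simp only [ev_commutatorPrimitive, Function.comp, skip]
    rw [if_neg (by omega), if_pos (by omega), mul_assoc]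
  have hlast : ev a (x ∘ skip (n + 1)) = ev a x := ev_congr a fun j hj => by
    simp only [Function.comp, skip]
    rw [if_pos (by omega)]
  have hfirst : (x ∘ skip 0) = fun j => x (1 + j) := by
    funext j
    simp [skip, add_comm]
  rw [sum_range_succ, sum_range_succ', hlast, hfirst] at key
  rw [ev_diff, ev_cup, ev_cup, ev_charCochain, ev_charCochain, sum_range_succ, sum_range_succ',
    sum_congr rfl e, ← sum_mul, ev_commutatorPrimitive, ev_commutatorPrimitive, hlast, hfirst]
  simp only [Function.comp, skip, add_zero, zero_add, add_comm 1 n, if_pos (Nat.lt_succ_self n),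
    if_pos (Nat.succ_pos n), mul_one, one_mul, pow_zero]
  linear_combination (-(-1) ^ n * (charFun χ (x (n + 1)) - charFun χ (x 0))) * key

/-- The inhomogeneous cochain `q` of degree `1`, in homogeneous form. -/
def quadCochain (q : G → k) : cochains k G 1 :=
  ⟨fun x => q ((x 0)⁻¹ * x 1), fun g x => by
    simp only [mul_inv_rev, mul_assoc, inv_mul_cancel_left]⟩

theorem ev_quadCochain (q : G → k) (x : ℕ → G) : ev (quadCochain q) x = q ((x 0)⁻¹ * x 1) := rfl

theorem diff_quadCochain (χ : Additive G →+ k) {q : G → k}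
    (hq : ∀ g h, q (g * h) = q g + q h + charFun χ g * charFun χ h) :
    diff 1 (quadCochain q) = cup rfl (charCochain χ) (charCochain χ) := by
  refine ext_ev fun x => ?_
  have h := hq ((x 0)⁻¹ * x 1) ((x 1)⁻¹ * x 2)
  rw [mul_assoc, mul_inv_cancel_left] at h
  simp only [charFun_mul, charFun_inv] at h
  rw [ev_diff, ev_cup, ev_charCochain, ev_charCochain]
  simp [sum_range_succ, ev_quadCochain, skip, h]
  ring

/-- The classes of characters commute with all classes in the graded sense. -/
theorem clsRing_charCocycle_mul (χ : Additive G →+ k) (n : ℕ)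
    (c : (groupCochains k G).cocycles n) :
    (groupCochains k G).clsRing 1 (charCocycle χ) * (groupCochains k G).clsRing n c =
      (-1 : k) ^ n • ((groupCochains k G).clsRing n c *
        (groupCochains k G).clsRing 1 (charCocycle χ)) := by
  rw [DGAlg.clsRing_mul (add_comm 1 n), DGAlg.clsRing_mul rfl, ← map_smul, DGAlg.clsRing_eq_iff]
  exact ⟨_, diff_commutatorPrimitive χ n c.1 c.2⟩

/-- The class of a character has square zero if the character has a quadratic refinement. -/
theorem clsRing_charCocycle_mul_self (χ : Additive G →+ k) {q : G → k}
    (hq : ∀ g h, q (g * h) = q g + q h + charFun χ g * charFun χ h) :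
    (groupCochains k G).clsRing 1 (charCocycle χ) *
      (groupCochains k G).clsRing 1 (charCocycle χ) = 0 := by
  rw [DGAlg.clsRing_mul rfl, ← map_zero ((groupCochains k G).clsRing 2), DGAlg.clsRing_eq_iff]
  exact ⟨_, (diff_quadCochain χ hq).trans (sub_zero _).symm⟩

theorem charFun_add (χ χ' : Additive G →+ k) (x : G) :
    charFun (χ + χ') x = charFun χ x + charFun χ' x := rfl

theorem charFun_smul (c : k) (χ : Additive G →+ k) (x : G) :
    charFun (c • χ) x = c * charFun χ x := rfl

/-- The characters `χ` that have a quadratic refinement: a function with polar form `χ g * χ h`.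
They form a subspace; for a sum of two characters, the product of the two is added to the sum of the
refinements. -/
def quadChar (k G : Type u) [Field k] [CommGroup G] : Submodule k (Additive G →+ k) where
  carrier := {χ | ∃ q : G → k,
    ∀ g h, q (g * h) = q g + q h + charFun χ g * charFun χ h}
  add_mem' := by
    rintro χ χ' ⟨q, hq⟩ ⟨q', hq'⟩
    refine ⟨fun g => q g + q' g + charFun χ g * charFun χ' g, fun g h => ?_⟩
    beta_reduce
    rw [hq, hq', charFun_mul, charFun_mul, charFun_add, charFun_add]
    ring
  zero_mem' := ⟨0, fun _ _ => by simp [charFun]⟩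
  smul_mem' := by
    rintro c χ ⟨q, hq⟩
    refine ⟨fun g => c ^ 2 * q g, fun g h => ?_⟩
    beta_reduce
    rw [hq, charFun_smul, charFun_smul]
    ring

end Relations

section ExteriorMap

variable {d : ℕ} {χ : Fin d → Additive G →+ k}

/-- The algebra homomorphism from the exterior algebra to the cohomology ring that maps the
generators to the classes of the given characters. -/
noncomputable def charMap (hχ : ∀ l, χ l ∈ quadChar k G) :
    ExteriorAlgebra k (Fin d → k) →ₐ[k] (groupCochains k G).Cohomology :=
  ExteriorAlgebra.lift k ⟨(groupCochains k G).clsRing 1 ∘ₗ charCocycle ∘ₗ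
    Fintype.linearCombination k χ, fun v => by
      obtain ⟨q, hq⟩ : Fintype.linearCombination k χ v ∈ quadChar k G := by
        rw [Fintype.linearCombination_apply]
        exact sum_mem fun l _ => Submodule.smul_mem _ _ (hχ l)
      exact clsRing_charCocycle_mul_self _ hq⟩

theorem charMap_ι (hχ : ∀ l, χ l ∈ quadChar k G) (v : Fin d → k) :
    charMap hχ (ExteriorAlgebra.ι k v) = (groupCochains k G).clsRing 1
      (charCocycle (Fintype.linearCombination k χ v)) :=
  ExteriorAlgebra.lift_ι_apply _ _ _ _

/-- The basis elements of the exterior algebra are the ordered products of the generators. -/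
theorem extBasis_eq_ordProd (S : Finset (Fin d)) :
    DGAlg.extBasis k d S = ordProd (fun l => if h : l < d then
      ExteriorAlgebra.ι k (Pi.single (⟨l, h⟩ : Fin d) (1 : k)) else 0)
      (S.map Fin.valEmbedding) d := by
  have e : List.ofFn (fun i => S.orderEmbOfFin rfl i) = (List.finRange d).filter (· ∈ S) := by
    refine List.SortedLT.eq_of_mem_iff (List.sortedLT_ofFn_iff.2 (S.orderEmbOfFin rfl).strictMono)
      (List.Pairwise.sortedLT (List.Pairwise.filter _ (List.pairwise_lt_finRange d))) fun a => ?_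
    rw [List.mem_ofFn', Finset.range_orderEmbOfFin]
    simp
  rw [DGAlg.extBasis, ExteriorAlgebra.basis_apply_ofCard _ (rfl : S.card = S.card)]
  rw [ExteriorAlgebra.ιMulti_family, ExteriorAlgebra.ιMulti_apply]
  have e' : List.ofFn (fun i => ExteriorAlgebra.ι k (Pi.basisFun k (Fin d)
      (S.orderEmbOfFin rfl i))) = ((List.finRange d).filter (· ∈ S)).map
        fun l => ExteriorAlgebra.ι k (Pi.basisFun k (Fin d) l) := by
    rw [← e, List.map_ofFn]
    rfl
  refine (congrArg List.prod e').trans ?_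
  rw [ordProd, ← List.map_coe_finRange_eq_range, List.filter_map, List.map_map]
  refine congrArg List.prod ?_
  have e1 : ((fun x : ℕ => decide (x ∈ S.map Fin.valEmbedding)) ∘ fun x : Fin d => (x : ℕ)) =
      fun x => decide (x ∈ S) := by
    funext x
    exact decide_eq_decide.2 (mem_map' Fin.valEmbedding)
  rw [e1]
  refine List.map_congr_left fun l _ => ?_
  simp

end ExteriorMap

end TotalCochain

/-! ### Cochain algebras of the groups at the end of a chain of root towers -/

namespace TotalCochain

open GroupCochains Finset

theorem sum_powerset_range {M : Type*} [AddCommMonoid M] (d : ℕ) (f : Finset ℕ → M) :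
    ∑ S ∈ (range d).powerset, f S = ∑ S : Finset (Fin d), f (S.map Fin.valEmbedding) := by
  symm
  refine sum_bij (fun S _ => S.map Fin.valEmbedding) (fun S _ => ?_) (fun S _ S' _ h =>
    map_injective _ h) (fun S hS => ?_) fun _ _ => rfl
  · rw [mem_powerset]
    intro x hx
    obtain ⟨l, -, rfl⟩ := mem_map.1 hx
    exact mem_range.2 l.2
  · exact ⟨S.attachFin fun l hl => mem_range.1 (mem_powerset.1 hS hl), mem_univ _,
      map_valEmbedding_attachFin _⟩

variable {k : Type u} [Field k] {G K : Type u} [CommGroup G] [CommGroup K] {d : ℕ}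
  {χ : Fin d → Additive K →+ k}

/-- The extension of a finite family of characters by zero. -/
def extChar (χ : Fin d → Additive K →+ k) (l : ℕ) : Additive K →+ k :=
  if h : l < d then χ ⟨l, h⟩ else 0

theorem charMap_extBasis (hχ : ∀ l, χ l ∈ quadChar k K) (S : Finset (Fin d)) :
    charMap hχ (DGAlg.extBasis k d S) = ordProd (fun l => (groupCochains k K).clsRing 1
      (charCocycle (extChar χ l))) (S.map Fin.valEmbedding) d := by
  rw [extBasis_eq_ordProd]
  refine (map_ordProd (charMap hχ).toRingHom.toMonoidHom _ _ _).trans ?_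
  congr 1
  funext l
  change charMap hχ (if h : l < d then _ else 0) = _
  by_cases h : l < d
  · rw [extChar, dif_pos h, dif_pos h, charMap_ι, Fintype.linearCombination_apply_single, one_smul]
  · rw [extChar, dif_neg h, dif_neg h, map_zero, map_zero, map_zero]

/-- The class of a combination of products of characters with restrictions of cocycles. -/
theorem exists_sum_cupMon_eq (hχ : ∀ l, χ l ∈ quadChar k K) (ι : K →* G)
    (a : Finset ℕ → zcyc k G) :
    ∃ F : zcyc k K, F.1.1 = ∑ S ∈ (range d).powerset,
        cupMon (fun l => charFun (extChar χ l)) S d (pull ι (a S).1.1) ∧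
      ∀ n, cl n F = ∑ S : {S : Finset (Fin d) // S.card ≤ n},
        cl (n - S.1.card) (res ι (a (S.1.map Fin.valEmbedding))) *
          charMap hχ (DGAlg.extBasis k d S.1) := by
  choose F hF hF' using fun S => exists_cupMon_eq (extChar χ) S d (res ι (a S))
  refine ⟨∑ S ∈ (range d).powerset, F S, ?_, fun n => ?_⟩
  · rw [AddSubmonoidClass.coe_finsetSum, AddSubmonoidClass.coe_finsetSum]
    exact sum_congr rfl fun S _ => hF S
  · rw [map_sum, sum_powerset_range,
      ← sum_subtype (univ.filter fun S : Finset (Fin d) => S.card ≤ n) (by simp)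
        fun S => cl (n - S.card) (res ι (a (S.map Fin.valEmbedding))) *
          charMap hχ (DGAlg.extBasis k d S), sum_filter]
    refine sum_congr rfl fun S _ => ?_
    have hc : ((range d).filter (· ∈ S.map Fin.valEmbedding)).card = S.card := by
      rw [filter_mem_eq_inter, inter_eq_right.2, card_map]
      intro x hx
      obtain ⟨l, -, rfl⟩ := mem_map.1 hx
      exact mem_range.2 l.2
    rw [hF', hc, charMap_extBasis hχ]

variable {p : ℕ} [Fact p.Prime] [CharP k p] {A : ℕ → Subgroup G} {t : ℕ → ℕ → G} {r : ℕ → G → k}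

/-- If a chain of `d` root towers leads from `G` to the subgroup `K`, and the functions `r l`
restrict to characters of `K` with quadratic refinements, then the tensor product of the cochain
algebra of `G` with the exterior algebra on `d` generators maps to the cochain algebra of `K` by a
quasi-isomorphism that induces an isomorphism of cohomology rings. -/
theorem exists_quasiIso_of_isRootTower
    (h : ∀ m < d, IsRootTower p (A m) (A (m + 1)) (t m) (r m)) (h0 : A 0 = ⊤) {ι : K →* G}
    (hι : Function.Injective ι) (hd : A d = ι.range) (hχ : ∀ l, χ l ∈ quadChar k K)
    (hr : ∀ (l : Fin d) x, r l (ι x) = charFun (χ l) x) :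
    ∃ φ : ((groupCochains k G).tensor (exteriorDGAlg k d)).complex ⟶ (groupCochains k K).complex,
      QuasiIso φ ∧ DGAlg.InducesRingIso φ := by
  have hr' : ∀ l < d, ∀ x, r l (ι x) = charFun (extChar χ l) x := fun l hl x => by
    rw [extChar, dif_pos hl, ← hr ⟨l, hl⟩]
  refine DGAlg.exists_quasiIso_of_exterior (resCochain_d ι) (resCochain_mul ι) (f := charMap hχ)
    (fun v => ⟨_, (charMap_ι hχ v).symm⟩) (fun v n c => ?_) (fun n b => ?_) fun n a ha => ?_
  · rw [charMap_ι]
    exact clsRing_charCocycle_mul _ _ _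
  · obtain ⟨F, hF, hdF, hFb⟩ := exists_pull_eq ι hι (single n b).1.2
      ((mem_zcyc_iff _).1 (single n b).2)
    obtain ⟨a, ha, hda, g, hg, he⟩ := exists_eq_sum_cupMon_add_dT h le_rfl (hd ▸ hF) hdF
    let a' : Finset ℕ → zcyc k G := fun S => ⟨⟨a S, h0 ▸ ha S⟩, (mem_zcyc_iff _).2 (hda S)⟩
    obtain ⟨F', hF', hcl⟩ := exists_sum_cupMon_eq hχ ι a'
    have hz := cl_eq_of_dInv_eq (F := single n b) (F' := F')
      (w := ⟨pull ι g, pull_mem_inv ι (hd ▸ hg)⟩) (Subtype.ext ?_) n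
    · rw [hcl] at hz
      refine ⟨fun S => compCocycle _ (a' (S.1.map Fin.valEmbedding)), ?_⟩
      have hb : cl n (single n b) = (groupCochains k K).clsRing n b :=
        congrArg ((groupCochains k K).clsRing n) (compCocycle_single_self n b)
      rw [← hb, hz]
      exact sum_congr rfl fun S _ => by rw [cl_res]
    · change dT (pull ι g) = (single n b).1.1 - F'.1.1
      rw [hF', ← hFb, he, map_add, map_sum, dT_pull, eq_sub_iff_add_eq, add_comm]
      congr 1
      exact sum_congr rfl fun S _ => (pull_cupMon ι hr' S _).symm
  · let aF : Finset (Fin d) → zcyc k G := fun S =>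
      if hS : S.card ≤ n then single (n - S.card) (a ⟨S, hS⟩) else 0
    let a' : Finset ℕ → zcyc k G := fun T => aF (univ.filter fun l : Fin d => (l : ℕ) ∈ T)
    have ha' : ∀ S : Finset (Fin d), a' (S.map Fin.valEmbedding) = aF S := fun S => by
      refine congrArg aF ?_
      ext l
      rw [mem_filter]
      exact (and_iff_right (mem_univ _)).trans (mem_map' Fin.valEmbedding)
    obtain ⟨F, hF, hcl⟩ := exists_sum_cupMon_eq hχ ι a'
    have hF0 : ∀ N, cl N F = 0 := fun N => by
      rw [hcl]
      obtain rfl | hN := eq_or_ne N n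
      · rw [← ha]
        refine sum_congr rfl fun S _ => ?_
        rw [ha', cl_res]
        simp only [aF, dif_pos S.2, compCocycle_single_self]
      · refine sum_eq_zero fun S _ => ?_
        have hS : compCocycle (N - S.1.card) (aF S.1) = 0 := by
          simp only [aF]
          split_ifs with hS
          · exact compCocycle_single_of_ne (by have := S.2; omega) _
          · exact map_zero _
        rw [ha', cl_res, hS, map_zero, map_zero, zero_mul]
    obtain ⟨w, hw⟩ := (forall_cl_eq_zero_iff F).1 hF0
    have hm : ∀ S, (a' S).1.1 ∈ inv k (A 0) := fun S => by
      rw [h0]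
      exact (a' S).1.2
    have hz : ∀ S, dT (a' S).1.1 = 0 := fun S => (mem_zcyc_iff _).1 (a' S).2
    obtain ⟨g, hg, hg'⟩ := exists_dT_eq_of_pull_eq_dT ι hι
      (by rw [← hd]; exact sum_cupMon_mem_inv h le_rfl hm) (dT_sum_cupMon h le_rfl hm hz) w.2 (by
        rw [show dT w.1 = F.1.1 from congrArg Subtype.val hw, hF, map_sum]
        exact sum_congr rfl fun S _ => pull_cupMon ι hr' S _)
    intro S
    obtain ⟨u, hu, hdu⟩ := exists_dT_eq_of_sum_cupMon_eq_dT h le_rfl hm hz (hd ▸ hg) hg'.symm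
      (S.1.map Fin.valEmbedding) (mem_powerset.2 fun x hx => by
        obtain ⟨l, -, rfl⟩ := mem_map.1 hx
        exact mem_range.2 l.2)
    have hc := (forall_cl_eq_zero_iff (aF S.1)).2
      ⟨⟨u, h0 ▸ hu⟩, Subtype.ext (hdu.trans (by rw [ha']))⟩ (n - S.1.card)
    rw [cl_eq_zero_iff] at hc
    have e : compCocycle (n - S.1.card) (aF S.1) = a S := by
      simp only [aF, dif_pos S.2, compCocycle_single_self]
    rw [← e]
    exact hc

end TotalCochain

/-! ### Finite abelian groups -/

section Residues

open TotalCochain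

variable {p : ℕ} [Fact p.Prime]

/-- The carry from the lowest binary digits is their product. -/
theorem quadratic_refinement_zmod_four : ∀ a b : ZMod 4,
    (if 2 ≤ (a + b).val then (1 : ZMod 2) else 0) =
      (if 2 ≤ a.val then 1 else 0) + (if 2 ≤ b.val then 1 else 0) +
        ZMod.castHom (show 2 ∣ 4 by decide) (ZMod 2) a *
          ZMod.castHom (show 2 ∣ 4 by decide) (ZMod 2) b := by
  decide

/-- The residue modulo `p` has the quadratic refinement `a ^ 2 / 2` if `p` is odd. If `p = 2`, then
the second binary digit is one; it is defined only modulo `4`. -/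
theorem exists_quadratic_refinement_zmod {n : ℕ} (hn : 0 < n) (hn₂ : p = 2 → 1 < n) :
    ∃ q : ZMod (p ^ n) → ZMod p, ∀ a b, q (a + b) = q a + q b +
      ZMod.castHom (dvd_pow_self p hn.ne') (ZMod p) a *
        ZMod.castHom (dvd_pow_self p hn.ne') (ZMod p) b := by
  by_cases hp : p = 2
  · subst hp
    have h4 : 2 ^ 2 ∣ 2 ^ n := pow_dvd_pow 2 (hn₂ rfl)
    refine ⟨fun a => if 2 ≤ (ZMod.castHom h4 (ZMod 4) a).val then 1 else 0, fun a b => ?_⟩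
    beta_reduce
    rw [map_add, quadratic_refinement_zmod_four]
    have hc : (ZMod.castHom (show 2 ∣ 4 by decide) (ZMod 2)).comp (ZMod.castHom h4 (ZMod 4)) =
      ZMod.castHom (dvd_pow_self 2 hn.ne') (ZMod 2) := Subsingleton.elim _ _
    rw [← hc]
    rfl
  · have h2 : (2 : ZMod p) ≠ 0 := fun h => hp <| by
      have := (ZMod.natCast_eq_zero_iff 2 p).1 (by exact_mod_cast h)
      exact (Nat.prime_dvd_prime_iff_eq Fact.out Nat.prime_two).1 this
    refine ⟨fun a => (ZMod.castHom (dvd_pow_self p hn.ne') (ZMod p) a) ^ 2 / 2, fun a b => ?_⟩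
    beta_reduce
    rw [map_add]
    field_simp
    ring

/-- The cochain algebra of an abelian `p`-group of rank `d` is quasi-isomorphic to `U(p, d)`, by a
map that induces an isomorphism of cohomology rings. -/
theorem exists_quasiIso_universalDGAlg (p : ℕ) [Fact p.Prime] {d : ℕ} {K : Type} [CommGroup K]
    {i : Fin d → ℕ} (hi : ∀ l, 0 < i l) (hi₂ : p = 2 → ∀ l, 1 < i l)
    (e : K ≃* ((l : Fin d) → Multiplicative (ZMod (p ^ i l)))) :
    ∃ φ : (universalDGAlg p d).complex ⟶ (groupCochains (ZMod p) K).complex,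
      QuasiIso φ ∧ DGAlg.InducesRingIso φ := by
  obtain ⟨t, r, h, hr⟩ := exists_isRootTower p i hi
  let χ : Fin d → Additive K →+ ZMod p := fun l => AddMonoidHom.mk'
    (fun x => residue p (hi l) (e x.toMul l)) fun x y => by
      rw [toMul_add, map_mul, Pi.mul_apply, residue_mul]
  refine exists_quasiIso_of_isRootTower h (pruferChain_zero p i)
    (ι := (pruferProdEmb p i).comp e.toMonoidHom) (χ := χ)
    ((pruferProdEmb_injective p i).comp e.injective) ?_ (fun l => ?_) fun l x => hr l (e x)
  · rw [pruferChain_last, MonoidHom.range_comp,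
      MonoidHom.range_eq_top.2 (show Function.Surjective e.toMonoidHom from e.surjective),
      MonoidHom.range_eq_map]
  · obtain ⟨q, hq⟩ := exists_quadratic_refinement_zmod (hi l) fun hp => hi₂ hp l
    refine ⟨fun x => q (e x l).toAdd, fun x y => ?_⟩
    beta_reduce
    rw [map_mul, Pi.mul_apply, toAdd_mul, hq]
    rfl

end Residues

theorem mainTheorem6 (p : ℕ) [Fact p.Prime] (d : ℕ) (hd : d < p)
    (K K' : Type) [CommGroup K] [CommGroup K']
    (i j : Fin d → ℕ) (hi : ∀ l, 0 < i l) (hj : ∀ l, 0 < j l)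
    (hi₂ : p = 2 → ∀ l, 1 < i l) (hj₂ : p = 2 → ∀ l, 1 < j l)
    (hK : Nonempty (K ≃* ((l : Fin d) → Multiplicative (ZMod (p ^ i l)))))
    (hK' : Nonempty (K' ≃* ((l : Fin d) → Multiplicative (ZMod (p ^ j l))))) :
    ∃ (φ : (universalDGAlg p d).complex ⟶ (groupCochains (ZMod p) K).complex)
      (φ' : (universalDGAlg p d).complex ⟶ (groupCochains (ZMod p) K').complex),
      QuasiIso φ ∧ QuasiIso φ' ∧ DGAlg.InducesRingIso φ ∧ DGAlg.InducesRingIso φ' := by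
  obtain ⟨e⟩ := hK
  obtain ⟨e'⟩ := hK'
  obtain ⟨φ, hφ, hφ'⟩ := exists_quasiIso_universalDGAlg p hi hi₂ e
  obtain ⟨ψ, hψ, hψ'⟩ := exists_quasiIso_universalDGAlg p hj hj₂ e'
  exact ⟨φ, ψ, hφ, hψ, hφ', hψ'⟩
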